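/- Let $(\Omega,\mathcal F,\{\mathcal F_t\}_{t\ge 0},\mathrm P)$ be a filtered probability space, and let $\lambda,\delta,u_0>0$. Let $0=T_0<T_1<T_2<\cdots\to\infty$ be claim times whose waiting times $T_{i+1}-T_i$ ($i\ge 0$) are exponential with mean $1/\lambda$, and let $Y_1,Y_2,\dots$ be nonnegative claim sizes with common distribution function $Q$, all waiting times and claim sizes being independent. Let $N(t)=\#\{i\ge 1: T_i\le t\}$ and $S(t)=\sum_{i=1}^{N(t)}Y_i$. Assume that $N$ and $S$ are adapted and that, for $s\le t$, the increment $(N(t)-N(s),S(t)-S(s))$ is independent of $\mathcal F_s$. Assume also that $Q$ is continuous on $[0,\infty)$ (that is, $\mathrm P(Y_1=y)=0$ for every $y>0$). Let $g$ be Lipschitz continuous on $[0,\infty)$ with $g(x)>u_0$ for all $x\ge 0$. Let $\Pi_R$ be the set of dividend schemes $D(t)=\int_0^t u(s)\,ds$, where $u$ is a jointly measurable adapted process with $0\le u(t)\le u_0$ and $D$ is adapted. For $x\ge 0$ and $D\in\Pi_R$ let $X^D$ be the surplus process, which satisfies, up to ruin, $$X^D(t)=x+\int_0^t g(X^D(s))\,ds-\sum_{i=1}^{N(t)}Y_i-D(t),$$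 and let $\tau=\inf\{t\ge 0: X^D(t)<0\}$ be the ruin time, with $\inf\varnothing=+\infty$. Put $$V_R(x)=\sup_{D\in\Pi_R}\mathrm E\int_0^{\tau}e^{-\delta t}u(t)\,dt,\qquad x\ge 0 .$$ Then $V_R$ is continuously differentiable on $[0,\infty)$ (with the one-sided derivative at $0$), and for every $x\ge 0$ $$\sup_{0\le u\le u_0}\Big\{(g(x)-u)V_R'(x)-(\lambda+\delta)V_R(x)+\lambda\int_{[0,x]}V_R(x-y)\,dQ(y)+u\Big\}=0 .$$ -/

import Mathlib

open Set Filter MeasureTheory ProbabilityTheory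
open scoped NNReal Topology

namespace PDCP

noncomputable section

/-- `N(t)`: the number of claim times `T i`, `i ≥ 1`, in `[0, t]`. -/
def claimCount {Ω : Type*} (T : ℕ → Ω → ℝ) (t : ℝ) (ω : Ω) : ℕ :=
  {i : ℕ | 1 ≤ i ∧ T i ω ≤ t}.ncard

/-- `S(t) = ∑_{i = 1}^{N(t)} Y i`: the aggregate claims up to time `t`. -/
def claimTotal {Ω : Type*} (T Y : ℕ → Ω → ℝ) (t : ℝ) (ω : Ω) : ℝ :=
  ∑ i ∈ Finset.Icc 1 (claimCount T t ω), Y i ω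

/-- `T 0 = 0 < T 1 < T 2 < ⋯` are the claim times and `Y 1, Y 2, …` the claim sizes of a compound
Poisson process with intensity `lam` and claim size law `Q`, relative to the filtration `𝓕`
(`Y 0` plays no role). -/
structure IsCompoundPoisson {Ω : Type*} [mΩ : MeasurableSpace Ω] (P : Measure Ω)
    (𝓕 : Filtration ℝ≥0 mΩ) (lam : ℝ) (Q : Measure ℝ) (T Y : ℕ → Ω → ℝ) : Prop where
  measurable_time : ∀ i, Measurable (T i)
  measurable_size : ∀ i, Measurable (Y (i + 1))
  time_zero : ∀ ω, T 0 ω = 0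
  strictMono_time : ∀ ω, StrictMono fun i => T i ω
  tendsto_time : ∀ ω, Tendsto (fun i => T i ω) atTop atTop
  size_nonneg : ∀ i ω, 0 ≤ Y (i + 1) ω
  /-- the waiting times are exponential with mean `1 / lam` -/
  law_waiting : ∀ i, P.map (fun ω => T (i + 1) ω - T i ω) = expMeasure lam
  /-- the claim sizes have law `Q` -/
  law_size : ∀ i, P.map (Y (i + 1)) = Q
  /-- all waiting times and all claim sizes together are independent -/
  indep : iIndepFun
    (fun (j : ℕ ⊕ ℕ) (ω : Ω) => Sum.elim (fun i => T (i + 1) ω - T i ω) (fun i => Y (i + 1) ω) j) P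
  /-- `N` and `S` are adapted -/
  adapted_count : ∀ t : ℝ≥0, Measurable[𝓕 t] (claimCount T t)
  adapted_total : ∀ t : ℝ≥0, Measurable[𝓕 t] (claimTotal T Y t)
  /-- the increments of `(N, S)` over `(s, t]` are independent of the information at time `s` -/
  indep_increment : ∀ s t : ℝ≥0, s ≤ t →
    Indep (MeasurableSpace.comap
      (fun ω => ((claimCount T t ω : ℤ) - claimCount T s ω, claimTotal T Y t ω - claimTotal T Y s ω))
      inferInstance) (𝓕 s) P

/-- `u` is the rate of a restricted dividend scheme: a measurable adapted process with values in
`[0, u₀]`, such that the aggregate dividends `D(t) = ∫_0^t u(s) ds` are adapted. Only times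
`t ≥ 0` matter. -/
structure IsRestrictedRate {Ω : Type*} [mΩ : MeasurableSpace Ω] (𝓕 : Filtration ℝ≥0 mΩ) (u₀ : ℝ)
    (u : ℝ → Ω → ℝ) : Prop where
  measurable : Measurable (Function.uncurry u)
  adapted : ∀ t : ℝ≥0, Measurable[𝓕 t] (u t)
  mem_Icc : ∀ t, 0 ≤ t → ∀ ω, u t ω ∈ Icc 0 u₀
  adapted_dividends : ∀ t : ℝ≥0, Measurable[𝓕 t] fun ω => ∫ s in (0 : ℝ)..t, u s ω

/-- `X` is the surplus process with initial surplus `x` under the dividend rate `u`: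
`X(t) = x + ∫_0^t g(X(s)) ds - S(t) - ∫_0^t u(s) ds` for `t ≥ 0`.
What happens after ruin has no influence on the dividends; `g` need only be meaningful on `[0, ∞)`,
and the premium rate at a negative surplus is frozen at `g 0`, so that the equation determines a
process on all of `[0, ∞)`. -/
structure IsSurplus {Ω : Type*} [mΩ : MeasurableSpace Ω] (𝓕 : Filtration ℝ≥0 mΩ) (g : ℝ → ℝ)
    (T Y : ℕ → Ω → ℝ) (x : ℝ) (u X : ℝ → Ω → ℝ) : Prop where
  adapted : ∀ t : ℝ≥0, Measurable[𝓕 t] (X t)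
  integrable : ∀ ω, ∀ t, 0 ≤ t → IntervalIntegrable (fun s => g (max (X s ω) 0)) volume 0 t
  equation : ∀ ω, ∀ t, 0 ≤ t →
    X t ω = x + (∫ s in (0 : ℝ)..t, g (max (X s ω) 0)) - claimTotal T Y t ω - ∫ s in (0 : ℝ)..t, u s ω

/-- The ruin time `inf {t ≥ 0 : X(t) < 0}` of a path, with `inf ∅ = +∞`. -/
def ruinTime (X : ℝ → ℝ) : EReal :=
  sInf ((fun t : ℝ => (t : EReal)) '' {t : ℝ | 0 ≤ t ∧ X t < 0})

/-- The expected present value `E ∫_0^τ e^{-δ t} u(t) dt` of the dividends up to the ruin time `τ`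
of `X`. -/
def dividendValue {Ω : Type*} [MeasurableSpace Ω] (P : Measure Ω) (δ : ℝ) (u X : ℝ → Ω → ℝ) : ℝ :=
  ∫ ω, (∫ t in {t : ℝ | 0 ≤ t ∧ (t : EReal) < ruinTime fun s => X s ω},
    Real.exp (-δ * t) * u t ω) ∂P

/-- The value function `V_R(x)`: the supremum over all restricted dividend schemes of the expected
present value of the dividends up to ruin, for the initial surplus `x`. -/
def restrictedValue {Ω : Type*} [mΩ : MeasurableSpace Ω] (P : Measure Ω) (𝓕 : Filtration ℝ≥0 mΩ)
    (g : ℝ → ℝ) (T Y : ℕ → Ω → ℝ) (δ u₀ : ℝ) (x : ℝ) : ℝ :=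
  sSup {J : ℝ | ∃ u X : ℝ → Ω → ℝ,
    IsRestrictedRate 𝓕 u₀ u ∧ IsSurplus 𝓕 g T Y x u X ∧ J = dividendValue P δ u X}

end

end PDCP

/-!
The value function is identified with a bounded `C¹` solution `W` of the Hamilton-Jacobi-Bellman
(HJB) equation, which is constructed analytically and then compared with the value of arbitrary
dividend schemes; no dynamic programming principle is needed. Since the HJB expression is affine
in `u`, the equation reads `max (g W') ((g - u₀) W' + u₀) = (λ + δ) W - λ ∫_{[0,x]} W (x - y)
dQ(y)`.

*Existence of `W`.* As `g > u₀`, the equation can be solved for `W'`, in the form `W' = k W -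
F(W)` with `k = (λ + δ) / (g - u₀)` and an operator `F` that is monotone in `W`. It is solved by
the fixed points of `f ↦ e^{K(x)} ∫_x^∞ e^{-K(s)} F(f)(s) ds` with `K' = k`, a monotone operator
that maps functions with values in `[0, u₀ / δ]` to such functions. Iteration from `0` converges
to a fixed point (`exists_hjbStep_eq_self`). Fixed points are continuous, and since `Q` has no
atoms in `(0, ∞)` so is the claim mean `∫_{[0,x]} W (x - y) dQ(y)`; hence `W` is `C¹`
(`exists_hjb_solution`).

*Verification.* The change of `e^{-δ t} W(X(t)) 1_{t < τ}` plus the discounted dividends is summed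
over short time steps of length `η`. In a step without a claim the path is Lipschitz, and a Taylor
expansion of `W` applies. A step with one claim, of probability about `λ η`, changes `W(X)` into
`W(X - y)`, or into `0` at ruin; a step with several claims has probability `O(η²)`. The increment
of the claim process over a step is independent of the past, so its law may be used with the
current surplus frozen: the jumps contribute `λ η (∫ W (X - y) dQ(y) - W(X))`, and the total is at
most `o(η)`, with equality if the rate attains the maximum in the HJB equation
(`integral_valueChange_le`). Summing the steps and letting `η → 0` and then `t → ∞` bounds the
value of every scheme by `W` (`dividendValue_le`).

*Optimality.* The maximising rate `u₀ 1_{W' < 1}` is discontinuous, and the surplus equation may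
fail to have a solution under it. A continuous feedback rate `v(X)` loses arbitrarily little in
the HJB equation, and the equation `X' = g(X) - v(X) > 0` is solved between claims by inverting
the travel time, without a Lipschitz condition on `v` (`exists_flow`, `exists_feedback`). The same
step-by-step estimate from below (`le_dividendValue_add`) shows that the value of this scheme is
nearly `W(x)`. Thus `V_R = W` on `[0, ∞)` (`restrictedValue_eq`).
-/

namespace PDCP

/-! ### A bounded continuously differentiable solution of the Hamilton-Jacobi-Bellman equation -/

/-- The expected value `∫_{[0,x]} f (x - y) dQ(y)` of `f` just after a claim that strikes at surplus
`x` and does not cause ruin. -/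
noncomputable def claimMean (Q : Measure ℝ) (f : ℝ → ℝ) (x : ℝ) : ℝ :=
  ∫ y in Icc 0 x, f (x - y) ∂Q

section ClaimMean

variable {Q : Measure ℝ} {f f' : ℝ → ℝ} {M : ℝ}

lemma claimMean_eq_integral_indicator (x : ℝ) :
    claimMean Q f x = ∫ y, (Icc 0 x).indicator (fun y => f (x - y)) y ∂Q :=
  (integral_indicator measurableSet_Icc).symm

lemma claimMean_nonneg (hf : ∀ x, 0 ≤ f x) (x : ℝ) : 0 ≤ claimMean Q f x :=
  integral_nonneg fun _ => hf _

lemma integrableOn_claimMean [IsFiniteMeasure Q] (hm : Measurable f) (hf : ∀ x, f x ∈ Icc 0 M)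
    (x : ℝ) : IntegrableOn (fun y => f (x - y)) (Icc 0 x) Q := by
  refine Integrable.of_bound (hm.comp (measurable_const.sub measurable_id)).aestronglyMeasurable M
    (ae_of_all _ fun y => ?_)
  rw [Real.norm_eq_abs, abs_of_nonneg (hf _).1]
  exact (hf _).2

lemma claimMean_mono [IsFiniteMeasure Q] (hm : Measurable f) (hf : ∀ x, f x ∈ Icc 0 M)
    (hm' : Measurable f') (hf' : ∀ x, f' x ∈ Icc 0 M) (h : ∀ x, f x ≤ f' x) (x : ℝ) :
    claimMean Q f x ≤ claimMean Q f' x :=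
  integral_mono (integrableOn_claimMean hm hf x) (integrableOn_claimMean hm' hf' x) fun _ => h _

lemma claimMean_le [IsProbabilityMeasure Q] (hM : 0 ≤ M) (hm : Measurable f)
    (hf : ∀ x, f x ∈ Icc 0 M) (x : ℝ) : claimMean Q f x ≤ M := by
  calc claimMean Q f x ≤ ∫ _ in Icc 0 x, M ∂Q :=
        integral_mono (integrableOn_claimMean hm hf x) (integrable_const _) fun _ => (hf _).2
    _ = Q.real (Icc 0 x) * M := by simp
    _ ≤ 1 * M := by gcongr; exact measureReal_le_one
    _ = M := one_mul M

lemma measurable_claimMean [SFinite Q] (hm : Measurable f) : Measurable (claimMean Q f) := by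
  have h1 : claimMean Q f = fun x => ∫ y, (({p : ℝ × ℝ | 0 ≤ p.2 ∧ p.2 ≤ p.1}).indicator
      (fun p => f (p.1 - p.2)) (x, y)) ∂Q := by
    funext x
    rw [claimMean_eq_integral_indicator]
    rfl
  rw [h1]
  refine StronglyMeasurable.measurable
    (StronglyMeasurable.integral_prod_right (f := fun x y => _) ?_)
  refine Measurable.stronglyMeasurable (Measurable.indicator ?_ ?_)
  · exact hm.comp (measurable_fst.sub measurable_snd)
  · exact (measurableSet_le measurable_const measurable_snd).inter
      (measurableSet_le measurable_snd measurable_fst)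

/-- The only discontinuity of `x ↦ 1_{[0, x]}(y) f (x - y)` is at `x = y`; it is removed by the
absence of atoms on `(0, ∞)`, and at `y = 0` by not letting `x` be negative. -/
lemma continuous_claimMean_max [IsFiniteMeasure Q] (hQ : ∀ y, 0 < y → Q {y} = 0)
    (hc : Continuous f) (hf : ∀ x, f x ∈ Icc 0 M) :
    Continuous fun x => claimMean Q f (max x 0) := by
  simp only [claimMean_eq_integral_indicator]
  rw [continuous_iff_continuousAt]
  intro x₀
  refine continuousAt_of_dominated (bound := fun _ => M) (Eventually.of_forall fun x => ?_)
    (Eventually.of_forall fun x => ae_of_all _ fun y => ?_) (integrable_const _) ?_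
  · exact ((hc.measurable.comp (measurable_const.sub measurable_id)).indicator
      measurableSet_Icc).aestronglyMeasurable
  · rw [Real.norm_eq_abs]
    by_cases hy : y ∈ Icc 0 (max x 0)
    · rw [indicator_of_mem hy, abs_of_nonneg (hf _).1]
      exact (hf _).2
    · rw [indicator_of_notMem hy, abs_zero]
      exact (hf 0).1.trans (hf 0).2
  · have hae : ∀ᵐ y ∂Q, ¬ (0 < y ∧ y = max x₀ 0) := by
      rcases (le_max_right x₀ 0).eq_or_lt with h | h
      · exact ae_of_all _ fun y hy => by rw [hy.2, ← h] at hy; exact lt_irrefl _ hy.1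
      · have : ∀ᵐ y ∂Q, y ≠ max x₀ 0 := by
          rw [ae_iff]
          simpa using hQ _ h
        filter_upwards [this] with y hy h' using hy h'.2
    filter_upwards [hae] with y hy
    have hmax : Continuous fun x : ℝ => max x 0 := continuous_id.max continuous_const
    have hcomp : ContinuousAt (fun x => f (max x 0 - y)) x₀ :=
      (hc.comp (hmax.sub continuous_const)).continuousAt
    rcases lt_trichotomy y 0 with h0 | h0 | h0
    · refine continuousAt_const.congr (f := fun _ => (0 : ℝ)) (Eventually.of_forall fun x => ?_)
      simp only
      rw [indicator_of_notMem]
      exact fun h => absurd h.1 (not_le.2 h0)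
    · refine hcomp.congr (Eventually.of_forall fun x => ?_)
      simp only
      rw [indicator_of_mem]
      exact ⟨h0.ge, h0 ▸ le_max_right _ _⟩
    · have hne : y ≠ max x₀ 0 := fun h => hy ⟨h0, h⟩
      rcases lt_or_gt_of_ne hne with h | h
      · refine hcomp.congr ?_
        filter_upwards [hmax.continuousAt.eventually (lt_mem_nhds h)] with x hx
        rw [indicator_of_mem]
        exact ⟨h0.le, hx.le⟩
      · refine continuousAt_const.congr (f := fun _ => (0 : ℝ)) ?_
        filter_upwards [hmax.continuousAt.eventually (gt_mem_nhds h)] with x hx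
        rw [indicator_of_notMem]
        exact fun h => absurd h.2 (not_le.2 hx)

end ClaimMean

section Hjb

variable (Q : Measure ℝ) (c : ℝ → ℝ) (lam δ u₀ : ℝ)

/-- The integrated discount rate `∫_0^x (λ + δ) / (c - u₀)` along the slowest possible path of the
surplus. -/
noncomputable def slowDiscount (x : ℝ) : ℝ := ∫ t in (0 : ℝ)..x, (lam + δ) / (c t - u₀)

/-- With `m` standing for `∫_{[0,s]} f (s - y) dQ(y)` and `w` for `f s`, the equation
`sup_u {(c - u) f' - (λ + δ) f + λ m + u} = 0` reads
`f' = (λ + δ) / (c - u₀) * f - hjbSource s w m`. This function is monotone in `w` and `m`. -/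
noncomputable def hjbSource (s w m : ℝ) : ℝ :=
  max (((lam + δ) / (c s - u₀) * u₀ * w + lam * m) / c s) ((lam * m + u₀) / (c s - u₀))

/-- Variation of constants turns the equation `f' = (λ + δ) / (c - u₀) * f - hjbSource` into the
fixed point equation of this monotone operator. -/
noncomputable def hjbStep (f : ℝ → ℝ) (x : ℝ) : ℝ :=
  Real.exp (slowDiscount c lam δ u₀ x) * ∫ s in Ioi x,
    Real.exp (-slowDiscount c lam δ u₀ s) * hjbSource c lam δ u₀ s (f s) (claimMean Q f (max s 0))

variable {Q c lam δ u₀} {f f' : ℝ → ℝ}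

lemma hjbSource_mono (hlam : 0 < lam) (hδ : 0 < δ) (hu₀ : 0 < u₀) (hcu : ∀ x, u₀ < c x)
    (s : ℝ) {w w' m m' : ℝ} (hw : w ≤ w') (hm : m ≤ m') :
    hjbSource c lam δ u₀ s w m ≤ hjbSource c lam δ u₀ s w' m' := by
  have h1 : 0 < c s - u₀ := sub_pos.2 (hcu s)
  have h2 : 0 < c s := hu₀.trans (hcu s)
  unfold hjbSource
  gcongr

lemma hjbSource_nonneg (hlam : 0 < lam) (hu₀ : 0 < u₀) (hcu : ∀ x, u₀ < c x)
    (s : ℝ) {w m : ℝ} (hm : 0 ≤ m) : 0 ≤ hjbSource c lam δ u₀ s w m := by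
  have h1 : 0 < c s - u₀ := sub_pos.2 (hcu s)
  exact le_max_of_le_right (by positivity)

lemma hjbSource_le (hlam : 0 < lam) (hδ : 0 < δ) (hu₀ : 0 < u₀) (hcu : ∀ x, u₀ < c x)
    (s : ℝ) {w m : ℝ} (hw : w ≤ u₀ / δ) (hm : m ≤ u₀ / δ) :
    hjbSource c lam δ u₀ s w m ≤ u₀ / δ * ((lam + δ) / (c s - u₀)) := by
  refine (hjbSource_mono hlam hδ hu₀ hcu s hw hm).trans ?_
  have h1 : 0 < c s - u₀ := sub_pos.2 (hcu s)
  have h2 : 0 < c s := hu₀.trans (hcu s)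
  unfold hjbSource
  refine max_le ?_ ?_
  · rw [div_le_iff₀ h2]
    have h3 : u₀ / δ * ((lam + δ) / (c s - u₀)) * c s - ((lam + δ) / (c s - u₀) * u₀ * (u₀ / δ)
        + lam * (u₀ / δ)) = u₀ := by
      field_simp
      ring
    linarith
  · apply le_of_eq
    field_simp

lemma measurable_hjbSource (hc : Measurable c) {w m : ℝ → ℝ} (hw : Measurable w)
    (hm : Measurable m) : Measurable fun s => hjbSource c lam δ u₀ s (w s) (m s) := by
  unfold hjbSource
  fun_prop

lemma continuous_hjbSource (hc : Continuous c) (hu₀ : 0 < u₀) (hcu : ∀ x, u₀ < c x) {w m : ℝ → ℝ}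
    (hw : Continuous w) (hm : Continuous m) :
    Continuous fun s => hjbSource c lam δ u₀ s (w s) (m s) := by
  have h1 : ∀ s, c s - u₀ ≠ 0 := fun s => (sub_pos.2 (hcu s)).ne'
  have h2 : ∀ s, c s ≠ 0 := fun s => (hu₀.trans (hcu s)).ne'
  unfold hjbSource
  fun_prop (disch := assumption)

lemma hasDerivAt_slowDiscount (hc : Continuous c) (hcu : ∀ x, u₀ < c x) (x : ℝ) :
    HasDerivAt (slowDiscount c lam δ u₀) ((lam + δ) / (c x - u₀)) x := by
  have h1 : Continuous fun t => (lam + δ) / (c t - u₀) :=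
    continuous_const.div (hc.sub continuous_const) fun s => (sub_pos.2 (hcu s)).ne'
  exact (h1.integral_hasStrictDerivAt 0 x).hasDerivAt

lemma continuous_slowDiscount (hc : Continuous c) (hcu : ∀ x, u₀ < c x) :
    Continuous (slowDiscount c lam δ u₀) :=
  continuous_iff_continuousAt.2 fun x => (hasDerivAt_slowDiscount hc hcu x).continuousAt

lemma integrableOn_and_integral_le_exp_neg_slowDiscount (hc : Continuous c) (hlam : 0 < lam)
    (hδ : 0 < δ) (hcu : ∀ x, u₀ < c x) (x : ℝ) :
    IntegrableOn (fun s => Real.exp (-slowDiscount c lam δ u₀ s) * ((lam + δ) / (c s - u₀)))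
      (Ioi x) ∧
    ∫ s in Ioi x, Real.exp (-slowDiscount c lam δ u₀ s) * ((lam + δ) / (c s - u₀))
      ≤ Real.exp (-slowDiscount c lam δ u₀ x) := by
  have hpos : ∀ s, 0 ≤ Real.exp (-slowDiscount c lam δ u₀ s) * ((lam + δ) / (c s - u₀)) := by
    intro s
    have h1 : 0 < c s - u₀ := sub_pos.2 (hcu s)
    positivity
  have hd : ∀ s, HasDerivAt (fun s => -Real.exp (-slowDiscount c lam δ u₀ s))
      (Real.exp (-slowDiscount c lam δ u₀ s) * ((lam + δ) / (c s - u₀))) s := by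
    intro s
    refine (hasDerivAt_slowDiscount (lam := lam) (δ := δ) hc hcu s).fun_neg.exp.fun_neg.congr_deriv
        ?_
    ring
  have hmono : Monotone (fun s => -Real.exp (-slowDiscount c lam δ u₀ s)) :=
    monotone_of_hasDerivAt_nonneg hd fun s => hpos s
  have hbdd : BddAbove (range (fun s => -Real.exp (-slowDiscount c lam δ u₀ s))) := by
    refine ⟨0, ?_⟩
    rintro _ ⟨s, rfl⟩
    exact neg_nonpos.2 (Real.exp_pos _).le
  have hlim := tendsto_atTop_ciSup hmono hbdd
  have hl : ⨆ s, -Real.exp (-slowDiscount c lam δ u₀ s) ≤ 0 :=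
    ciSup_le fun s => neg_nonpos.2 (Real.exp_pos _).le
  refine ⟨integrableOn_Ioi_deriv_of_nonneg' (fun s _ => hd s) (fun s _ => hpos s) hlim, ?_⟩
  rw [integral_Ioi_of_hasDerivAt_of_nonneg' (fun s _ => hd s) (fun s _ => hpos s) hlim]
  linarith

section Step

variable [IsProbabilityMeasure Q] (hc : Continuous c) (hlam : 0 < lam) (hδ : 0 < δ) (hu₀ : 0 < u₀)
  (hcu : ∀ x, u₀ < c x)

include hc hcu in
omit [IsProbabilityMeasure Q] in
lemma measurable_hjbIntegrand [SFinite Q] (hm : Measurable f) :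
    Measurable fun s => Real.exp (-slowDiscount c lam δ u₀ s) *
      hjbSource c lam δ u₀ s (f s) (claimMean Q f (max s 0)) := by
  have h1 := (continuous_slowDiscount (lam := lam) (δ := δ) hc hcu).measurable
  have h2 : Measurable fun s : ℝ => claimMean Q f (max s 0) :=
    (measurable_claimMean hm).comp (measurable_id.max measurable_const)
  exact h1.neg.exp.mul (measurable_hjbSource hc.measurable hm h2)

include hlam hδ hu₀ hcu in
lemma hjbIntegrand_mem_Icc (hm : Measurable f) (hf : ∀ x, f x ∈ Icc 0 (u₀ / δ)) (s : ℝ) :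
    Real.exp (-slowDiscount c lam δ u₀ s) *
      hjbSource c lam δ u₀ s (f s) (claimMean Q f (max s 0)) ∈
    Icc 0 (u₀ / δ *
      (Real.exp (-slowDiscount c lam δ u₀ s) * ((lam + δ) / (c s - u₀)))) := by
  have hM : 0 ≤ u₀ / δ := by positivity
  constructor
  · exact mul_nonneg (Real.exp_pos _).le
      (hjbSource_nonneg hlam hu₀ hcu s (claimMean_nonneg (fun x => (hf x).1) _))
  · have := hjbSource_le hlam hδ hu₀ hcu s (hf s).2 (claimMean_le (Q := Q) hM hm hf (max s 0))
    calc _ ≤ Real.exp (-slowDiscount c lam δ u₀ s) * (u₀ / δ * ((lam + δ) / (c s - u₀))) := by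
            gcongr
      _ = _ := by ring

include hc hlam hδ hu₀ hcu

lemma integrableOn_hjbIntegrand (hm : Measurable f) (hf : ∀ x, f x ∈ Icc 0 (u₀ / δ)) (x : ℝ) :
    IntegrableOn (fun s => Real.exp (-slowDiscount c lam δ u₀ s) *
      hjbSource c lam δ u₀ s (f s) (claimMean Q f (max s 0))) (Ioi x) := by
  refine ((integrableOn_and_integral_le_exp_neg_slowDiscount hc hlam hδ hcu x).1.const_mul
    (u₀ / δ)).mono' (measurable_hjbIntegrand hc hcu hm).aestronglyMeasurable
    (ae_of_all _ fun s => ?_)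
  have := hjbIntegrand_mem_Icc (Q := Q) hlam hδ hu₀ hcu hm hf s
  rw [Real.norm_eq_abs, abs_of_nonneg this.1]
  exact this.2

lemma hjbStep_mem_Icc (hm : Measurable f) (hf : ∀ x, f x ∈ Icc 0 (u₀ / δ)) (x : ℝ) :
    hjbStep Q c lam δ u₀ f x ∈ Icc 0 (u₀ / δ) := by
  have hM : 0 ≤ u₀ / δ := by positivity
  have hE := integrableOn_and_integral_le_exp_neg_slowDiscount hc hlam hδ hcu x
  constructor
  · exact mul_nonneg (Real.exp_pos _).le (integral_nonneg fun s =>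
      (hjbIntegrand_mem_Icc (Q := Q) hlam hδ hu₀ hcu hm hf s).1)
  · calc hjbStep Q c lam δ u₀ f x
        ≤ Real.exp (slowDiscount c lam δ u₀ x) * ∫ s in Ioi x, u₀ / δ *
          (Real.exp (-slowDiscount c lam δ u₀ s) * ((lam + δ) / (c s - u₀))) := by
          refine mul_le_mul_of_nonneg_left ?_ (Real.exp_pos _).le
          exact integral_mono (integrableOn_hjbIntegrand hc hlam hδ hu₀ hcu hm hf x)
            (hE.1.const_mul _) fun s =>
              (hjbIntegrand_mem_Icc (Q := Q) hlam hδ hu₀ hcu hm hf s).2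
      _ ≤ Real.exp (slowDiscount c lam δ u₀ x) *
          (u₀ / δ * Real.exp (-slowDiscount c lam δ u₀ x)) := by
          rw [integral_const_mul]
          gcongr
          exact hE.2
      _ = u₀ / δ := by
          rw [mul_left_comm, ← Real.exp_add]
          simp

lemma hjbStep_mono (hm : Measurable f) (hf : ∀ x, f x ∈ Icc 0 (u₀ / δ)) (hm' : Measurable f')
    (hf' : ∀ x, f' x ∈ Icc 0 (u₀ / δ)) (h : ∀ x, f x ≤ f' x) (x : ℝ) :
    hjbStep Q c lam δ u₀ f x ≤ hjbStep Q c lam δ u₀ f' x := by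
  refine mul_le_mul_of_nonneg_left ?_ (Real.exp_pos _).le
  refine integral_mono (integrableOn_hjbIntegrand hc hlam hδ hu₀ hcu hm hf x)
    (integrableOn_hjbIntegrand hc hlam hδ hu₀ hcu hm' hf' x) fun s => ?_
  have := hjbSource_mono hlam hδ hu₀ hcu s (h s) (claimMean_mono (Q := Q) hm hf hm' hf' h (max s 0))
  exact mul_le_mul_of_nonneg_left this (Real.exp_pos _).le

lemma continuous_hjbStep (hm : Measurable f) (hf : ∀ x, f x ∈ Icc 0 (u₀ / δ)) :
    Continuous (hjbStep Q c lam δ u₀ f) := by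
  set k : ℝ → ℝ := fun s => Real.exp (-slowDiscount c lam δ u₀ s) *
    hjbSource c lam δ u₀ s (f s) (claimMean Q f (max s 0)) with hk
  have hint : ∀ x, IntegrableOn k (Ioi x) := integrableOn_hjbIntegrand hc hlam hδ hu₀ hcu hm hf
  have hii : ∀ a b, IntervalIntegrable k volume a b := fun a b =>
    (intervalIntegrable_iff).2 ((hint (min a b)).mono_set fun y hy => hy.1)
  have heq : hjbStep Q c lam δ u₀ f = fun x => Real.exp (slowDiscount c lam δ u₀ x) *
      ((∫ s in Ioi 0, k s) - ∫ s in (0 : ℝ)..x, k s) := by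
    funext x
    rw [← intervalIntegral.integral_Ioi_sub_Ioi' (hint 0) (hint x), sub_sub_cancel]
    rfl
  rw [heq]
  exact (Real.continuous_exp.comp (continuous_slowDiscount hc hcu)).mul
    (continuous_const.sub (intervalIntegral.continuous_primitive hii 0))

/-- Iterating the monotone operator `hjbStep` from `0` yields a bounded fixed point. -/
lemma exists_hjbStep_eq_self : ∃ W : ℝ → ℝ, Measurable W ∧ (∀ x, W x ∈ Icc 0 (u₀ / δ)) ∧
    hjbStep Q c lam δ u₀ W = W := by
  have hM : 0 ≤ u₀ / δ := by positivity
  set F : ℕ → ℝ → ℝ := fun n => (hjbStep Q c lam δ u₀)^[n] 0 with hF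
  have hsucc : ∀ n, F (n + 1) = hjbStep Q c lam δ u₀ (F n) := fun n =>
    Function.iterate_succ_apply' _ _ _
  have hFm : ∀ n, Measurable (F n) ∧ ∀ x, F n x ∈ Icc 0 (u₀ / δ) := by
    intro n
    induction n with
    | zero => exact ⟨measurable_const, fun x => ⟨le_rfl, hM⟩⟩
    | succ n ih =>
      rw [hsucc]
      exact ⟨(continuous_hjbStep hc hlam hδ hu₀ hcu ih.1 ih.2).measurable,
        hjbStep_mem_Icc hc hlam hδ hu₀ hcu ih.1 ih.2⟩
  have hstep : ∀ n x, F n x ≤ F (n + 1) x := by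
    intro n
    induction n with
    | zero => exact fun x => ((hFm 1).2 x).1
    | succ n ih =>
      intro x
      rw [hsucc, hsucc (n + 1)]
      exact hjbStep_mono hc hlam hδ hu₀ hcu (hFm n).1 (hFm n).2 (hFm (n + 1)).1 (hFm (n + 1)).2 ih x
  have hmono : ∀ x, Monotone fun n => F n x := fun x => monotone_nat_of_le_succ fun n => hstep n x
  have hbdd : ∀ x, BddAbove (range fun n => F n x) := fun x =>
    ⟨u₀ / δ, by rintro _ ⟨n, rfl⟩; exact ((hFm n).2 x).2⟩
  set W : ℝ → ℝ := fun x => ⨆ n, F n x with hW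
  have hlim : ∀ x, Tendsto (fun n => F n x) atTop (𝓝 (W x)) := fun x =>
    tendsto_atTop_ciSup (hmono x) (hbdd x)
  have hWm : Measurable W := measurable_of_tendsto_metrizable (fun n => (hFm n).1)
    (tendsto_pi_nhds.2 hlim)
  have hWb : ∀ x, W x ∈ Icc 0 (u₀ / δ) := fun x =>
    isClosed_Icc.mem_of_tendsto (hlim x) (Eventually.of_forall fun n => (hFm n).2 x)
  refine ⟨W, hWm, hWb, ?_⟩
  have hmean : ∀ x, Tendsto (fun n => claimMean Q (F n) x) atTop (𝓝 (claimMean Q W x)) := by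
    intro x
    refine tendsto_integral_of_dominated_convergence (fun _ => u₀ / δ) (fun n => ?_)
      (integrable_const _) (fun n => ae_of_all _ fun y => ?_) (ae_of_all _ fun y => hlim _)
    · exact ((hFm n).1.comp (measurable_const.sub measurable_id)).aestronglyMeasurable
    · rw [Real.norm_eq_abs, abs_of_nonneg ((hFm n).2 _).1]
      exact ((hFm n).2 _).2
  funext x
  refine tendsto_nhds_unique (f := fun n => F (n + 1) x) (l := atTop) ?_
    ((tendsto_add_atTop_iff_nat (f := fun n => F n x) 1).2 (hlim x))
  simp only [hsucc]
  unfold hjbStep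
  refine Tendsto.const_mul _ ?_
  refine tendsto_integral_of_dominated_convergence
    (fun s => u₀ / δ * (Real.exp (-slowDiscount c lam δ u₀ s) * ((lam + δ) / (c s - u₀))))
    (fun n => (measurable_hjbIntegrand hc hcu (hFm n).1).aestronglyMeasurable)
    ((integrableOn_and_integral_le_exp_neg_slowDiscount hc hlam hδ hcu x).1.const_mul _)
    (fun n => ae_of_all _ fun s => ?_) (ae_of_all _ fun s => ?_)
  · have := hjbIntegrand_mem_Icc (Q := Q) hlam hδ hu₀ hcu (hFm n).1 (hFm n).2 s
    rw [Real.norm_eq_abs, abs_of_nonneg this.1]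
    exact this.2
  · refine Tendsto.const_mul _ ?_
    unfold hjbSource
    exact ((((hlim s).const_mul _).add ((hmean _).const_mul _)).div_const _).max
      ((((hmean _).const_mul _).add_const _).div_const _)

/-- There is a bounded continuously differentiable solution `W` of the Hamilton-Jacobi-Bellman
equation; the supremum over the rates is attained at `0` or at `u₀`. -/
theorem exists_hjb_solution (hQ : ∀ y, 0 < y → Q {y} = 0) :
    ∃ W W' : ℝ → ℝ, (∀ x, W x ∈ Icc 0 (u₀ / δ)) ∧ (∀ x, HasDerivAt W (W' x) x) ∧ Continuous W' ∧
      ∀ x, 0 ≤ x →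
        max (c x * W' x) ((c x - u₀) * W' x + u₀) = (lam + δ) * W x - lam * claimMean Q W x := by
  obtain ⟨W, hWm, hWb, hfix⟩ := exists_hjbStep_eq_self (Q := Q) hc hlam hδ hu₀ hcu
  have hWc : Continuous W := hfix ▸ continuous_hjbStep (Q := Q) hc hlam hδ hu₀ hcu hWm hWb
  have hmc := continuous_claimMean_max hQ hWc hWb
  have hsc : Continuous fun s => hjbSource c lam δ u₀ s (W s) (claimMean Q W (max s 0)) :=
    continuous_hjbSource hc hu₀ hcu hWc hmc
  set k : ℝ → ℝ := fun s => Real.exp (-slowDiscount c lam δ u₀ s) *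
    hjbSource c lam δ u₀ s (W s) (claimMean Q W (max s 0)) with hk
  have hkc : Continuous k :=
    (Real.continuous_exp.comp (continuous_slowDiscount hc hcu).neg).mul hsc
  have hint : ∀ x, IntegrableOn k (Ioi x) := integrableOn_hjbIntegrand hc hlam hδ hu₀ hcu hWm hWb
  have heq : W = fun x => Real.exp (slowDiscount c lam δ u₀ x) *
      ((∫ s in Ioi 0, k s) - ∫ s in (0 : ℝ)..x, k s) := by
    funext x
    rw [← intervalIntegral.integral_Ioi_sub_Ioi' (hint 0) (hint x), sub_sub_cancel]
    exact (congrFun hfix x).symm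
  refine ⟨W, fun x => (lam + δ) / (c x - u₀) * W x -
    hjbSource c lam δ u₀ x (W x) (claimMean Q W (max x 0)), hWb, fun x => ?_, ?_, fun x hx => ?_⟩
  · have h1 := (hasDerivAt_slowDiscount (lam := lam) (δ := δ) hc hcu x).exp.mul
      ((hasDerivAt_const x (∫ s in Ioi 0, k s)).sub (hkc.integral_hasStrictDerivAt 0 x).hasDerivAt)
    have h3 := h1.congr_of_eventuallyEq (f₁ := W) (Eventually.of_forall (congrFun heq))
    refine h3.congr_deriv ?_
    have h2 : Real.exp (slowDiscount c lam δ u₀ x) * k x =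
        hjbSource c lam δ u₀ x (W x) (claimMean Q W (max x 0)) := by
      rw [hk]
      dsimp only
      rw [← mul_assoc, ← Real.exp_add, add_neg_cancel, Real.exp_zero, one_mul]
    have h4 := congrFun heq x
    simp only [Pi.sub_apply]
    rw [← h2]
    conv_rhs => enter [1]; rw [h4]
    ring
  · refine Continuous.sub (Continuous.mul ?_ hWc) hsc
    exact continuous_const.div (hc.sub continuous_const) fun s => (sub_pos.2 (hcu s)).ne'
  · dsimp only
    rw [max_eq_left hx]
    have h1 : 0 < c x - u₀ := sub_pos.2 (hcu x)
    have h2 : 0 < c x := hu₀.trans (hcu x)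
    set m := claimMean Q W x
    set w := W x
    unfold hjbSource
    rcases le_total (((lam + δ) / (c x - u₀) * u₀ * w + lam * m) / c x)
      ((lam * m + u₀) / (c x - u₀)) with h | h
    · rw [max_eq_right h]
      have h3 : (c x - u₀) * ((lam + δ) / (c x - u₀) * w - (lam * m + u₀) / (c x - u₀)) + u₀
          = (lam + δ) * w - lam * m := by
        field_simp
        ring
      rw [max_eq_right, h3]
      have h4 : (lam + δ) / (c x - u₀) * w - (lam * m + u₀) / (c x - u₀) ≤ 1 := by
        rw [div_le_div_iff₀ h2 h1, add_mul] at h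
        have h5 : (lam + δ) / (c x - u₀) * u₀ * w * (c x - u₀) = (lam + δ) * u₀ * w := by
          field_simp
        rw [h5] at h
        rw [← mul_div_right_comm, ← sub_div, div_le_one h1]
        by_contra! hcon
        nlinarith [mul_lt_mul_of_pos_left hcon hu₀]
      nlinarith
    · rw [max_eq_left h]
      have h3 : c x * ((lam + δ) / (c x - u₀) * w - ((lam + δ) / (c x - u₀) * u₀ * w + lam * m) / c
          x)
          = (lam + δ) * w - lam * m := by
        field_simp
        ring
      rw [max_eq_left, h3]
      have h4 : 1 ≤ (lam + δ) / (c x - u₀) * w -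
          ((lam + δ) / (c x - u₀) * u₀ * w + lam * m) / c x := by
        rw [div_le_div_iff₀ h1 h2, add_mul _ _ (c x - u₀)] at h
        have h5 : (lam + δ) / (c x - u₀) * u₀ * w * (c x - u₀) = (lam + δ) * u₀ * w := by
          field_simp
        rw [h5] at h
        have h6 : c x * ((lam + δ) / (c x - u₀) * w -
          ((lam + δ) / (c x - u₀) * u₀ * w + lam * m) / c x) = (lam + δ) * w - lam * m := h3
        by_contra! hcon
        have h7 := mul_lt_mul_of_pos_left hcon h2
        rw [h6] at h7
        nlinarith [mul_lt_mul_of_pos_left h7 hu₀]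
      nlinarith

end Step

end Hjb

/-! ### Increments of the compound Poisson process -/

section Paths

variable {Ω : Type*} [mΩ : MeasurableSpace Ω] {P : Measure Ω} {𝓕 : Filtration ℝ≥0 mΩ} {lam : ℝ}
  {Q : Measure ℝ} {T Y : ℕ → Ω → ℝ} {s t : ℝ} {ω : Ω}

lemma claimCount_eq_iff (h : IsCompoundPoisson P 𝓕 lam Q T Y) (ht : 0 ≤ t) {n : ℕ} :
    claimCount T t ω = n ↔ T n ω ≤ t ∧ t < T (n + 1) ω := by
  have key : ∀ m, T m ω ≤ t → t < T (m + 1) ω → claimCount T t ω = m := by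
    intro m h1 h2
    have : {i : ℕ | 1 ≤ i ∧ T i ω ≤ t} = (Finset.Icc 1 m : Finset ℕ) := by
      ext i
      simp only [mem_ofPred_eq, Finset.coe_Icc, mem_Icc]
      refine and_congr_right fun _ => ⟨fun hi => ?_, fun hi => ?_⟩
      · exact Nat.lt_succ_iff.1 ((h.strictMono_time ω).lt_iff_lt.1 (hi.trans_lt h2))
      · exact ((h.strictMono_time ω).monotone hi).trans h1
    rw [claimCount, this, ncard_coe_finset]
    simp
  refine ⟨fun hn => ?_, fun hn => key n hn.1 hn.2⟩
  have hex : ∃ m, t < T m ω := ((h.tendsto_time ω).eventually_gt_atTop t).exists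
  classical
  have h0 : Nat.find hex ≠ 0 := by
    intro h0
    have := Nat.find_spec hex
    rw [h0, h.time_zero] at this
    exact absurd this (not_lt.2 ht)
  obtain ⟨m, hm⟩ := Nat.exists_eq_succ_of_ne_zero h0
  have h1 : T m ω ≤ t := not_lt.1 (Nat.find_min hex (hm ▸ Nat.lt_succ_self m))
  have h2 : t < T (m + 1) ω := by
    have := Nat.find_spec hex
    rwa [hm] at this
  rw [key m h1 h2] at hn
  subst hn
  exact ⟨h1, h2⟩

lemma claimCount_spec (h : IsCompoundPoisson P 𝓕 lam Q T Y) (ht : 0 ≤ t) :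
    T (claimCount T t ω) ω ≤ t ∧ t < T (claimCount T t ω + 1) ω :=
  (claimCount_eq_iff h ht).1 rfl

lemma claimCount_mono (h : IsCompoundPoisson P 𝓕 lam Q T Y) (hs : 0 ≤ s) (hst : s ≤ t) :
    claimCount T s ω ≤ claimCount T t ω := by
  have h1 := (claimCount_spec (ω := ω) h hs).1
  have h2 := (claimCount_spec (ω := ω) h (hs.trans hst)).2
  exact Nat.lt_succ_iff.1 ((h.strictMono_time ω).lt_iff_lt.1 ((h1.trans hst).trans_lt h2))

lemma claimCount_zero (h : IsCompoundPoisson P 𝓕 lam Q T Y) : claimCount T 0 ω = 0 := by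
  refine (claimCount_eq_iff h le_rfl).2 ⟨(h.time_zero ω).le, ?_⟩
  have := h.strictMono_time ω zero_lt_one
  simpa [h.time_zero] using this

omit mΩ in
lemma claimTotal_eq (T Y : ℕ → Ω → ℝ) (t : ℝ) (ω : Ω) :
    claimTotal T Y t ω = ∑ i ∈ Finset.range (claimCount T t ω), Y (i + 1) ω := by
  rw [claimTotal, ← Finset.Ico_add_one_right_eq_Icc, Finset.sum_Ico_eq_sum_range]
  simp [add_comm]

lemma claimTotal_mono (h : IsCompoundPoisson P 𝓕 lam Q T Y) (hs : 0 ≤ s) (hst : s ≤ t) :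
    claimTotal T Y s ω ≤ claimTotal T Y t ω := by
  rw [claimTotal_eq, claimTotal_eq]
  exact Finset.sum_le_sum_of_subset_of_nonneg
    (Finset.range_subset_range.2 (claimCount_mono h hs hst)) fun i _ _ => h.size_nonneg i ω

lemma claimTotal_zero (h : IsCompoundPoisson P 𝓕 lam Q T Y) : claimTotal T Y 0 ω = 0 := by
  rw [claimTotal_eq, claimCount_zero h, Finset.sum_range_zero]

omit mΩ in
lemma claimTotal_congr (h : claimCount T s ω = claimCount T t ω) :
    claimTotal T Y s ω = claimTotal T Y t ω := by
  rw [claimTotal_eq, claimTotal_eq, h]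

end Paths

section Law

variable {Ω : Type*} [mΩ : MeasurableSpace Ω] {P : Measure Ω} [IsProbabilityMeasure P]
  {𝓕 : Filtration ℝ≥0 mΩ} {lam : ℝ} {Q : Measure ℝ} {T Y : ℕ → Ω → ℝ}

lemma isProbabilityMeasure_claimLaw (h : IsCompoundPoisson P 𝓕 lam Q T Y) :
    IsProbabilityMeasure Q := by
  rw [← h.law_size 0]
  exact Measure.isProbabilityMeasure_map (h.measurable_size 0).aemeasurable

omit [IsProbabilityMeasure P] in
lemma claimLaw_Iio_zero (h : IsCompoundPoisson P 𝓕 lam Q T Y) : Q (Iio 0) = 0 := by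
  rw [← h.law_size 0, Measure.map_apply (h.measurable_size 0) measurableSet_Iio]
  convert measure_empty (μ := P)
  ext ω
  simpa using h.size_nonneg 0 ω

lemma expMeasure_Ioi {r : ℝ} (hr : 0 < r) {x : ℝ} (hx : 0 ≤ x) :
    expMeasure r (Ioi x) = ENNReal.ofReal (Real.exp (-(r * x))) := by
  have := isProbabilityMeasure_expMeasure hr
  have h1 : (expMeasure r).real (Iic x) = 1 - Real.exp (-(r * x)) := by
    rw [← cdf_eq_real, cdf_expMeasure_eq hr, if_pos hx]
  rw [← compl_Iic, ← ENNReal.ofReal_toReal (measure_ne_top _ (Iic x)ᶜ)]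
  congr 1
  have := probReal_compl_eq_one_sub (μ := expMeasure r) (measurableSet_Iic (a := x))
  rw [Measure.real] at this
  rw [this, h1]
  ring

/-- The probability that exactly one point of a renewal process with exponential waiting times lies
in `[0, t]`. -/
lemma expMeasure_prod_single {r : ℝ} (hr : 0 < r) {t : ℝ} :
    ((expMeasure r).prod (expMeasure r)) {p : ℝ × ℝ | p.1 ≤ t ∧ t < p.1 + p.2} =
      ENNReal.ofReal (r * t * Real.exp (-(r * t))) := by
  have := isProbabilityMeasure_expMeasure hr
  have hms : MeasurableSet {p : ℝ × ℝ | p.1 ≤ t ∧ t < p.1 + p.2} :=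
    (measurableSet_le measurable_fst measurable_const).inter
      (measurableSet_lt measurable_const (measurable_fst.add measurable_snd))
  rw [Measure.prod_apply hms]
  have h1 : ∀ a, expMeasure r (Prod.mk a ⁻¹' {p : ℝ × ℝ | p.1 ≤ t ∧ t < p.1 + p.2}) =
      (Iic t).indicator (fun a => ENNReal.ofReal (Real.exp (-(r * (t - a))))) a := by
    intro a
    by_cases ha : a ≤ t
    · rw [indicator_of_mem (mem_Iic.2 ha), ← expMeasure_Ioi hr (sub_nonneg.2 ha)]
      congr 1
      ext b
      simp [ha, sub_lt_iff_lt_add']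
    · rw [indicator_of_notMem (by simpa using ha)]
      convert measure_empty (μ := expMeasure r)
      ext b
      simp [ha]
  simp_rw [h1]
  have h2 : expMeasure r = volume.withDensity (exponentialPDF r) := rfl
  have hmp : Measurable (exponentialPDF r) := (measurable_exponentialPDFReal r).ennreal_ofReal
  rw [h2, lintegral_withDensity_eq_lintegral_mul₀ hmp.aemeasurable]
  · have h3 : ∀ a, (exponentialPDF r * (Iic t).indicator
        (fun a => ENNReal.ofReal (Real.exp (-(r * (t - a)))))) a =
        (Icc 0 t).indicator (fun _ => ENNReal.ofReal (r * Real.exp (-(r * t)))) a := by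
      intro a
      simp only [Pi.mul_apply]
      by_cases h0 : 0 ≤ a
      · rw [exponentialPDF_of_nonneg h0]
        by_cases ha : a ≤ t
        · rw [indicator_of_mem (mem_Iic.2 ha), indicator_of_mem (mem_Icc.2 ⟨h0, ha⟩),
            ← ENNReal.ofReal_mul (by positivity), mul_assoc, ← Real.exp_add]
          congr 3
          ring
        · rw [indicator_of_notMem (by simpa using ha), indicator_of_notMem (by simp [ha]), mul_zero]
      · rw [exponentialPDF_of_neg (not_le.1 h0), zero_mul, indicator_of_notMem (by simp [h0])]
    simp_rw [h3]
    rw [lintegral_indicator measurableSet_Icc, lintegral_const, Measure.restrict_apply_univ,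
      Real.volume_Icc, sub_zero, ← ENNReal.ofReal_mul (by positivity)]
    congr 1
    ring
  · exact (Measurable.indicator (by fun_prop) measurableSet_Iic).aemeasurable

omit [IsProbabilityMeasure P] in
lemma measure_claimCount_eq_zero (h : IsCompoundPoisson P 𝓕 lam Q T Y) (hlam : 0 < lam) {t : ℝ}
    (ht : 0 ≤ t) : P {ω | claimCount T t ω = 0} = ENNReal.ofReal (Real.exp (-(lam * t))) := by
  rw [← expMeasure_Ioi hlam ht, ← h.law_waiting 0,
    Measure.map_apply (f := fun ω => T (0 + 1) ω - T 0 ω)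
      ((h.measurable_time _).sub (h.measurable_time _)) measurableSet_Ioi]
  congr 1
  ext ω
  simp [claimCount_eq_iff h ht, h.time_zero, ht]

lemma measure_claimCount_eq_one (h : IsCompoundPoisson P 𝓕 lam Q T Y) (hlam : 0 < lam) {t : ℝ}
    (ht : 0 ≤ t) {A : Set ℝ} (hA : MeasurableSet A) :
    P {ω | claimCount T t ω = 1 ∧ claimTotal T Y t ω ∈ A} =
      ENNReal.ofReal (lam * t * Real.exp (-(lam * t))) * Q A := by
  have := isProbabilityMeasure_expMeasure hlam
  have hmeas : ∀ j : ℕ ⊕ ℕ, Measurable fun ω =>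
      Sum.elim (fun i => T (i + 1) ω - T i ω) (fun i => Y (i + 1) ω) j := by
    rintro (i | i)
    · exact (h.measurable_time _).sub (h.measurable_time _)
    · exact h.measurable_size i
  have hind : IndepFun (fun ω => (T (0 + 1) ω - T 0 ω, T (1 + 1) ω - T 1 ω))
      (fun ω => Y (0 + 1) ω) P :=
    h.indep.indepFun_prodMk hmeas (Sum.inl 0) (Sum.inl 1) (Sum.inr 0) (by simp) (by simp)
  have hind2 : IndepFun (fun ω => T (0 + 1) ω - T 0 ω) (fun ω => T (1 + 1) ω - T 1 ω) P :=
    h.indep.indepFun (i := Sum.inl 0) (j := Sum.inl 1) (by simp)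
  have hms : MeasurableSet {p : ℝ × ℝ | p.1 ≤ t ∧ t < p.1 + p.2} :=
    (measurableSet_le measurable_fst measurable_const).inter
      (measurableSet_lt measurable_const (measurable_fst.add measurable_snd))
  have hpair := (indepFun_iff_map_prod_eq_prod_map_map (hmeas (Sum.inl 0)).aemeasurable
    (hmeas (Sum.inl 1)).aemeasurable).1 hind2
  simp only [Sum.elim_inl] at hpair
  rw [h.law_waiting 0, h.law_waiting 1] at hpair
  rw [← expMeasure_prod_single hlam, ← hpair, Measure.map_apply
    (f := fun ω => (T (0 + 1) ω - T 0 ω, T (1 + 1) ω - T 1 ω))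
    ((hmeas (Sum.inl 0)).prodMk (hmeas (Sum.inl 1))) hms, ← h.law_size 0,
    Measure.map_apply (h.measurable_size 0) hA, ← hind.measure_inter_preimage_eq_mul _ _ hms hA]
  congr 1
  ext ω
  simp only [mem_ofPred_eq, mem_inter_iff, mem_preimage, claimCount_eq_iff h ht, h.time_zero]
  simp only [zero_add, sub_zero, add_sub_cancel]
  refine and_congr_right fun h1 => ?_
  rw [claimTotal_eq, (claimCount_eq_iff h ht).2 h1]
  simp

/-- The number of claims and the aggregate claims in `(s, t]`. -/
noncomputable def claimIncrement (T Y : ℕ → Ω → ℝ) (s t : ℝ) (ω : Ω) : ℤ × ℝ :=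
  ((claimCount T t ω : ℤ) - claimCount T s ω, claimTotal T Y t ω - claimTotal T Y s ω)

omit [IsProbabilityMeasure P] in
lemma measurable_claimIncrement (h : IsCompoundPoisson P 𝓕 lam Q T Y) {s t : ℝ≥0} :
    Measurable (claimIncrement T Y s t) := by
  have h1 : ∀ t : ℝ≥0, Measurable (claimCount T t) := fun t => (h.adapted_count t).mono (𝓕.le t)
      le_rfl
  have h2 : ∀ t : ℝ≥0, Measurable (claimTotal T Y t) := fun t =>
    (h.adapted_total t).mono (𝓕.le t) le_rfl
  have h3 : Measurable fun n : ℕ => (n : ℤ) := measurable_from_top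
  exact ((h3.comp (h1 t)).sub (h3.comp (h1 s))).prodMk ((h2 t).sub (h2 s))

omit [IsProbabilityMeasure P] in
lemma measure_inter_claimIncrement (h : IsCompoundPoisson P 𝓕 lam Q T Y) {s t : ℝ≥0} (hst : s ≤ t)
    {A : Set Ω} (hA : MeasurableSet[𝓕 s] A) {B : Set (ℤ × ℝ)} (hB : MeasurableSet B) :
    P (A ∩ claimIncrement T Y s t ⁻¹' B) = P A * P (claimIncrement T Y s t ⁻¹' B) := by
  rw [inter_comm, mul_comm]
  exact (Indep_iff _ _ _).1 (h.indep_increment s t hst) _ _ ⟨B, hB, rfl⟩ hA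

omit [IsProbabilityMeasure P] in
/-- No claim in `(0, t]` means no claim in `(0, s]` and none in `(s, t]`; these are independent. -/
lemma measure_claimIncrement_zero (h : IsCompoundPoisson P 𝓕 lam Q T Y) (hlam : 0 < lam) {s t : ℝ≥0}
    (hst : s ≤ t) : P (claimIncrement T Y s t ⁻¹' ({0} ×ˢ univ)) =
      ENNReal.ofReal (Real.exp (-(lam * (t - s)))) := by
  have hA : MeasurableSet[𝓕 s] {ω | claimCount T s ω = 0} :=
    h.adapted_count s (measurableSet_singleton 0)
  have h1 := measure_inter_claimIncrement h hst hA
    (B := {0} ×ˢ univ) ((measurableSet_singleton _).prod MeasurableSet.univ)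
  have h2 : {ω | claimCount T s ω = 0} ∩ claimIncrement T Y s t ⁻¹' ({0} ×ˢ univ) =
      {ω | claimCount T t ω = 0} := by
    ext ω
    have := claimCount_mono (ω := ω) h s.coe_nonneg (NNReal.coe_le_coe.2 hst)
    simp only [claimIncrement, mem_inter_iff, mem_ofPred_eq, mem_preimage, mem_prod,
        mem_singleton_iff,
      mem_univ, and_true]
    omega
  rw [h2, measure_claimCount_eq_zero h hlam s.coe_nonneg, measure_claimCount_eq_zero h hlam
      t.coe_nonneg] at h1
  have hpos : ENNReal.ofReal (Real.exp (-(lam * s))) ≠ 0 := by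
    rw [ENNReal.ofReal_ne_zero_iff]; positivity
  rw [← ENNReal.mul_right_inj hpos ENNReal.ofReal_ne_top, ← h1, ← ENNReal.ofReal_mul (by
      positivity),
    ← Real.exp_add]
  congr 2
  ring

/-- One claim in `(0, t]` falls either into `(0, s]` or into `(s, t]`, with no claim in the other
interval. -/
lemma measure_claimIncrement_one (h : IsCompoundPoisson P 𝓕 lam Q T Y) (hlam : 0 < lam) {s t : ℝ≥0}
    (hst : s ≤ t) {A : Set ℝ} (hA : MeasurableSet A) :
    P (claimIncrement T Y s t ⁻¹' ({1} ×ˢ A)) =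
      ENNReal.ofReal (lam * (t - s) * Real.exp (-(lam * (t - s)))) * Q A := by
  have := isProbabilityMeasure_claimLaw h
  have hst' : (s : ℝ) ≤ t := NNReal.coe_le_coe.2 hst
  have hA0 : MeasurableSet[𝓕 s] {ω | claimCount T s ω = 0} :=
    h.adapted_count s (measurableSet_singleton 0)
  have hA1 : MeasurableSet[𝓕 s] {ω | claimCount T s ω = 1 ∧ claimTotal T Y s ω ∈ A} :=
    (h.adapted_count s (measurableSet_singleton 1)).inter (h.adapted_total s hA)
  have h0 := measure_inter_claimIncrement h hst hA0
    (B := {1} ×ˢ A) ((measurableSet_singleton _).prod hA)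
  have h1 := measure_inter_claimIncrement h hst hA1
    (B := {0} ×ˢ univ) ((measurableSet_singleton _).prod MeasurableSet.univ)
  have hsplit : {ω | claimCount T t ω = 1 ∧ claimTotal T Y t ω ∈ A} =
      ({ω | claimCount T s ω = 1 ∧ claimTotal T Y s ω ∈ A} ∩
        claimIncrement T Y s t ⁻¹' ({0} ×ˢ univ)) ∪
      ({ω | claimCount T s ω = 0} ∩ claimIncrement T Y s t ⁻¹' ({1} ×ˢ A)) := by
    ext ω
    have hle := claimCount_mono (ω := ω) h s.coe_nonneg hst'
    simp only [claimIncrement, mem_union, mem_inter_iff, mem_ofPred_eq, mem_preimage, mem_prod,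
      mem_singleton_iff, mem_univ, and_true]
    constructor
    · rintro ⟨h1, h2⟩
      rcases (Nat.le_one_iff_eq_zero_or_eq_one.1 (h1 ▸ hle)) with h3 | h3
      · refine Or.inr ⟨h3, by omega, ?_⟩
        rw [claimTotal_eq T Y s, h3, Finset.sum_range_zero, sub_zero]
        exact h2
      · refine Or.inl ⟨⟨h3, ?_⟩, by omega⟩
        rwa [claimTotal_congr (h3.trans h1.symm)]
    · rintro (⟨⟨h1, h2⟩, h3⟩ | ⟨h1, h2, h3⟩)
      · have h4 : claimCount T t ω = claimCount T s ω := by omega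
        exact ⟨by omega, by rwa [claimTotal_congr h4]⟩
      · refine ⟨by omega, ?_⟩
        rwa [claimTotal_eq T Y s, h1, Finset.sum_range_zero, sub_zero] at h3
  have hdisj : Disjoint ({ω | claimCount T s ω = 1 ∧ claimTotal T Y s ω ∈ A} ∩
        claimIncrement T Y s t ⁻¹' ({0} ×ˢ univ))
      ({ω | claimCount T s ω = 0} ∩ claimIncrement T Y s t ⁻¹' ({1} ×ˢ A)) := by
    rw [disjoint_left]
    rintro ω ⟨⟨h1, -⟩, -⟩ ⟨h2, -⟩
    simp only [mem_ofPred_eq] at h1 h2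
    omega
  have hms : MeasurableSet ({ω | claimCount T s ω = 0} ∩ claimIncrement T Y s t ⁻¹' ({1} ×ˢ A)) :=
    ((𝓕.le s) _ hA0).inter (measurable_claimIncrement h ((measurableSet_singleton _).prod hA))
  have key := measure_union (μ := P) hdisj hms
  rw [← hsplit, h0, h1, measure_claimCount_eq_one h hlam s.coe_nonneg hA, measure_claimCount_eq_one
      h hlam t.coe_nonneg hA,
    measure_claimIncrement_zero h hlam hst, measure_claimCount_eq_zero h hlam s.coe_nonneg] at key
  have hexp : Real.exp (-(lam * s)) * Real.exp (-(lam * (t - s))) = Real.exp (-(lam * t)) := by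
    rw [← Real.exp_add]
    congr 1
    ring
  have hsplit2 : ENNReal.ofReal (lam * t * Real.exp (-(lam * t))) * Q A =
      ENNReal.ofReal (lam * s * Real.exp (-(lam * s))) * Q A *
        ENNReal.ofReal (Real.exp (-(lam * (t - s)))) +
      ENNReal.ofReal (Real.exp (-(lam * s))) *
        (ENNReal.ofReal (lam * (t - s) * Real.exp (-(lam * (t - s)))) * Q A) := by
    have e1 : 0 ≤ lam * (t - s) * Real.exp (-(lam * (t - s))) :=
      mul_nonneg (mul_nonneg hlam.le (sub_nonneg.2 hst')) (Real.exp_pos _).le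
    rw [mul_right_comm (ENNReal.ofReal (lam * s * _)), ← mul_assoc, ← ENNReal.ofReal_mul (by
        positivity),
      ← ENNReal.ofReal_mul (by positivity), ← add_mul, ← ENNReal.ofReal_add (by positivity)
      (mul_nonneg (Real.exp_pos _).le e1), ← hexp]
    congr 2
    ring
  rw [hsplit2] at key
  have hpos : ENNReal.ofReal (Real.exp (-(lam * s))) ≠ 0 := by
    rw [ENNReal.ofReal_ne_zero_iff]; positivity
  rw [← ENNReal.mul_right_inj hpos ENNReal.ofReal_ne_top]
  refine ((ENNReal.add_right_inj ?_).1 key).symm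
  exact ENNReal.mul_ne_top (ENNReal.mul_ne_top ENNReal.ofReal_ne_top (measure_ne_top _ _))
    ENNReal.ofReal_ne_top

end Law

/-! ### Paths of the surplus process -/

section Surplus

variable {Ω : Type*} [mΩ : MeasurableSpace Ω] {P : Measure Ω} {𝓕 : Filtration ℝ≥0 mΩ} {lam u₀ : ℝ}
  {g : ℝ → ℝ} {Q : Measure ℝ} {T Y : ℕ → Ω → ℝ} {x : ℝ} {u X : ℝ → Ω → ℝ} {s t : ℝ} {ω : Ω}

lemma intervalIntegrable_rate (hu : IsRestrictedRate 𝓕 u₀ u) (hs : 0 ≤ s) (ht : 0 ≤ t) :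
    IntervalIntegrable (fun r => u r ω) volume s t := by
  rw [intervalIntegrable_iff]
  refine Measure.integrableOn_of_bounded (M := u₀) (by simp)
    (hu.measurable.comp (measurable_id.prodMk measurable_const)).aestronglyMeasurable ?_
  refine (ae_restrict_mem measurableSet_uIoc).mono fun r hr => ?_
  have h := hu.mem_Icc r ((le_min hs ht).trans hr.1.le) ω
  rw [Real.norm_eq_abs, abs_of_nonneg h.1]
  exact h.2

lemma integral_rate_mem_Icc (hu : IsRestrictedRate 𝓕 u₀ u) (hs : 0 ≤ s) (hst : s ≤ t) :
    ∫ r in s..t, u r ω ∈ Icc 0 (u₀ * (t - s)) := by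
  constructor
  · exact intervalIntegral.integral_nonneg hst fun r hr => (hu.mem_Icc r (hs.trans hr.1) ω).1
  · calc ∫ r in s..t, u r ω ≤ ∫ _ in s..t, u₀ :=
        intervalIntegral.integral_mono_on hst (intervalIntegrable_rate hu hs (hs.trans hst))
          intervalIntegrable_const fun r hr => (hu.mem_Icc r (hs.trans hr.1) ω).2
      _ = u₀ * (t - s) := by simp [mul_comm]

lemma intervalIntegrable_premium (hX : IsSurplus 𝓕 g T Y x u X) (hs : 0 ≤ s) (ht : 0 ≤ t) :
    IntervalIntegrable (fun r => g (max (X r ω) 0)) volume s t :=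
  (hX.integrable ω s hs).symm.trans (hX.integrable ω t ht)

lemma surplus_zero (h : IsCompoundPoisson P 𝓕 lam Q T Y) (hX : IsSurplus 𝓕 g T Y x u X) (ω : Ω) :
    X 0 ω = x := by
  simpa [claimTotal_zero h] using hX.equation ω 0 le_rfl

lemma surplus_sub (hu : IsRestrictedRate 𝓕 u₀ u) (hX : IsSurplus 𝓕 g T Y x u X) (hs : 0 ≤ s)
    (ht : 0 ≤ t) : X t ω = X s ω + ((∫ r in s..t, g (max (X r ω) 0)) - ∫ r in s..t, u r ω) -
      (claimTotal T Y t ω - claimTotal T Y s ω) := by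
  have h1 := intervalIntegral.integral_add_adjacent_intervals
    (intervalIntegrable_premium (ω := ω) hX le_rfl hs) (intervalIntegrable_premium (ω := ω) hX hs
        ht)
  have h2 := intervalIntegral.integral_add_adjacent_intervals
    (intervalIntegrable_rate (ω := ω) hu le_rfl hs) (intervalIntegrable_rate (ω := ω) hu hs ht)
  rw [hX.equation ω t ht, hX.equation ω s hs, ← h1, ← h2]
  ring

/-- The premium rate exceeds every admissible dividend rate, so only claims decrease the surplus. -/
lemma surplus_sub_claims_le (hgu : ∀ x, 0 ≤ x → u₀ < g x) (hu : IsRestrictedRate 𝓕 u₀ u)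
    (hX : IsSurplus 𝓕 g T Y x u X) (hs : 0 ≤ s) (hst : s ≤ t) :
    X s ω - (claimTotal T Y t ω - claimTotal T Y s ω) ≤ X t ω := by
  rw [surplus_sub hu hX hs (hs.trans hst)]
  have h1 : ∫ r in s..t, u r ω ≤ ∫ r in s..t, g (max (X r ω) 0) :=
    intervalIntegral.integral_mono_on hst (intervalIntegrable_rate hu hs (hs.trans hst))
      (intervalIntegrable_premium hX hs (hs.trans hst))
      fun r hr => (hu.mem_Icc r (hs.trans hr.1) ω).2.trans (hgu _ (le_max_right _ _)).le
  linarith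

lemma surplus_le (hu : IsRestrictedRate 𝓕 u₀ u) (hX : IsSurplus 𝓕 g T Y x u X) (hs : 0 ≤ s)
    (hst : s ≤ t) : X t ω ≤ X s ω + (∫ r in s..t, g (max (X r ω) 0)) -
      (claimTotal T Y t ω - claimTotal T Y s ω) := by
  rw [surplus_sub hu hX hs (hs.trans hst)]
  have := (integral_rate_mem_Icc (ω := ω) hu hs hst).1
  linarith

/-- By Gronwall's argument, the surplus on a bounded time interval is bounded by a constant. -/
lemma exists_surplus_le (h : IsCompoundPoisson P 𝓕 lam Q T Y) {K : ℝ≥0}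
    (hg : LipschitzOnWith K g (Ici 0)) (hu₀ : 0 < u₀) (hgu : ∀ x, 0 ≤ x → u₀ < g x)
    (hu : IsRestrictedRate 𝓕 u₀ u) (hX : IsSurplus 𝓕 g T Y x u X) (t₀ : ℝ) :
    ∃ B, 0 ≤ B ∧ ∀ t, 0 ≤ t → t ≤ t₀ → ∀ ω, X t ω ≤ B := by
  have hgK : ∀ y, 0 ≤ y → g y ≤ g 0 + K * y := by
    intro y hy
    have := hg.dist_le_mul y hy 0 self_mem_Ici
    rw [Real.dist_eq, Real.dist_eq, sub_zero, abs_of_nonneg hy] at this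
    linarith [le_abs_self (g y - g 0)]
  have hg0 : 0 < g 0 := hu₀.trans (hgu 0 le_rfl)
  set ℓ : ℝ := 1 / (2 * (K + 1)) with hℓ
  have hℓ0 : 0 < ℓ := by positivity
  have hℓK : ℓ * K ≤ 1 / 2 := by
    rw [hℓ, one_div_mul_eq_div, div_le_div_iff₀ (by positivity) (by norm_num)]
    linarith
  have key : ∀ n : ℕ, ∃ B, 0 ≤ B ∧ ∀ t, 0 ≤ t → t ≤ n * ℓ → ∀ ω, X t ω ≤ B := by
    intro n
    induction n with
    | zero =>
      refine ⟨max x 0, le_max_right _ _, fun t h0 ht ω => ?_⟩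
      have : t = 0 := le_antisymm (by simpa using ht) h0
      rw [this, surplus_zero h hX]
      exact le_max_left _ _
    | succ n ih =>
      obtain ⟨B, hB0, hB⟩ := ih
      refine ⟨B + 2 * ℓ * (g 0 + K * B), by positivity, fun t h0 ht ω => ?_⟩
      rcases le_total t (n * ℓ) with hn | hn
      · have : 0 ≤ 2 * ℓ * (g 0 + K * B) := by positivity
        linarith [hB t h0 hn ω]
      have ha : 0 ≤ n * ℓ := by positivity
      have htl : t - n * ℓ ≤ ℓ := by
        push_cast at ht
        linarith
      set I := ∫ r in n * ℓ..t, g (max (X r ω) 0) with hI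
      have hI0 : 0 ≤ I := intervalIntegral.integral_nonneg hn fun r _ =>
        (hu₀.trans (hgu _ (le_max_right _ _))).le
      have hXr : ∀ r ∈ Icc (n * ℓ) t, X r ω ≤ B + I := by
        intro r hr
        have h1 := surplus_le (ω := ω) hu hX ha hr.1
        have h2 := claimTotal_mono (ω := ω) h ha hr.1
        have h3 : ∫ r in n * ℓ..r, g (max (X r ω) 0) ≤ I := by
          have := intervalIntegral.integral_add_adjacent_intervals
            (intervalIntegrable_premium (ω := ω) hX ha (ha.trans hr.1))
            (intervalIntegrable_premium (ω := ω) hX (ha.trans hr.1) h0)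
          have h4 : 0 ≤ ∫ r in r..t, g (max (X r ω) 0) :=
            intervalIntegral.integral_nonneg hr.2 fun r _ =>
              (hu₀.trans (hgu _ (le_max_right _ _))).le
          linarith
        linarith [hB (n * ℓ) ha le_rfl ω]
      have hI1 : I ≤ ∫ _ in n * ℓ..t, (g 0 + K * (B + I)) := by
        refine intervalIntegral.integral_mono_on hn (intervalIntegrable_premium hX ha h0)
          intervalIntegrable_const fun r hr => (hgK _ (le_max_right _ _)).trans ?_
        gcongr
        exact max_le (hXr r hr) (by positivity)
      rw [intervalIntegral.integral_const, smul_eq_mul] at hI1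
      have hI2 : I ≤ ℓ * (g 0 + K * (B + I)) :=
        hI1.trans (mul_le_mul_of_nonneg_right htl (by positivity))
      have hI3 : ℓ * K * I ≤ 1 / 2 * I := mul_le_mul_of_nonneg_right hℓK hI0
      have hI4 : ℓ * (g 0 + K * (B + I)) = ℓ * (g 0 + K * B) + ℓ * K * I := by ring
      have h5 := hXr t ⟨hn, le_rfl⟩
      linarith
  obtain ⟨n, hn⟩ := exists_nat_ge (t₀ / ℓ)
  obtain ⟨B, hB0, hB⟩ := key n
  exact ⟨B, hB0, fun t h0 ht ω => hB t h0 (ht.trans ((div_le_iff₀ hℓ0).1 hn)) ω⟩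

lemma lipschitzWith_premium {K : ℝ≥0} (hg : LipschitzOnWith K g (Ici 0)) :
    LipschitzWith K fun y => g (max y 0) := by
  have h1 : LipschitzWith 1 fun y : ℝ => max y 0 := LipschitzWith.id.max_const 0
  have h2 := hg.comp (lipschitzOnWith_univ.2 h1) fun y _ => mem_Ici.2 (le_max_right y 0)
  rw [mul_one, lipschitzOnWith_univ] at h2
  exact h2

lemma exists_surplus_bounds (h : IsCompoundPoisson P 𝓕 lam Q T Y) {K : ℝ≥0}
    (hg : LipschitzOnWith K g (Ici 0)) (hu₀ : 0 < u₀) (hgu : ∀ x, 0 ≤ x → u₀ < g x)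
    (hu : IsRestrictedRate 𝓕 u₀ u) (hX : IsSurplus 𝓕 g T Y x u X) (t₀ : ℝ) :
    ∃ B G, 0 ≤ B ∧ 0 < G ∧ (∀ t, 0 ≤ t → t ≤ t₀ → ∀ ω, X t ω ≤ B) ∧
      ∀ t, 0 ≤ t → t ≤ t₀ → ∀ ω, g (max (X t ω) 0) ≤ G := by
  obtain ⟨B, hB0, hB⟩ := exists_surplus_le h hg hu₀ hgu hu hX t₀
  refine ⟨B, g 0 + K * B, hB0, ?_, hB, fun t h0 ht ω => ?_⟩
  · have hg0 : 0 < g 0 := hu₀.trans (hgu 0 le_rfl)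
    positivity
  · have h1 := hg.dist_le_mul (max (X t ω) 0) (mem_Ici.2 (le_max_right _ _)) 0 self_mem_Ici
    rw [Real.dist_eq, Real.dist_eq, sub_zero,
      abs_of_nonneg (le_max_right (X t ω) 0)] at h1
    have h2 : (K : ℝ) * max (X t ω) 0 ≤ K * B := by
      gcongr
      exact max_le (hB t h0 ht ω) hB0
    linarith [le_abs_self (g (max (X t ω) 0) - g 0)]

lemma surplus_le_of_premium_le (hu : IsRestrictedRate 𝓕 u₀ u) (hX : IsSurplus 𝓕 g T Y x u X)
    {t₀ G : ℝ} (hG : ∀ t, 0 ≤ t → t ≤ t₀ → ∀ ω, g (max (X t ω) 0) ≤ G) (hs : 0 ≤ s) (hst : s ≤ t)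
    (ht : t ≤ t₀) :
    X t ω ≤ X s ω - (claimTotal T Y t ω - claimTotal T Y s ω) + G * (t - s) := by
  have h1 := surplus_le (ω := ω) hu hX hs hst
  have h2 : ∫ r in s..t, g (max (X r ω) 0) ≤ ∫ _ in s..t, G :=
    intervalIntegral.integral_mono_on hst (intervalIntegrable_premium hX hs (hs.trans hst))
      intervalIntegrable_const fun r hr => hG r (hs.trans hr.1) (hr.2.trans ht) ω
  rw [intervalIntegral.integral_const, smul_eq_mul, mul_comm] at h2
  linarith

/-- A negative surplus stays negative for a little while. -/
lemma exists_surplus_neg_right (h : IsCompoundPoisson P 𝓕 lam Q T Y) {K : ℝ≥0}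
    (hg : LipschitzOnWith K g (Ici 0)) (hu₀ : 0 < u₀) (hgu : ∀ x, 0 ≤ x → u₀ < g x)
    (hu : IsRestrictedRate 𝓕 u₀ u) (hX : IsSurplus 𝓕 g T Y x u X) (hs : 0 ≤ s) (hneg : X s ω < 0) :
    ∃ t > s, ∀ r, s ≤ r → r < t → X r ω < 0 := by
  obtain ⟨B, G, -, hG0, -, hG⟩ := exists_surplus_bounds h hg hu₀ hgu hu hX (s + 1)
  have hN := claimCount_spec (ω := ω) h hs
  refine ⟨min (T (claimCount T s ω + 1) ω) (min (s + 1) (s + -X s ω / G)), ?_, fun r hr hrt => ?_⟩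
  · refine lt_min hN.2 (lt_min (by linarith) ?_)
    have : 0 < -X s ω / G := div_pos (neg_pos.2 hneg) hG0
    linarith
  · have hr1 : r < T (claimCount T s ω + 1) ω := hrt.trans_le (min_le_left _ _)
    have hr2 : r < s + 1 := hrt.trans_le ((min_le_right _ _).trans (min_le_left _ _))
    have hr3 : r < s + -X s ω / G := hrt.trans_le ((min_le_right _ _).trans (min_le_right _ _))
    have hc : claimCount T r ω = claimCount T s ω :=
      (claimCount_eq_iff h (hs.trans hr)).2 ⟨hN.1.trans hr, hr1⟩
    have h1 := surplus_le_of_premium_le (ω := ω) hu hX hG hs hr hr2.le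
    rw [claimTotal_congr hc, sub_self, sub_zero] at h1
    have h2 : G * (r - s) < -X s ω := by
      have : r - s < -X s ω / G := by linarith
      rwa [lt_div_iff₀ hG0, mul_comm] at this
    linarith

/-- The event that the surplus `X` has not been negative up to time `t`. -/
def alive (X : ℝ → Ω → ℝ) (t : ℝ) : Set Ω := {ω | ∀ r, 0 ≤ r → r ≤ t → 0 ≤ X r ω}

omit mΩ in
lemma alive_anti (hst : s ≤ t) : alive X t ⊆ alive X s := fun _ hω r h0 hr => hω r h0 (hr.trans hst)

lemma measurableSet_alive (h : IsCompoundPoisson P 𝓕 lam Q T Y) {K : ℝ≥0}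
    (hg : LipschitzOnWith K g (Ici 0)) (hu₀ : 0 < u₀) (hgu : ∀ x, 0 ≤ x → u₀ < g x)
    (hu : IsRestrictedRate 𝓕 u₀ u) (hX : IsSurplus 𝓕 g T Y x u X) (t : ℝ≥0) :
    MeasurableSet[𝓕 t] (alive X t) := by
  have heq : alive X t = {ω | 0 ≤ X t ω} ∩ ⋂ q : {q : ℚ // 0 ≤ (q : ℝ) ∧ (q : ℝ) ≤ t},
      {ω | 0 ≤ X ((q : ℚ) : ℝ) ω} := by
    ext ω
    simp only [mem_inter_iff, mem_iInter, mem_ofPred_eq]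
    constructor
    · exact fun hω => ⟨hω t t.coe_nonneg le_rfl, fun q => hω _ q.2.1 q.2.2⟩
    · rintro ⟨ht, hq⟩ r h0 hr
      by_contra! hneg
      have hrt : r < t := lt_of_le_of_ne hr fun he => by rw [he] at hneg; exact absurd ht (not_le.2
          hneg)
      obtain ⟨b, hb, hneg'⟩ := exists_surplus_neg_right h hg hu₀ hgu hu hX h0 hneg
      obtain ⟨q, hq1, hq2⟩ := exists_rat_btwn (lt_min hb hrt)
      exact absurd (hq ⟨q, h0.trans hq1.le, hq2.le.trans (min_le_right _ _)⟩)
        (not_le.2 (hneg' q hq1.le (hq2.trans_le (min_le_left _ _))))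
  rw [heq]
  refine (measurableSet_le measurable_const (hX.adapted t)).inter (MeasurableSet.iInter fun q => ?_)
  have h1 : Measurable[𝓕 ⟨q.1, q.2.1⟩] (X ((q : ℚ) : ℝ)) := hX.adapted ⟨q.1, q.2.1⟩
  have h2 : (⟨q.1, q.2.1⟩ : ℝ≥0) ≤ t := q.2.2
  exact measurableSet_le measurable_const (h1.mono (𝓕.mono h2) le_rfl)

omit mΩ in
lemma mem_alive_of_lt_ruinTime (ht : (t : EReal) < ruinTime fun s => X s ω) : ω ∈ alive X t := by
  intro r h0 hr
  by_contra! hneg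
  have h1 : (ruinTime fun s => X s ω) ≤ (r : EReal) := sInf_le ⟨r, ⟨h0, hneg⟩, rfl⟩
  exact absurd (ht.trans_le h1) (not_lt.2 (EReal.coe_le_coe_iff.2 hr))

omit mΩ in
lemma lt_ruinTime_of_mem_alive (hω : ω ∈ alive X t) (hst : s < t) :
    (s : EReal) < ruinTime fun s => X s ω := by
  refine (EReal.coe_lt_coe_iff.2 hst).trans_le (le_sInf ?_)
  rintro _ ⟨r, ⟨h0, hr⟩, rfl⟩
  by_contra! hlt
  exact absurd (hω r h0 (EReal.coe_lt_coe_iff.1 hlt).le) (not_le.2 hr)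

lemma measurable_ruinTime (h : IsCompoundPoisson P 𝓕 lam Q T Y) {K : ℝ≥0}
    (hg : LipschitzOnWith K g (Ici 0)) (hu₀ : 0 < u₀) (hgu : ∀ x, 0 ≤ x → u₀ < g x)
    (hu : IsRestrictedRate 𝓕 u₀ u) (hX : IsSurplus 𝓕 g T Y x u X) :
    Measurable fun ω => ruinTime fun s => X s ω := by
  refine measurable_of_Iio fun a => ?_
  have heq : (fun ω => ruinTime fun s => X s ω) ⁻¹' Iio a =
      ⋃ q : {q : ℚ // 0 ≤ (q : ℝ) ∧ ((q : ℝ) : EReal) < a}, {ω | X ((q : ℚ) : ℝ) ω < 0} := by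
    ext ω
    simp only [mem_preimage, mem_Iio, mem_iUnion, mem_ofPred_eq, ruinTime, sInf_lt_iff]
    constructor
    · rintro ⟨_, ⟨r, ⟨h0, hneg⟩, rfl⟩, hr⟩
      obtain ⟨b, hb, hneg'⟩ := exists_surplus_neg_right h hg hu₀ hgu hu hX h0 hneg
      obtain ⟨q, hq1, hq2⟩ := EReal.exists_rat_btwn_of_lt
        (lt_min hr (EReal.coe_lt_coe_iff.2 hb))
      have hq1' : r < q := EReal.coe_lt_coe_iff.1 hq1
      exact ⟨⟨q, h0.trans hq1'.le, hq2.trans_le (min_le_left _ _)⟩, hneg' q hq1'.le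
        (EReal.coe_lt_coe_iff.1 (hq2.trans_le (min_le_right _ _)))⟩
    · rintro ⟨q, hq⟩
      exact ⟨_, ⟨q, ⟨q.2.1, hq⟩, rfl⟩, q.2.2⟩
  rw [heq]
  refine MeasurableSet.iUnion fun q => ?_
  have h1 : Measurable[𝓕 ⟨q.1, q.2.1⟩] (X ((q : ℚ) : ℝ)) := hX.adapted ⟨q.1, q.2.1⟩
  exact measurableSet_lt (h1.mono (𝓕.le _) le_rfl) measurable_const

end Surplus

/-! ### Expectations of functions of the increments -/

section IncrementLaw

variable {Ω : Type*} [mΩ : MeasurableSpace Ω] {P : Measure Ω} [IsProbabilityMeasure P]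
  {𝓕 : Filtration ℝ≥0 mΩ} {lam : ℝ} {Q : Measure ℝ} {T Y : ℕ → Ω → ℝ}

lemma integral_claimIncrement (h : IsCompoundPoisson P 𝓕 lam Q T Y) (hlam : 0 < lam) {s t : ℝ≥0}
    (hst : s ≤ t) {b : ℝ → ℝ} (hb : Measurable b) {C : ℝ} (hbC : ∀ y, |b y| ≤ C) (a d : ℝ) :
    ∫ p, (if p.1 = 0 then a else if p.1 = 1 then b p.2 else d) ∂P.map (claimIncrement T Y s t) =
      a * Real.exp (-(lam * (t - s))) +
      lam * (t - s) * Real.exp (-(lam * (t - s))) * ∫ y, b y ∂Q +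
      d * (1 - Real.exp (-(lam * (t - s))) - lam * (t - s) * Real.exp (-(lam * (t - s)))) := by
  have := isProbabilityMeasure_claimLaw h
  have hm := measurable_claimIncrement (s := s) (t := t) h
  set L := P.map (claimIncrement T Y s t) with hL
  have : IsProbabilityMeasure L := Measure.isProbabilityMeasure_map hm.aemeasurable
  set e₀ := Real.exp (-(lam * (t - s))) with he₀
  set e₁ := lam * (t - s) * e₀ with he₁
  have hts : (0 : ℝ) ≤ t - s := sub_nonneg.2 (NNReal.coe_le_coe.2 hst)
  have he₁0 : 0 ≤ e₁ := by positivity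
  have hS0 : MeasurableSet ({0} ×ˢ univ : Set (ℤ × ℝ)) :=
    (measurableSet_singleton _).prod MeasurableSet.univ
  have hS1 : MeasurableSet ({1} ×ˢ univ : Set (ℤ × ℝ)) :=
    (measurableSet_singleton _).prod MeasurableSet.univ
  have hL0 : L.real ({0} ×ˢ univ) = e₀ := by
    rw [Measure.real, hL, Measure.map_apply hm hS0, measure_claimIncrement_zero h hlam hst,
      ENNReal.toReal_ofReal (Real.exp_pos _).le]
  have hL1 : (L.restrict ({1} ×ˢ univ)).map Prod.snd = ENNReal.ofReal e₁ • Q := by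
    ext A hA
    rw [Measure.map_apply measurable_snd hA, Measure.restrict_apply (measurable_snd hA), hL,
      Measure.map_apply hm ((measurable_snd hA).inter hS1), Measure.smul_apply, smul_eq_mul,
      ← measure_claimIncrement_one h hlam hst hA]
    congr 1
    ext ω
    simp [and_comm]
  have hL1' : L.real ({1} ×ˢ univ) = e₁ := by
    rw [Measure.real, hL, Measure.map_apply hm hS1, measure_claimIncrement_one h hlam hst .univ,
      measure_univ, mul_one, ENNReal.toReal_ofReal he₁0]
  have hI1 : ∫ p in {1} ×ˢ univ, b p.2 ∂L = e₁ * ∫ y, b y ∂Q := by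
    rw [← integral_map (φ := Prod.snd) measurable_snd.aemeasurable hb.aestronglyMeasurable, hL1,
      integral_smul_measure, ENNReal.toReal_ofReal he₁0, smul_eq_mul]
  have hbi : Integrable (fun p : ℤ × ℝ => b p.2) L :=
    Integrable.of_bound (hb.comp measurable_snd).aestronglyMeasurable C (ae_of_all _ fun p => hbC _)
  have hfun : (fun p : ℤ × ℝ => if p.1 = 0 then a else if p.1 = 1 then b p.2 else d) =
      fun p => (({0} ×ˢ univ : Set (ℤ × ℝ)).indicator (fun _ => a - d) p +
        (({1} ×ˢ univ : Set (ℤ × ℝ)).indicator (fun p => b p.2) p -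
        ({1} ×ˢ univ : Set (ℤ × ℝ)).indicator (fun _ => d) p)) + d := by
    funext p
    by_cases h0 : p.1 = 0
    · simp [indicator, h0]
    · by_cases h1 : p.1 = 1 <;> simp [indicator, h0, h1]
  have hi0 : Integrable (({0} ×ˢ univ : Set (ℤ × ℝ)).indicator (fun _ => a - d)) L :=
    (integrable_const _).indicator hS0
  have hi1 : Integrable (({1} ×ˢ univ : Set (ℤ × ℝ)).indicator (fun _ => d)) L :=
    (integrable_const _).indicator hS1
  have hi2 : Integrable (({1} ×ˢ univ : Set (ℤ × ℝ)).indicator (fun p => b p.2)) L :=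
    hbi.indicator hS1
  rw [hfun]
  refine (integral_add (hi0.add (hi2.sub hi1)) (integrable_const _)).trans ?_
  rw [integral_add' hi0 (hi2.sub hi1), integral_sub' hi2 hi1, integral_indicator hS0,
    integral_indicator hS1, integral_indicator hS1, hI1]
  simp only [integral_const, measureReal_restrict_apply MeasurableSet.univ, univ_inter, hL0, hL1',
    probReal_univ, smul_eq_mul]
  ring

/-- An expectation of a function of an `𝓕 s`-measurable variable and the increment over `(s, t]` can
be bounded by freezing the variable. -/
lemma integral_le_of_claimIncrement (h : IsCompoundPoisson P 𝓕 lam Q T Y) {s t : ℝ≥0}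
    (hst : s ≤ t) {Z : Ω → ℝ} (hZ : Measurable[𝓕 s] Z) {Φ : ℝ → ℤ × ℝ → ℝ}
    (hΦ : Measurable (Function.uncurry Φ)) {C : ℝ} (hC : ∀ z p, |Φ z p| ≤ C) {κ : ℝ}
    (hκ : ∀ ω, ∫ p, Φ (Z ω) p ∂P.map (claimIncrement T Y s t) ≤ κ) :
    ∫ ω, Φ (Z ω) (claimIncrement T Y s t ω) ∂P ≤ κ := by
  have hm := measurable_claimIncrement (s := s) (t := t) h
  have hZ' : Measurable Z := hZ.mono (𝓕.le s) le_rfl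
  have hind : IndepFun Z (claimIncrement T Y s t) P := by
    rw [IndepFun_iff_Indep]
    exact (indep_of_indep_of_le_right (h.indep_increment s t hst) hZ.comap_le).symm
  have hmap := (indepFun_iff_map_prod_eq_prod_map_map hZ'.aemeasurable hm.aemeasurable).1 hind
  have : IsProbabilityMeasure (P.map (claimIncrement T Y s t)) :=
    Measure.isProbabilityMeasure_map hm.aemeasurable
  have : IsProbabilityMeasure (P.map Z) := Measure.isProbabilityMeasure_map hZ'.aemeasurable
  have hint : Integrable (Function.uncurry Φ) ((P.map Z).prod (P.map (claimIncrement T Y s t))) :=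
    Integrable.of_bound hΦ.aestronglyMeasurable C (ae_of_all _ fun p => hC _ _)
  calc ∫ ω, Φ (Z ω) (claimIncrement T Y s t ω) ∂P
      = ∫ q, Function.uncurry Φ q ∂(P.map fun ω => (Z ω, claimIncrement T Y s t ω)) :=
        (integral_map (hZ'.prodMk hm).aemeasurable hΦ.aestronglyMeasurable).symm
    _ = ∫ z, ∫ p, Φ z p ∂P.map (claimIncrement T Y s t) ∂(P.map Z) := by
        rw [hmap, integral_prod _ hint]
        rfl
    _ = ∫ ω, ∫ p, Φ (Z ω) p ∂P.map (claimIncrement T Y s t) ∂P :=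
        integral_map hZ'.aemeasurable hint.integral_prod_left.aestronglyMeasurable
    _ ≤ ∫ _, κ ∂P := by
        refine integral_mono ?_ (integrable_const _) hκ
        exact hint.integral_prod_left.comp_measurable hZ'
    _ = κ := by simp

end IncrementLaw

/-! ### One time step of the discounted value along a surplus process -/

section Step

variable {Ω : Type*} [mΩ : MeasurableSpace Ω] {P : Measure Ω} {𝓕 : Filtration ℝ≥0 mΩ} {lam u₀ δ : ℝ}
  {g : ℝ → ℝ} {Q : Measure ℝ} {T Y : ℕ → Ω → ℝ} {x : ℝ} {u X : ℝ → Ω → ℝ} {s t : ℝ} {ω : Ω}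
  {W W' : ℝ → ℝ} {M : ℝ}

/-- The rate, at time `r`, of the discounted dividends up to ruin. -/
noncomputable def dividendRate (δ : ℝ) (u X : ℝ → Ω → ℝ) (r : ℝ) (ω : Ω) : ℝ :=
  {r : ℝ | 0 ≤ r ∧ (r : EReal) < ruinTime fun s => X s ω}.indicator
    (fun r => Real.exp (-δ * r) * u r ω) r

/-- The discounted value `e^{-δ t} W(X t)` at time `t`, set to zero after ruin. -/
noncomputable def discountedValue (δ : ℝ) (W : ℝ → ℝ) (X : ℝ → Ω → ℝ) (t : ℝ) : Ω → ℝ :=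
  (alive X t).indicator fun ω => Real.exp (-δ * t) * W (X t ω)

/-- The change over `(s, t]` of the discounted value plus the discounted dividends. -/
noncomputable def valueChange (δ : ℝ) (W : ℝ → ℝ) (u X : ℝ → Ω → ℝ) (s t : ℝ) (ω : Ω) : ℝ :=
  discountedValue δ W X t ω - discountedValue δ W X s ω + ∫ r in s..t, dividendRate δ u X r ω

lemma measurable_dividendRate (hu : IsRestrictedRate 𝓕 u₀ u)
    (hτ : Measurable fun ω => ruinTime fun s => X s ω) :
    Measurable (Function.uncurry (dividendRate δ u X)) := by
  have heq : Function.uncurry (dividendRate δ u X) =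
      {p : ℝ × Ω | 0 ≤ p.1 ∧ (p.1 : EReal) < ruinTime fun s => X s p.2}.indicator
        fun p => Real.exp (-δ * p.1) * u p.1 p.2 := rfl
  rw [heq]
  refine Measurable.indicator ?_ ?_
  · exact (measurable_const.mul measurable_fst).exp.mul hu.measurable
  · exact (measurableSet_le measurable_const measurable_fst).inter
      (measurableSet_lt measurable_fst.coe_real_ereal (hτ.comp measurable_snd))

lemma dividendRate_mem_Icc (hδ : 0 < δ) (hu₀ : 0 < u₀) (hu : IsRestrictedRate 𝓕 u₀ u) (r : ℝ)
    (ω : Ω) : dividendRate δ u X r ω ∈ Icc 0 u₀ := by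
  rw [dividendRate]
  by_cases hr : r ∈ {r : ℝ | 0 ≤ r ∧ (r : EReal) < ruinTime fun s => X s ω}
  · rw [indicator_of_mem hr]
    have h1 := hu.mem_Icc r hr.1 ω
    have h2 : Real.exp (-δ * r) ≤ 1 := Real.exp_le_one_iff.2 (by nlinarith [hr.1])
    exact ⟨mul_nonneg (Real.exp_pos _).le h1.1,
      (mul_le_mul h2 h1.2 h1.1 zero_le_one).trans_eq (one_mul _)⟩
  · rw [indicator_of_notMem hr]
    exact ⟨le_rfl, hu₀.le⟩

lemma intervalIntegrable_dividendRate (hδ : 0 < δ) (hu₀ : 0 < u₀) (hu : IsRestrictedRate 𝓕 u₀ u)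
    (hτ : Measurable fun ω => ruinTime fun s => X s ω) (s t : ℝ) :
    IntervalIntegrable (fun r => dividendRate δ u X r ω) volume s t := by
  rw [intervalIntegrable_iff]
  refine Measure.integrableOn_of_bounded (M := u₀) (by simp)
    ((measurable_dividendRate hu hτ).comp
      (measurable_id.prodMk measurable_const)).aestronglyMeasurable (ae_of_all _ fun r => ?_)
  have h := dividendRate_mem_Icc (X := X) hδ hu₀ hu r ω
  rw [Real.norm_eq_abs, abs_of_nonneg h.1]
  exact h.2

lemma integral_dividendRate_mem_Icc (hδ : 0 < δ) (hu₀ : 0 < u₀) (hu : IsRestrictedRate 𝓕 u₀ u)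
    (hτ : Measurable fun ω => ruinTime fun s => X s ω) (hst : s ≤ t) :
    ∫ r in s..t, dividendRate δ u X r ω ∈ Icc 0 (u₀ * (t - s)) := by
  constructor
  · exact intervalIntegral.integral_nonneg hst fun r _ => (dividendRate_mem_Icc hδ hu₀ hu r ω).1
  · calc ∫ r in s..t, dividendRate δ u X r ω ≤ ∫ _ in s..t, u₀ :=
        intervalIntegral.integral_mono_on hst (intervalIntegrable_dividendRate hδ hu₀ hu hτ s t)
          intervalIntegrable_const fun r _ => (dividendRate_mem_Icc hδ hu₀ hu r ω).2
      _ = u₀ * (t - s) := by simp [mul_comm]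

omit mΩ in
lemma discountedValue_mem_Icc (hδ : 0 < δ) (hW : ∀ y, W y ∈ Icc 0 M) (ht : 0 ≤ t) :
    discountedValue δ W X t ω ∈ Icc 0 M := by
  have hM : 0 ≤ M := (hW 0).1.trans (hW 0).2
  rw [discountedValue]
  by_cases hω : ω ∈ alive X t
  · rw [indicator_of_mem hω]
    have h2 : Real.exp (-δ * t) ≤ 1 := Real.exp_le_one_iff.2 (by nlinarith)
    exact ⟨mul_nonneg (Real.exp_pos _).le (hW _).1,
      (mul_le_mul h2 (hW _).2 (hW _).1 zero_le_one).trans_eq (one_mul _)⟩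
  · rw [indicator_of_notMem hω]
    exact ⟨le_rfl, hM⟩

lemma measurable_discountedValue {t : ℝ≥0} (hA : MeasurableSet[𝓕 t] (alive X t))
    (hX : IsSurplus 𝓕 g T Y x u X) (hW : Measurable W) :
    Measurable (discountedValue δ W X t) :=
  ((hW.comp ((hX.adapted t).mono (𝓕.le t) le_rfl)).const_mul _).indicator (𝓕.le t _ hA)

omit mΩ in
/-- Nothing changes after ruin. -/
lemma valueChange_eq_zero (hω : ω ∉ alive X s) (hst : s ≤ t) : valueChange δ W u X s t ω = 0 := by
  have h1 : ω ∉ alive X t := fun h => hω (alive_anti hst h)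
  rw [valueChange, discountedValue, discountedValue, indicator_of_notMem h1, indicator_of_notMem hω,
    sub_zero, zero_add]
  refine (intervalIntegral.integral_congr fun r hr => ?_).trans intervalIntegral.integral_zero
  rw [uIcc_of_le hst] at hr
  simp only [dividendRate]
  refine indicator_of_notMem (fun h => hω ?_) _
  exact alive_anti hr.1 (mem_alive_of_lt_ruinTime h.2)

lemma abs_valueChange_le (hδ : 0 < δ) (hu₀ : 0 < u₀) (hu : IsRestrictedRate 𝓕 u₀ u)
    (hτ : Measurable fun ω => ruinTime fun s => X s ω) (hW : ∀ y, W y ∈ Icc 0 M)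
    (hs : 0 ≤ s) (hst : s ≤ t) : |valueChange δ W u X s t ω| ≤ M + u₀ * (t - s) := by
  have h1 := discountedValue_mem_Icc (X := X) (ω := ω) hδ hW hs
  have h2 := discountedValue_mem_Icc (X := X) (ω := ω) hδ hW (hs.trans hst)
  have h3 := integral_dividendRate_mem_Icc (ω := ω) hδ hu₀ hu hτ hst
  rw [valueChange, abs_le]
  constructor <;> linarith [h1.1, h1.2, h2.1, h2.2, h3.1, h3.2]

/-- Without a claim, the discounted value changes to first order as along the ordinary differential
equation of the surplus. -/
lemma abs_valueChange_sub_le_of_no_claim (h : IsCompoundPoisson P 𝓕 lam Q T Y) {K : ℝ≥0}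
    (hg : LipschitzOnWith K g (Ici 0)) (hδ : 0 < δ) (hgu : ∀ x, 0 ≤ x → u₀ < g x)
    (hu : IsRestrictedRate 𝓕 u₀ u) (hX : IsSurplus 𝓕 g T Y x u X) (hW : ∀ y, W y ∈ Icc 0 M)
    (hW' : ∀ y, HasDerivAt W (W' y) y) {t₀ B G M' ε : ℝ}
    (hB : ∀ t, 0 ≤ t → t ≤ t₀ → ∀ ω, X t ω ≤ B)
    (hG : ∀ t, 0 ≤ t → t ≤ t₀ → ∀ ω, g (max (X t ω) 0) ≤ G)
    (hM' : ∀ y ∈ Icc 0 B, |W' y| ≤ M') (hs : 0 ≤ s) {η : ℝ} (hη : 0 ≤ η) (hδη : δ * η ≤ 1)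
    (ht : s + η ≤ t₀)
    (hε : ∀ y ∈ Icc 0 B, ∀ z ∈ Icc 0 B, |z - y| ≤ G * η → |W' z - W' y| ≤ ε)
    (hω : ω ∈ alive X s) (hN : claimCount T (s + η) ω = claimCount T s ω) :
    |valueChange δ W u X s (s + η) ω - Real.exp (-δ * s) *
      ((g (X s ω) * η - ∫ r in s..(s + η), u r ω) * W' (X s ω) - δ * η * W (X s ω) +
        ∫ r in s..(s + η), u r ω)| ≤
      (ε * G + (M' * K * G + δ ^ 2 * M + δ * (ε + M') * G + δ * u₀) * η) * η := by
  have hsη : s ≤ s + η := by linarith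
  have hS : ∀ r ∈ Icc s (s + η), claimTotal T Y r ω = claimTotal T Y s ω := by
    intro r hr
    refine claimTotal_congr (le_antisymm ?_ (claimCount_mono h hs hr.1))
    exact (claimCount_mono h (hs.trans hr.1) hr.2).trans hN.le
  have hup : ∀ r ∈ Icc s (s + η), X s ω ≤ X r ω := by
    intro r hr
    have := surplus_sub_claims_le (ω := ω) hgu hu hX hs hr.1
    rwa [hS r hr, sub_self, sub_zero] at this
  have hlo : ∀ r ∈ Icc s (s + η), X r ω ≤ X s ω + G * (r - s) := by
    intro r hr
    have := surplus_le_of_premium_le (ω := ω) hu hX hG hs hr.1 (hr.2.trans ht)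
    rwa [hS r hr, sub_self, sub_zero] at this
  have hy0 : 0 ≤ X s ω := hω s hs le_rfl
  have hG0 : 0 ≤ G := (hu.mem_Icc s hs ω).1.trans ((hu.mem_Icc s hs ω).2.trans
    ((hgu _ (le_max_right _ _)).le.trans (hG s hs (hsη.trans ht) ω)))
  have halive : ω ∈ alive X (s + η) := by
    intro r h0 hr
    rcases le_total r s with hrs | hrs
    · exact hω r h0 hrs
    · exact hy0.trans (hup r ⟨hrs, hr⟩)
  have hmem : s + η ∈ Icc s (s + η) := ⟨hsη, le_rfl⟩
  set y := X s ω with hy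
  set z := X (s + η) ω with hz
  set U := ∫ r in s..(s + η), u r ω with hU
  have hyz : y ≤ z := hup _ hmem
  have hzy : z - y ≤ G * η := by
    have := hlo _ hmem
    rw [add_sub_cancel_left] at this
    linarith
  have hyB : y ∈ Icc 0 B := ⟨hy0, hB s hs (hsη.trans ht) ω⟩
  have hzB : z ∈ Icc 0 B := ⟨hy0.trans hyz, hB _ (hs.trans hsη) ht ω⟩
  have hU0 := integral_rate_mem_Icc (ω := ω) hu hs hsη
  rw [add_sub_cancel_left, ← hU] at hU0
  have hε0 : 0 ≤ ε := (abs_nonneg _).trans (hε y hyB z hzB (by rwa [abs_of_nonneg (sub_nonneg.2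
      hyz)]))
  have hM'0 : 0 ≤ M' := (abs_nonneg _).trans (hM' y hyB)
  -- first-order Taylor formula for `W` between `y` and `z`
  have hTaylor : |W z - W y - (z - y) * W' y| ≤ ε * (z - y) := by
    have hd : ∀ w ∈ Icc y z, HasDerivWithinAt (fun w => W w - w * W' y) (W' w - W' y) (Icc y z) w :=
        by
      intro w _
      exact ((hW' w).sub ((hasDerivAt_id w).mul_const (W' y))).hasDerivWithinAt.congr_deriv (by
          simp)
    have hb : ∀ w ∈ Icc y z, ‖W' w - W' y‖ ≤ ε := by
      intro w hw
      refine hε y hyB w ⟨hy0.trans hw.1, hw.2.trans hzB.2⟩ ?_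
      rw [abs_of_nonneg (sub_nonneg.2 hw.1)]
      linarith [hw.2]
    have := (convex_Icc y z).norm_image_sub_le_of_norm_hasDerivWithin_le hd hb
      (left_mem_Icc.2 hyz) (right_mem_Icc.2 hyz)
    rw [Real.norm_eq_abs, Real.norm_eq_abs, abs_of_nonneg (sub_nonneg.2 hyz)] at this
    convert this using 2
    ring
  have hg' := lipschitzWith_premium hg
  -- the premium rate barely changes
  have hΔ : |z - y - (g y * η - U)| ≤ K * G * η * η := by
    have h1 := surplus_sub (ω := ω) hu hX hs (hs.trans hsη)
    rw [hS _ hmem, sub_self, sub_zero, ← hz, ← hy, ← hU] at h1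
    have h2 : z - y - (g y * η - U) = ∫ r in s..(s + η), (g (max (X r ω) 0) - g y) := by
      rw [intervalIntegral.integral_sub (intervalIntegrable_premium hX hs (hs.trans hsη))
        intervalIntegrable_const, intervalIntegral.integral_const, smul_eq_mul]
      rw [h1]
      ring
    rw [h2]
    have h3 := intervalIntegral.norm_integral_le_of_norm_le_const (a := s) (b := s + η)
      (f := fun r => g (max (X r ω) 0) - g y) (C := K * G * η) ?_
    · rwa [add_sub_cancel_left, abs_of_nonneg hη] at h3
    · intro r hr
      rw [uIoc_of_le hsη] at hr
      have hr' : r ∈ Icc s (s + η) := ⟨hr.1.le, hr.2⟩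
      have h4 := hg'.dist_le_mul (X r ω) y
      rw [max_eq_left hy0, Real.dist_eq, Real.dist_eq, abs_of_nonneg (sub_nonneg.2 (hup r hr'))]
          at h4
      refine h4.trans ?_
      rw [mul_assoc]
      refine mul_le_mul_of_nonneg_left ?_ K.2
      have h5 := hlo r hr'
      have h6 : G * (r - s) ≤ G * η := mul_le_mul_of_nonneg_left (by linarith [hr.2]) hG0
      linarith
  have hexp : |Real.exp (-(δ * η)) - 1 + δ * η| ≤ δ ^ 2 * η ^ 2 := by
    have := Real.abs_exp_sub_one_sub_id_le (x := -(δ * η))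
      (by rw [abs_neg, abs_of_nonneg (by positivity)]; exact hδη)
    convert this using 1
    · congr 1
      ring
    · ring
  set E := Real.exp (-δ * s) with hE
  have hE0 : 0 < E := Real.exp_pos _
  have hE1 : E ≤ 1 := Real.exp_le_one_iff.2 (by nlinarith)
  -- discounting the dividends within the step is of second order
  have hI : |(∫ r in s..(s + η), dividendRate δ u X r ω) - E * U| ≤ δ * u₀ * η * η := by
    have h1 : ∫ r in s..(s + η), dividendRate δ u X r ω =
        ∫ r in s..(s + η), Real.exp (-δ * r) * u r ω := by
      refine intervalIntegral.integral_congr_ae ?_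
      have hne : ∀ᵐ r : ℝ, r ≠ s + η := by
        simp [ae_iff]
      filter_upwards [hne] with r hr hr'
      rw [uIoc_of_le hsη] at hr'
      rw [dividendRate, indicator_of_mem]
      exact ⟨hs.trans hr'.1.le, lt_ruinTime_of_mem_alive halive (lt_of_le_of_ne hr'.2 hr)⟩
    have hui := intervalIntegrable_rate (ω := ω) hu hs (hs.trans hsη)
    have h2 : (∫ r in s..(s + η), Real.exp (-δ * r) * u r ω) - E * U =
        ∫ r in s..(s + η), (Real.exp (-δ * r) - E) * u r ω := by
      rw [hU, ← intervalIntegral.integral_const_mul, ← intervalIntegral.integral_sub]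
      · simp_rw [sub_mul]
      · exact hui.continuousOn_mul (by fun_prop)
      · exact hui.const_mul _
    rw [h1, h2]
    have h3 := intervalIntegral.norm_integral_le_of_norm_le_const (a := s) (b := s + η)
      (f := fun r => (Real.exp (-δ * r) - E) * u r ω) (C := δ * u₀ * η) ?_
    · rwa [add_sub_cancel_left, abs_of_nonneg hη] at h3
    · intro r hr
      rw [uIoc_of_le hsη] at hr
      have hur := hu.mem_Icc r (hs.trans hr.1.le) ω
      have h4 : Real.exp (-δ * r) = E * Real.exp (-(δ * (r - s))) := by
        rw [hE, ← Real.exp_add]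
        congr 1
        ring
      have h5 : 1 - δ * (r - s) ≤ Real.exp (-(δ * (r - s))) := by
        linarith [Real.add_one_le_exp (-(δ * (r - s)))]
      have h6 : Real.exp (-(δ * (r - s))) ≤ 1 := Real.exp_le_one_iff.2 (by nlinarith [hr.1])
      have h7 : |Real.exp (-δ * r) - E| ≤ δ * η := by
        rw [h4, abs_le]
        have h8 : δ * (r - s) ≤ δ * η := by nlinarith [hr.2]
        constructor <;> nlinarith
      rw [norm_mul, Real.norm_eq_abs, Real.norm_eq_abs, abs_of_nonneg hur.1]
      calc |Real.exp (-δ * r) - E| * u r ω ≤ δ * η * u₀ :=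
            mul_le_mul h7 hur.2 hur.1 (by positivity)
        _ = δ * u₀ * η := by ring
  have hexps : Real.exp (-δ * (s + η)) = E * Real.exp (-(δ * η)) := by
    rw [hE, ← Real.exp_add]
    congr 1
    ring
  rw [valueChange, discountedValue, discountedValue, indicator_of_mem halive, indicator_of_mem hω,
    ← hy, ← hz, ← hE, hexps]
  have hWz : |W z| ≤ M := by rw [abs_of_nonneg (hW z).1]; exact (hW z).2
  have hWzy : |W z - W y| ≤ (ε + M') * G * η := by
    have h1 : W z - W y = (W z - W y - (z - y) * W' y) + (z - y) * W' y := by ring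
    rw [h1]
    refine (abs_add_le _ _).trans ?_
    rw [abs_mul, abs_of_nonneg (sub_nonneg.2 hyz)]
    have h2 := hM' y hyB
    have h3 : (z - y) * |W' y| ≤ (G * η) * M' := mul_le_mul hzy h2 (abs_nonneg _) (by positivity)
    have h4 : ε * (z - y) ≤ ε * (G * η) := mul_le_mul_of_nonneg_left hzy hε0
    linarith
  have hsplit : E * Real.exp (-(δ * η)) * W z - E * W y + (∫ r in s..(s + η), dividendRate δ u X r
      ω) -
      E * ((g y * η - U) * W' y - δ * η * W y + U) =
      E * ((W z - W y - (z - y) * W' y) + (z - y - (g y * η - U)) * W' y +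
        (Real.exp (-(δ * η)) - 1 + δ * η) * W z - δ * η * (W z - W y)) +
      ((∫ r in s..(s + η), dividendRate δ u X r ω) - E * U) := by ring
  rw [hsplit]
  have hinner : |(W z - W y - (z - y) * W' y) + (z - y - (g y * η - U)) * W' y +
        (Real.exp (-(δ * η)) - 1 + δ * η) * W z - δ * η * (W z - W y)| ≤
      ε * (G * η) + K * G * η * η * M' + δ ^ 2 * η ^ 2 * M + δ * η * ((ε + M') * G * η) := by
    refine (abs_sub _ _).trans (add_le_add ((abs_add_le _ _).trans (add_le_add
      ((abs_add_le _ _).trans (add_le_add ?_ ?_)) ?_)) ?_)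
    · exact hTaylor.trans (mul_le_mul_of_nonneg_left hzy hε0)
    · rw [abs_mul]
      exact mul_le_mul hΔ (hM' y hyB) (abs_nonneg _) (by positivity)
    · rw [abs_mul]
      exact mul_le_mul hexp hWz (abs_nonneg _) (by positivity)
    · rw [abs_mul, abs_of_nonneg (by positivity : 0 ≤ δ * η)]
      exact mul_le_mul_of_nonneg_left hWzy (by positivity)
  refine (abs_add_le _ _).trans ?_
  rw [abs_mul, abs_of_pos hE0]
  have h1 := mul_le_mul hE1 hinner (abs_nonneg _) zero_le_one
  rw [one_mul] at h1
  refine (add_le_add h1 hI).trans (le_of_eq ?_)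
  ring

/-- One claim of size `y` changes the value from `W(X)` to `W(X - y)`, or to `0` at ruin; the drift
within the step matters only if it decides about ruin, that is, if `y ∈ (X, X + G η]`. -/
lemma abs_valueChange_sub_le_of_claim (h : IsCompoundPoisson P 𝓕 lam Q T Y)
    (hδ : 0 < δ) (hu₀ : 0 < u₀) (hgu : ∀ x, 0 ≤ x → u₀ < g x)
    (hu : IsRestrictedRate 𝓕 u₀ u) (hX : IsSurplus 𝓕 g T Y x u X)
    (hτ : Measurable fun ω => ruinTime fun s => X s ω) (hW : ∀ y, W y ∈ Icc 0 M)
    (hW' : ∀ y, HasDerivAt W (W' y) y) {t₀ B G M' : ℝ}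
    (hB : ∀ t, 0 ≤ t → t ≤ t₀ → ∀ ω, X t ω ≤ B)
    (hG : ∀ t, 0 ≤ t → t ≤ t₀ → ∀ ω, g (max (X t ω) 0) ≤ G)
    (hM' : ∀ y ∈ Icc 0 B, |W' y| ≤ M') (hs : 0 ≤ s) {η : ℝ} (hη : 0 ≤ η) (ht : s + η ≤ t₀)
    (hω : ω ∈ alive X s) :
    |valueChange δ W u X s (s + η) ω - Real.exp (-δ * s) *
      ((Ici 0).indicator W (X s ω - (claimTotal T Y (s + η) ω - claimTotal T Y s ω)) - W (X s ω))| ≤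
      (u₀ + δ * M + M' * G) * η + (Ioc (X s ω) (X s ω + G * η)).indicator (fun _ => M)
        (claimTotal T Y (s + η) ω - claimTotal T Y s ω) := by
  have hsη : s ≤ s + η := by linarith
  have hM : 0 ≤ M := (hW 0).1.trans (hW 0).2
  set y := X s ω with hy
  set z := X (s + η) ω with hz
  set S := claimTotal T Y (s + η) ω - claimTotal T Y s ω with hS
  have hy0 : 0 ≤ y := hω s hs le_rfl
  have hS0 : 0 ≤ S := sub_nonneg.2 (claimTotal_mono h hs hsη)
  have hyB : y ∈ Icc 0 B := ⟨hy0, hB s hs (hsη.trans ht) ω⟩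
  have hM'0 : 0 ≤ M' := (abs_nonneg _).trans (hM' y hyB)
  have hG0 : 0 ≤ G := (hu.mem_Icc s hs ω).1.trans ((hu.mem_Icc s hs ω).2.trans
    ((hgu _ (le_max_right _ _)).le.trans (hG s hs (hsη.trans ht) ω)))
  have hzlo : y - S ≤ z := surplus_sub_claims_le hgu hu hX hs hsη
  have hzup : z ≤ y - S + G * η := by
    have := surplus_le_of_premium_le (ω := ω) hu hX hG hs hsη ht
    rwa [add_sub_cancel_left] at this
  have hI := integral_dividendRate_mem_Icc (ω := ω) hδ hu₀ hu hτ hsη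
  rw [add_sub_cancel_left] at hI
  set E := Real.exp (-δ * s) with hE
  have hE0 : 0 < E := Real.exp_pos _
  have hE1 : E ≤ 1 := Real.exp_le_one_iff.2 (by nlinarith)
  have hexps : Real.exp (-δ * (s + η)) = E * Real.exp (-(δ * η)) := by
    rw [hE, ← Real.exp_add]
    congr 1
    ring
  have hq : |Real.exp (-(δ * η)) - 1| ≤ δ * η := by
    rw [abs_le]
    constructor
    · linarith [Real.add_one_le_exp (-(δ * η))]
    · have : Real.exp (-(δ * η)) ≤ 1 := Real.exp_le_one_iff.2 (by nlinarith)
      nlinarith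
  -- the value right after the step, without discounting
  set V := (alive X (s + η)).indicator (fun ω => W (X (s + η) ω)) ω with hV
  have hVM : V ∈ Icc 0 M := by
    rw [hV]
    by_cases hω' : ω ∈ alive X (s + η)
    · rw [indicator_of_mem hω']
      exact hW _
    · rw [indicator_of_notMem hω']
      exact ⟨le_rfl, hM⟩
  have hVW : |V - (Ici 0).indicator W (y - S)| ≤
      M' * G * η + (Ioc y (y + G * η)).indicator (fun _ => M) S := by
    have hpos : 0 ≤ M' * G * η := by positivity
    rcases le_or_gt S y with hSy | hSy
    · have halive : ω ∈ alive X (s + η) := by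
        intro r h0 hr
        rcases le_total r s with hrs | hrs
        · exact hω r h0 hrs
        · have h1 := surplus_sub_claims_le (ω := ω) hgu hu hX hs hrs
          have h2 := claimTotal_mono (ω := ω) h (hs.trans hrs) hr
          linarith
      rw [hV, indicator_of_mem halive, indicator_of_mem (show y - S ∈ Ici 0 from sub_nonneg.2 hSy),
        indicator_of_notMem (fun hm => absurd hm.1 (not_lt.2 hSy)), add_zero]
      have hd : ∀ w ∈ Icc (y - S) z, HasDerivWithinAt W (W' w) (Icc (y - S) z) w :=
        fun w _ => (hW' w).hasDerivWithinAt
      have hb : ∀ w ∈ Icc (y - S) z, ‖W' w‖ ≤ M' := fun w hw =>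
        hM' w ⟨(sub_nonneg.2 hSy).trans hw.1, hw.2.trans (hB _ (hs.trans hsη) ht ω)⟩
      have h1 := (convex_Icc (y - S) z).norm_image_sub_le_of_norm_hasDerivWithin_le hd hb
        (left_mem_Icc.2 hzlo) (right_mem_Icc.2 hzlo)
      rw [Real.norm_eq_abs, Real.norm_eq_abs, abs_of_nonneg (sub_nonneg.2 hzlo)] at h1
      refine h1.trans ?_
      rw [mul_assoc]
      exact mul_le_mul_of_nonneg_left (by linarith) hM'0
    · rw [indicator_of_notMem (show y - S ∉ Ici 0 from fun hm => absurd (sub_nonneg.1 hm)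
        (not_le.2 hSy)), sub_zero, abs_of_nonneg hVM.1]
      rcases le_or_gt S (y + G * η) with hSG | hSG
      · rw [indicator_of_mem (show S ∈ Ioc y (y + G * η) from ⟨hSy, hSG⟩)]
        linarith [hVM.2]
      · rw [indicator_of_notMem (show S ∉ Ioc y (y + G * η) from fun hm =>
          absurd hm.2 (not_le.2 hSG)), add_zero, hV, indicator_of_notMem]
        · exact hpos
        · intro ha
          have := ha (s + η) (hs.trans hsη) le_rfl
          linarith
  have hdV : discountedValue δ W X (s + η) ω = E * Real.exp (-(δ * η)) * V := by
    rw [discountedValue, hV, hexps]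
    by_cases hω' : ω ∈ alive X (s + η)
    · rw [indicator_of_mem hω', indicator_of_mem hω']
    · rw [indicator_of_notMem hω', indicator_of_notMem hω', mul_zero]
  have hdV' : discountedValue δ W X s ω = E * W y := by
    rw [discountedValue, indicator_of_mem hω]
  have hsplit : valueChange δ W u X s (s + η) ω - E * ((Ici 0).indicator W (y - S) - W y) =
      E * ((Real.exp (-(δ * η)) - 1) * V + (V - (Ici 0).indicator W (y - S))) +
        ∫ r in s..(s + η), dividendRate δ u X r ω := by
    rw [valueChange, hdV, hdV']
    ring
  rw [hsplit]
  have hinner : |(Real.exp (-(δ * η)) - 1) * V + (V - (Ici 0).indicator W (y - S))| ≤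
      δ * η * M + (M' * G * η + (Ioc y (y + G * η)).indicator (fun _ => M) S) := by
    refine (abs_add_le _ _).trans (add_le_add ?_ hVW)
    rw [abs_mul, abs_of_nonneg hVM.1]
    exact mul_le_mul hq hVM.2 hVM.1 (by positivity)
  refine (abs_add_le _ _).trans ?_
  rw [abs_mul, abs_of_pos hE0, abs_of_nonneg hI.1]
  have h1 := mul_le_mul hE1 hinner (abs_nonneg _) zero_le_one
  rw [one_mul] at h1
  linarith [hI.2]

end Step

/-! ### Verification -/

section Verification

variable {Ω : Type*} [mΩ : MeasurableSpace Ω] {P : Measure Ω} [IsProbabilityMeasure P]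
  {𝓕 : Filtration ℝ≥0 mΩ} {lam u₀ δ : ℝ}
  {g : ℝ → ℝ} {Q : Measure ℝ} {T Y : ℕ → Ω → ℝ} {x : ℝ} {u X : ℝ → Ω → ℝ}
  {W W' : ℝ → ℝ} {M : ℝ}

lemma integral_indicator_sub_eq_claimMean {f : ℝ → ℝ} (hQ0 : Q (Iio 0) = 0) (z : ℝ) :
    ∫ y, (Ici 0).indicator f (z - y) ∂Q = claimMean Q f z := by
  rw [claimMean_eq_integral_indicator]
  refine integral_congr_ae ?_
  have hae : ∀ᵐ y ∂Q, y ∉ Iio (0 : ℝ) := measure_eq_zero_iff_ae_notMem.1 hQ0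
  filter_upwards [hae] with y hy
  by_cases hyz : y ≤ z
  · rw [indicator_of_mem (show z - y ∈ Ici 0 from sub_nonneg.2 hyz),
      indicator_of_mem (show y ∈ Icc 0 z from ⟨not_lt.1 hy, hyz⟩)]
  · rw [indicator_of_notMem (show z - y ∉ Ici 0 from fun h => hyz (sub_nonneg.1 h)),
      indicator_of_notMem (show y ∉ Icc 0 z from fun h => hyz h.2)]

lemma integrable_valueChange (h : IsCompoundPoisson P 𝓕 lam Q T Y) {K : ℝ≥0}
    (hg : LipschitzOnWith K g (Ici 0)) (hδ : 0 < δ) (hu₀ : 0 < u₀)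
    (hgu : ∀ x, 0 ≤ x → u₀ < g x) (hu : IsRestrictedRate 𝓕 u₀ u) (hX : IsSurplus 𝓕 g T Y x u X)
    (hW : ∀ y, W y ∈ Icc 0 M) (hWm : Measurable W) {s t : ℝ≥0} (hst : s ≤ t) :
    Integrable (valueChange δ W u X s t) P := by
  have hτ := measurable_ruinTime h hg hu₀ hgu hu hX
  have hst' : (s : ℝ) ≤ t := NNReal.coe_le_coe.2 hst
  refine Integrable.of_bound (C := M + u₀ * (t - s)) ?_ (ae_of_all _ fun ω =>
    abs_valueChange_le hδ hu₀ hu hτ hW s.coe_nonneg hst')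
  have h1 : Measurable fun ω => ∫ r in (s : ℝ)..t, dividendRate δ u X r ω := by
    simp_rw [intervalIntegral.integral_of_le hst']
    exact ((measurable_dividendRate (δ := δ) hu hτ).comp
      measurable_swap).stronglyMeasurable.integral_prod_right'.measurable
  have h2 : ∀ t : ℝ≥0, Measurable (discountedValue δ W X t) := fun t =>
    measurable_discountedValue (measurableSet_alive h hg hu₀ hgu hu hX t) hX hWm
  exact (((h2 t).sub (h2 s)).add h1).aestronglyMeasurable

set_option maxHeartbeats 400000 in
/-- Apart from errors of higher order in `η`, the expected change of the value in a step of length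
`η` comes from a possible failure of the Hamilton-Jacobi-Bellman equation: the terms with `λ` cancel
between the paths without a claim and the paths with one claim. The sign `σ` selects a bound from
above or from below. -/
lemma integral_valueChange_le (h : IsCompoundPoisson P 𝓕 lam Q T Y) {K : ℝ≥0}
    (hg : LipschitzOnWith K g (Ici 0)) (hlam : 0 < lam) (hδ : 0 < δ) (hu₀ : 0 < u₀)
    (hgu : ∀ x, 0 ≤ x → u₀ < g x) (hu : IsRestrictedRate 𝓕 u₀ u) (hX : IsSurplus 𝓕 g T Y x u X)
    (hW : ∀ y, W y ∈ Icc 0 M) (hW' : ∀ y, HasDerivAt W (W' y) y) {t₀ B G M' ε : ℝ}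
    (hB : ∀ t, 0 ≤ t → t ≤ t₀ → ∀ ω, X t ω ≤ B)
    (hG : ∀ t, 0 ≤ t → t ≤ t₀ → ∀ ω, g (max (X t ω) 0) ≤ G) (hG0 : 0 ≤ G) (hε0 : 0 ≤ ε)
    (hM'0 : 0 ≤ M') (hM' : ∀ y ∈ Icc 0 B, |W' y| ≤ M') {s η : ℝ≥0} (hδη : δ * η ≤ 1)
    (ht : (s : ℝ) + η ≤ t₀)
    (hε : ∀ y ∈ Icc 0 B, ∀ z ∈ Icc 0 B, |z - y| ≤ G * η → |W' z - W' y| ≤ ε)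
    (hQε : ∀ z ∈ Icc 0 B, Q.real (Ioc z (z + G * η)) ≤ ε) {σ κ : ℝ} (hσ : σ = 1 ∨ σ = -1)
    (hκ0 : 0 ≤ κ)
    (hκ : ∀ ω ∈ alive X s, claimCount T (s + η) ω = claimCount T s ω →
      σ * ((g (X s ω) * η - ∫ r in s..(s + η), u r ω) * W' (X s ω) + (∫ r in s..(s + η), u r ω) -
        η * ((lam + δ) * W (X s ω) - lam * claimMean Q W (X s ω))) ≤ κ * η) :
    σ * ∫ ω, valueChange δ W u X s (s + η) ω ∂P ≤
      (κ + ε * G + (M' * K * G + δ ^ 2 * M + δ * (ε + M') * G + δ * u₀) * η) * η +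
      lam * η * ((u₀ + δ * M + M' * G) * η + M * ε) + (M + u₀ * η) * (lam * η) ^ 2 := by
  have hQp := isProbabilityMeasure_claimLaw h
  have hτ := measurable_ruinTime h hg hu₀ hgu hu hX
  have hA := measurableSet_alive h hg hu₀ hgu hu hX s
  have hM : 0 ≤ M := (hW 0).1.trans (hW 0).2
  have hWc : Continuous W := continuous_iff_continuousAt.2 fun y => (hW' y).continuousAt
  have hWm : Measurable W := hWc.measurable
  have hη : (0 : ℝ) ≤ η := η.coe_nonneg
  have hs : (0 : ℝ) ≤ s := s.coe_nonneg
  set E := Real.exp (-δ * s) with hE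
  have hE0 : 0 < E := Real.exp_pos _
  have hE1 : E ≤ 1 := Real.exp_le_one_iff.2 (by nlinarith)
  set c₀ : ℝ := (κ + ε * G + (M' * K * G + δ ^ 2 * M + δ * (ε + M') * G + δ * u₀) * η) * η with hc₀
  have hc₀0 : 0 ≤ c₀ := by positivity
  set c₁ : ℝ := (u₀ + δ * M + M' * G) * η with hc₁
  have hc₁0 : 0 ≤ c₁ := by positivity
  have hσ1 : |σ| = 1 := by rcases hσ with rfl | rfl <;> simp
  have hσa : ∀ a : ℝ, σ * a ≤ |a| := fun a =>
    (le_abs_self _).trans_eq (by rw [abs_mul, hσ1, one_mul])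
  -- the surplus at time `s`, or `-1` if ruin has occurred
  set Z : Ω → ℝ := fun ω => (alive X s).indicator (fun ω => X s ω + 1) ω - 1 with hZ
  have hZm : Measurable[𝓕 s] Z := by
    have h1 : Measurable[𝓕 s] ((alive X s).indicator (fun ω => X s ω + 1)) :=
      Measurable.indicator (m := 𝓕 s) ((hX.adapted s).add_const 1) hA
    exact h1.sub_const 1
  have hZa : ∀ ω ∈ alive X s, Z ω = X s ω := fun ω hω => by
    rw [hZ]; dsimp only; rw [indicator_of_mem hω, add_sub_cancel_right]
  have hZn : ∀ ω ∉ alive X s, Z ω < 0 := fun ω hω => by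
    rw [hZ]; dsimp only; rw [indicator_of_notMem hω]; norm_num
  set b : ℝ → ℝ → ℝ := fun z y => σ * (E * ((Ici 0).indicator W (z - y) - W z)) + c₁ +
    (Ioc z (z + G * η)).indicator (fun _ => M) y with hb
  set a : ℝ → ℝ := fun z => σ * (E * (η * (lam * (W z - claimMean Q W z)))) + c₀ with ha
  set Φ : ℝ → ℤ × ℝ → ℝ := fun z p => if z < 0 then 0 else
    if p.1 = 0 then a z else if p.1 = 1 then b z p.2 else M + u₀ * η with hΦ
  have ham : Measurable a :=
    (((((hWm.sub (measurable_claimMean hWm)).const_mul lam).const_mul (η : ℝ)).const_mul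
        E).const_mul
      σ).add_const c₀
  have hIoc : MeasurableSet {q : ℝ × ℝ | q.2 ∈ Ioc q.1 (q.1 + G * η)} :=
    (measurableSet_lt measurable_fst measurable_snd).inter
      (measurableSet_le measurable_snd (measurable_fst.add_const _))
  have hbm : Measurable (Function.uncurry b) := by
    have h1 : Measurable ((Ici (0 : ℝ)).indicator W) := hWm.indicator measurableSet_Ici
    have h2 : Measurable fun q : ℝ × ℝ => (Ioc q.1 (q.1 + G * η)).indicator (fun _ => M) q.2 :=
      (measurable_const (a := M)).indicator hIoc
    have h3 : Measurable fun q : ℝ × ℝ => (Ici 0).indicator W (q.1 - q.2) :=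
      h1.comp (measurable_fst.sub measurable_snd)
    have h4 : Measurable fun q : ℝ × ℝ => W q.1 := hWm.comp measurable_fst
    have h5 : Measurable fun q : ℝ × ℝ => σ * (E * ((Ici 0).indicator W (q.1 - q.2) - W q.1)) + c₁
        :=
      (((h3.sub h4).const_mul E).const_mul σ).add_const c₁
    exact h5.add h2
  clear_value a b Z
  have hΦm : Measurable (Function.uncurry Φ) := by
    have m1 : Measurable fun q : ℝ × (ℤ × ℝ) => q.2.1 := measurable_fst.comp measurable_snd
    have m2 : Measurable fun q : ℝ × (ℤ × ℝ) => (q.1, q.2.2) :=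
      measurable_fst.prodMk (measurable_snd.comp measurable_snd)
    have m3 : Measurable fun q : ℝ × (ℤ × ℝ) => b q.1 q.2.2 := hbm.comp m2
    have m4 : Measurable fun q : ℝ × (ℤ × ℝ) => a q.1 := ham.comp measurable_fst
    change Measurable fun q : ℝ × (ℤ × ℝ) => if q.1 < 0 then 0 else
      if q.2.1 = 0 then a q.1 else if q.2.1 = 1 then b q.1 q.2.2 else M + u₀ * η
    refine Measurable.ite (measurableSet_lt measurable_fst measurable_const) measurable_const ?_
    refine Measurable.ite (m1 (measurableSet_singleton 0)) m4 ?_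
    exact Measurable.ite (m1 (measurableSet_singleton 1)) m3 measurable_const
  clear_value Φ
  have hWi : ∀ y, (Ici 0).indicator W y ∈ Icc 0 M := by
    intro y
    by_cases hy : y ∈ Ici (0 : ℝ)
    · rw [indicator_of_mem hy]; exact hW y
    · rw [indicator_of_notMem hy]; exact ⟨le_rfl, hM⟩
  have hbC : ∀ z y, |b z y| ≤ M + c₁ + M := by
    intro z y
    rw [hb]
    refine (abs_add_le _ _).trans (add_le_add ((abs_add_le _ _).trans (add_le_add ?_ ?_)) ?_)
    · rw [abs_mul, hσ1, one_mul, abs_mul, abs_of_pos hE0]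
      have h1 : |(Ici 0).indicator W (z - y) - W z| ≤ M := by
        rw [abs_le]
        constructor <;> linarith [(hWi (z - y)).1, (hWi (z - y)).2, (hW z).1, (hW z).2]
      exact (mul_le_mul hE1 h1 (abs_nonneg _) zero_le_one).trans_eq (one_mul _)
    · rw [abs_of_nonneg hc₁0]
    · by_cases hy : y ∈ Ioc z (z + G * η)
      · rw [indicator_of_mem hy, abs_of_nonneg hM]
      · rw [indicator_of_notMem hy, abs_zero]; exact hM
  have haC : ∀ z, |a z| ≤ η * (lam * M) + c₀ := by
    intro z
    rw [ha]
    refine (abs_add_le _ _).trans (add_le_add ?_ (abs_of_nonneg hc₀0).le)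
    rw [abs_mul, hσ1, one_mul, abs_mul, abs_of_pos hE0, abs_mul, abs_of_nonneg hη, abs_mul,
      abs_of_pos hlam]
    have h1 : |W z - claimMean Q W z| ≤ M := by
      have h2 := claimMean_le (Q := Q) hM hWm hW z
      have h3 := claimMean_nonneg (Q := Q) (fun y => (hW y).1) z
      rw [abs_le]
      constructor <;> linarith [(hW z).1, (hW z).2]
    have h2 : η * (lam * |W z - claimMean Q W z|) ≤ η * (lam * M) := by gcongr
    exact (mul_le_mul hE1 h2 (by positivity) zero_le_one).trans_eq (one_mul _)
  have hΦC : ∀ z p, |Φ z p| ≤ (η * (lam * M) + c₀) + (M + c₁ + M) + (M + u₀ * η) := by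
    intro z p
    have h1 : 0 ≤ η * (lam * M) + c₀ := by positivity
    have h2 : 0 ≤ M + c₁ + M := by positivity
    have h3 : 0 ≤ M + u₀ * η := by positivity
    simp only [hΦ]
    split_ifs
    · rw [abs_zero]; positivity
    · linarith [haC z]
    · linarith [hbC z p.2]
    · rw [abs_of_nonneg h3]; linarith
  have hst : s ≤ s + η := le_self_add
  have hdom : ∀ ω, σ * valueChange δ W u X s (s + η) ω ≤
      Φ (Z ω) (claimIncrement T Y s ((s + η : ℝ≥0) : ℝ) ω) := by
    intro ω
    by_cases hω : ω ∈ alive X s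
    · have hX0 : ¬ X s ω < 0 := not_lt.2 (hω s hs le_rfl)
      simp only [hΦ, hZa ω hω, if_neg hX0, claimIncrement, NNReal.coe_add]
      split_ifs with h0 h1
      · have hN : claimCount T (s + η) ω = claimCount T s ω := by omega
        have h2 := abs_valueChange_sub_le_of_no_claim h hg hδ hgu hu hX hW hW' hB hG hM' hs hη hδη
            ht hε
          hω hN
        have h3 := hσa (valueChange δ W u X s (s + η) ω - E * ((g (X s ω) * η -
          ∫ r in s..(s + η : ℝ), u r ω) * W' (X s ω) - δ * η * W (X s ω) +
          ∫ r in s..(s + η : ℝ), u r ω))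
        have h4 := hκ ω hω hN
        have h5 := mul_le_mul_of_nonneg_left h4 hE0.le
        have h6 : E * (κ * η) ≤ κ * η := mul_le_of_le_one_left (by positivity) hE1
        have h7 := h3.trans h2
        simp only [ha, hc₀]
        set U := ∫ r in s..(s + η : ℝ), u r ω
        have h8 : σ * (E * (η * (lam * (W (X s ω) - claimMean Q W (X s ω))))) +
            E * (σ * ((g (X s ω) * η - U) * W' (X s ω) + U -
              η * ((lam + δ) * W (X s ω) - lam * claimMean Q W (X s ω)))) =
            σ * (E * ((g (X s ω) * η - U) * W' (X s ω) - δ * η * W (X s ω) + U)) := by ring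
        linarith
      · have h2 := abs_valueChange_sub_le_of_claim (B := B) h hδ hu₀ hgu hu hX hτ hW hW' hB hG hM'
          hs hη
          ht hω
        have h3 := (hσa _).trans h2
        simp only [hb, hc₁]
        linarith
      · have h2 := abs_valueChange_le (ω := ω) hδ hu₀ hu hτ hW hs (NNReal.coe_le_coe.2 hst)
        rw [NNReal.coe_add, add_sub_cancel_left] at h2
        exact (hσa _).trans h2
    · rw [valueChange_eq_zero hω (by linarith), mul_zero]
      simp only [hΦ, if_pos (hZn ω hω), le_rfl]
  have hinner : ∀ ω, ∫ p, Φ (Z ω) p ∂P.map (claimIncrement T Y s ((s + η : ℝ≥0) : ℝ)) ≤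
      c₀ + lam * η * (c₁ + M * ε) + (M + u₀ * η) * (lam * η) ^ 2 := by
    intro ω
    by_cases hω : ω ∈ alive X s
    · have hX0 : 0 ≤ X s ω := hω s hs le_rfl
      have hXB : X s ω ∈ Icc 0 B := ⟨hX0, hB s hs (by linarith) ω⟩
      simp only [hΦ, hZa ω hω, if_neg (not_lt.2 hX0)]
      set z := X s ω
      have hbz : Measurable (b z) := hbm.of_uncurry_left
      rw [integral_claimIncrement h hlam hst hbz (hbC z), NNReal.coe_add, add_sub_cancel_left]
      have hint : ∫ y, b z y ∂Q = σ * (E * (claimMean Q W z - W z)) + c₁ +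
          M * Q.real (Ioc z (z + G * η)) := by
        have i1 : Integrable (fun y => (Ici 0).indicator W (z - y)) Q := by
          refine Integrable.of_bound ((hWm.indicator measurableSet_Ici).comp
            (measurable_const.sub measurable_id)).aestronglyMeasurable M (ae_of_all _ fun y => ?_)
          rw [Real.norm_eq_abs, abs_of_nonneg (hWi _).1]
          exact (hWi _).2
        have i2 : Integrable (fun y => σ * (E * ((Ici 0).indicator W (z - y) - W z))) Q :=
          ((i1.sub (integrable_const _)).const_mul _).const_mul _
        have i3 : Integrable ((Ioc z (z + G * η)).indicator fun _ => M) Q :=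
          (integrable_const _).indicator measurableSet_Ioc
        simp only [hb]
        refine (integral_add (i2.add (integrable_const c₁)) i3).trans ?_
        rw [integral_add' i2 (integrable_const c₁),
          integral_const_mul, integral_const_mul, integral_sub i1 (integrable_const _),
          integral_indicator measurableSet_Ioc,
          integral_indicator_sub_eq_claimMean (claimLaw_Iio_zero h)]
        simp [mul_comm M]
      rw [hint]
      set q := Q.real (Ioc z (z + G * η)) with hq
      have hqε : q ≤ ε := hQε z hXB
      have hq0 : 0 ≤ q := measureReal_nonneg
      set r : ℝ := lam * η with hr
      have hr0 : 0 ≤ r := by positivity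
      set e := Real.exp (-r) with he
      have he0 : 0 < e := Real.exp_pos _
      have he1 : e ≤ 1 := Real.exp_le_one_iff.2 (by linarith)
      have her : 1 - r ≤ e := by linarith [Real.add_one_le_exp (-r)]
      have hP2 : 1 - e - r * e ≤ r ^ 2 := by nlinarith
      have h3 : (M + u₀ * η) * (1 - e - r * e) ≤ (M + u₀ * η) * r ^ 2 := by
        gcongr
      have h4 : c₀ * e ≤ c₀ := mul_le_of_le_one_right hc₀0 he1
      have h5 : r * e * (c₁ + M * q) ≤ r * (c₁ + M * ε) := by
        have : r * e ≤ r := mul_le_of_le_one_right hr0 he1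
        gcongr
      have h6 : a z * e + r * e * (σ * (E * (claimMean Q W z - W z)) + c₁ + M * q) =
          c₀ * e + r * e * (c₁ + M * q) := by
        simp only [ha, hr]
        ring
      linarith
    · simp only [hΦ, if_pos (hZn ω hω), integral_zero]
      positivity
  have hle := integral_le_of_claimIncrement h hst hZm hΦm hΦC hinner
  refine le_trans ?_ hle
  have hi := integrable_valueChange h hg hδ hu₀ hgu hu hX hW hWm hst
  rw [NNReal.coe_add] at hi
  rw [← integral_const_mul]
  refine integral_mono (hi.const_mul _) ?_ hdom
  have hm : Measurable fun ω => (Z ω, claimIncrement T Y s ((s + η : ℝ≥0) : ℝ) ω) :=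
    (hZm.mono (𝓕.le s) le_rfl).prodMk (measurable_claimIncrement h)
  have hm' : Measurable fun ω => Φ (Z ω) (claimIncrement T Y s ((s + η : ℝ≥0) : ℝ) ω) :=
    hΦm.comp hm
  exact Integrable.of_bound hm'.aestronglyMeasurable _ (ae_of_all _ fun ω => hΦC _ _)

end Verification

/-! ### Bounds for the value of a dividend scheme -/

section Bounds

variable {Ω : Type*} [mΩ : MeasurableSpace Ω] {P : Measure Ω} [IsProbabilityMeasure P]
  {𝓕 : Filtration ℝ≥0 mΩ} {lam u₀ δ : ℝ}
  {g : ℝ → ℝ} {Q : Measure ℝ} {T Y : ℕ → Ω → ℝ} {x : ℝ} {u X : ℝ → Ω → ℝ}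
  {W W' : ℝ → ℝ} {M : ℝ}

/-- If the Hamilton-Jacobi-Bellman expression, multiplied by the sign `σ`, is at most `κ` along the
controlled path, up to first order in the length `η` of a claim-free step, then the value of the
scheme up to time `t` exceeds `W x` in the direction `σ` by at most `κ t`. -/
lemma integral_valueChange_zero_le (h : IsCompoundPoisson P 𝓕 lam Q T Y) {K : ℝ≥0}
    (hg : LipschitzOnWith K g (Ici 0)) (hlam : 0 < lam) (hδ : 0 < δ) (hu₀ : 0 < u₀)
    (hgu : ∀ x, 0 ≤ x → u₀ < g x) (hQ : ∀ y, 0 < y → Q {y} = 0)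
    (hu : IsRestrictedRate 𝓕 u₀ u) (hX : IsSurplus 𝓕 g T Y x u X)
    (hW : ∀ y, W y ∈ Icc 0 M) (hW' : ∀ y, HasDerivAt W (W' y) y) (hW'c : Continuous W')
    (t : ℝ≥0) {σ κ : ℝ} (hσ : σ = 1 ∨ σ = -1) (hκ0 : 0 ≤ κ)
    (hκ : ∃ η₀ > 0, ∀ s η : ℝ≥0, η ≤ η₀ → s + η ≤ t → ∀ ω ∈ alive X s,
      claimCount T (s + η) ω = claimCount T s ω →
      σ * ((g (X s ω) * η - ∫ r in s..(s + η), u r ω) * W' (X s ω) + (∫ r in s..(s + η), u r ω) -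
        η * ((lam + δ) * W (X s ω) - lam * claimMean Q W (X s ω))) ≤ κ * η) :
    σ * ∫ ω, valueChange δ W u X 0 t ω ∂P ≤ κ * t := by
  have hQp := isProbabilityMeasure_claimLaw h
  have hτ := measurable_ruinTime h hg hu₀ hgu hu hX
  have hM : 0 ≤ M := (hW 0).1.trans (hW 0).2
  have hWc : Continuous W := continuous_iff_continuousAt.2 fun y => (hW' y).continuousAt
  obtain ⟨η₀, hη₀, hκ⟩ := hκ
  obtain ⟨B, G, hB0, hG0, hB, hG⟩ := exists_surplus_bounds h hg hu₀ hgu hu hX t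
  obtain ⟨M', hM'⟩ := isCompact_Icc.exists_bound_of_continuousOn (s := Icc 0 B) hW'c.continuousOn
  have hM'0 : 0 ≤ M' := (norm_nonneg _).trans (hM' 0 (left_mem_Icc.2 hB0))
  have hM'' : ∀ y ∈ Icc 0 B, |W' y| ≤ M' := hM'
  have hui : ∀ s t : ℝ≥0, s ≤ t → Integrable (valueChange δ W u X s t) P := fun s t hst =>
    integrable_valueChange h hg hδ hu₀ hgu hu hX hW hWc.measurable hst
  -- the distribution function of the claims
  have hqc : Continuous fun z : ℝ => Q.real (Icc 0 (max z 0)) := by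
    have := continuous_claimMean_max (f := fun _ => (1 : ℝ)) (M := 1) hQ continuous_const (by simp)
    simpa [claimMean] using this
  refine le_of_forall_pos_le_add fun ε' hε' => ?_
  obtain ⟨ε, hε0, hεε'⟩ : ∃ ε > 0, t * ((G + lam * M) * ε) ≤ ε' := by
    refine ⟨ε' / (t * (G + lam * M) + 1), by positivity, ?_⟩
    have h1 : t * ((G + lam * M) * (ε' / (t * (G + lam * M) + 1))) =
        ε' * ((t * (G + lam * M)) / (t * (G + lam * M) + 1)) := by ring
    rw [h1]
    have h2 : (t * (G + lam * M)) / (t * (G + lam * M) + 1) ≤ 1 := by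
      rw [div_le_one (by positivity)]
      linarith
    exact mul_le_of_le_one_right hε'.le h2
  obtain ⟨ρ, hρ0, hρ⟩ := Metric.uniformContinuousOn_iff.1
    (isCompact_Icc.uniformContinuousOn_of_continuous (s := Icc 0 (B + 1)) hW'c.continuousOn) ε hε0
  obtain ⟨ρ', hρ'0, hρ'⟩ := Metric.uniformContinuousOn_iff.1
    (isCompact_Icc.uniformContinuousOn_of_continuous (s := Icc 0 (B + 1)) hqc.continuousOn) ε hε0
  set c : ℝ → ℝ := fun η => κ + ε * G + lam * (M * ε) +
    ((M' * K * G + δ ^ 2 * M + δ * (ε + M') * G + δ * u₀) + lam * (u₀ + δ * M + M' * G) +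
      (M + u₀ * η) * lam ^ 2) * η with hc
  have hstep : ∀ η : ℝ≥0, η ≤ η₀ → δ * η ≤ 1 → G * η < ρ → G * η < ρ' → G * η ≤ 1 →
      ∀ s : ℝ≥0, s + η ≤ t → σ * ∫ ω, valueChange δ W u X s (s + η) ω ∂P ≤ c η * η := by
    intro η h1 h2 h3 h4 h5 s hs
    have hs' : (s : ℝ) + η ≤ t := by exact_mod_cast hs
    refine (integral_valueChange_le h hg hlam hδ hu₀ hgu hu hX hW hW' hB hG hG0.le hε0.le hM'0 hM''
        h2
      hs' ?_ ?_ hσ hκ0 (hκ s η h1 hs)).trans (le_of_eq ?_)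
    · intro y hy z hz hyz
      have := hρ z ⟨hz.1, hz.2.trans (by linarith)⟩ y ⟨hy.1, hy.2.trans (by linarith)⟩
        (by rw [Real.dist_eq]; exact hyz.trans_lt h3)
      rw [Real.dist_eq] at this
      exact this.le
    · intro z hz
      have hGη : 0 ≤ G * η := by positivity
      have := hρ' (z + G * η) ⟨by linarith [hz.1], by linarith [hz.2]⟩ z ⟨hz.1, by linarith [hz.2]⟩
        (by rw [Real.dist_eq, add_sub_cancel_left, abs_of_nonneg hGη]; exact h4)
      rw [Real.dist_eq, max_eq_left hz.1, max_eq_left (by linarith [hz.1])] at this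
      have hdiff : Ioc z (z + G * η) = Icc 0 (z + G * η) \ Icc 0 z := by
        ext y
        simp only [mem_Ioc, Set.mem_sdiff, mem_Icc, not_and, not_le]
        refine ⟨fun hy => ⟨⟨hz.1.trans hy.1.le, hy.2⟩, fun _ => hy.1⟩,
          fun hy => ⟨hy.2 hy.1.1, hy.1.2⟩⟩
      rw [hdiff, measureReal_sdiff (Icc_subset_Icc_right (by linarith)) measurableSet_Icc]
      exact (le_abs_self _).trans this.le
    · rw [hc]
      ring
  have hsum : ∀ η : ℝ≥0, η ≤ η₀ → δ * η ≤ 1 → G * η < ρ → G * η < ρ' → G * η ≤ 1 →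
      ∀ n : ℕ, n * η ≤ t → σ * ∫ ω, valueChange δ W u X 0 (n * η : ℝ≥0) ω ∂P ≤ n * (c η * η) := by
    intro η h1 h2 h3 h4 h5 n
    induction n with
    | zero => simp [valueChange]
    | succ n ih =>
      intro hn
      have hn' : (n : ℝ≥0) * η + η ≤ t := by
        rw [Nat.cast_succ, add_mul, one_mul] at hn
        exact hn
      have h6 := ih (le_self_add.trans hn')
      have h7 := hstep η h1 h2 h3 h4 h5 (n * η) hn'
      have h8 : ∀ ω, valueChange δ W u X 0 ((n + 1 : ℕ) * η : ℝ≥0) ω =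
          valueChange δ W u X (0 : ℝ≥0) (n * η : ℝ≥0) ω +
          valueChange δ W u X (n * η : ℝ≥0) (n * η + η : ℝ≥0) ω := by
        intro ω
        have e1 : ((n + 1 : ℕ) * η : ℝ≥0) = n * η + η := by
          rw [Nat.cast_succ, add_mul, one_mul]
        rw [e1]
        have e2 := fun a b => intervalIntegrable_dividendRate (ω := ω) hδ hu₀ hu hτ a b
        simp only [valueChange, NNReal.coe_zero]
        rw [← intervalIntegral.integral_add_adjacent_intervals (e2 0 (n * η : ℝ≥0))
          (e2 (n * η : ℝ≥0) (n * η + η : ℝ≥0))]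
        ring
      simp_rw [h8]
      rw [integral_add (hui _ _ zero_le) (hui _ _ le_self_add), mul_add]
      rw [NNReal.coe_add]
      push_cast at h6 h7 ⊢
      linarith
  have htends : Tendsto (fun n : ℕ => t * c (t / (n + 1))) atTop (𝓝 (t * c 0)) := by
    have h1 : Tendsto (fun n : ℕ => (t : ℝ) / ((n : ℝ) + 1)) atTop (𝓝 0) :=
      tendsto_const_nhds.div_atTop (tendsto_atTop_add_const_right _ _ tendsto_natCast_atTop_atTop)
    have h2 : Continuous fun η => t * c η := by
      rw [hc]
      fun_prop
    exact (h2.tendsto 0).comp h1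
  have hev : ∀ᶠ n : ℕ in atTop, σ * ∫ ω, valueChange δ W u X 0 t ω ∂P ≤ t * c (t / (n + 1)) := by
    have h1 : Tendsto (fun n : ℕ => (t : ℝ) / ((n : ℝ) + 1)) atTop (𝓝 0) :=
      tendsto_const_nhds.div_atTop (tendsto_atTop_add_const_right _ _ tendsto_natCast_atTop_atTop)
    have hG1 : Tendsto (fun n : ℕ => G * ((t : ℝ) / ((n : ℝ) + 1))) atTop (𝓝 0) := by
      simpa using h1.const_mul G
    have hδ1 : Tendsto (fun n : ℕ => δ * ((t : ℝ) / ((n : ℝ) + 1))) atTop (𝓝 0) := by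
      simpa using h1.const_mul δ
    have hη₀' : (0 : ℝ) < η₀ := hη₀
    filter_upwards [h1.eventually (gt_mem_nhds hη₀'), hδ1.eventually (gt_mem_nhds zero_lt_one),
      hG1.eventually (gt_mem_nhds hρ0), hG1.eventually (gt_mem_nhds hρ'0),
      hG1.eventually (gt_mem_nhds zero_lt_one)] with n e1 e2 e3 e4 e5
    set η : ℝ≥0 := t / (n + 1) with hη
    have hηc : (η : ℝ) = t / (n + 1) := by rw [hη]; push_cast; rfl
    have hnη : ((n + 1 : ℕ) : ℝ≥0) * η = t := by
      rw [hη]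
      push_cast
      field_simp
    rw [← hηc] at e1 e2 e3 e4 e5 ⊢
    have := hsum η (NNReal.coe_le_coe.1 e1.le) e2.le e3 e4 e5.le (n + 1) hnη.le
    rw [hnη] at this
    refine this.trans (le_of_eq ?_)
    have h3 : ((n + 1 : ℕ) : ℝ) * η = t := by rw [← hnη]; push_cast; rfl
    rw [← h3]
    ring
  have hlim := ge_of_tendsto htends hev
  refine hlim.trans ?_
  rw [hc]
  simp only [mul_zero, add_zero]
  linarith

omit [IsProbabilityMeasure P] in
lemma valueChange_zero (h : IsCompoundPoisson P 𝓕 lam Q T Y) (hx : 0 ≤ x)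
    (hX : IsSurplus 𝓕 g T Y x u X) (t : ℝ) (ω : Ω) :
    valueChange δ W u X 0 t ω =
      discountedValue δ W X t ω - W x + ∫ r in (0 : ℝ)..t, dividendRate δ u X r ω := by
  have h0 : ω ∈ alive X 0 := by
    intro r h0 hr
    rw [le_antisymm hr h0, surplus_zero h hX]
    exact hx
  rw [valueChange]
  congr 2
  rw [discountedValue, indicator_of_mem h0, surplus_zero h hX]
  simp

/-- The dividends after time `t` are worth at most `e^{-δ t} u₀ / δ`. -/
lemma abs_dividendValue_sub_le (h : IsCompoundPoisson P 𝓕 lam Q T Y) {K : ℝ≥0}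
    (hg : LipschitzOnWith K g (Ici 0)) (hδ : 0 < δ) (hu₀ : 0 < u₀) (hgu : ∀ x, 0 ≤ x → u₀ < g x)
    (hx : 0 ≤ x) (hu : IsRestrictedRate 𝓕 u₀ u) (hX : IsSurplus 𝓕 g T Y x u X)
    (hW : ∀ y, W y ∈ Icc 0 (u₀ / δ)) (hWm : Measurable W) (t : ℝ≥0) :
    |dividendValue P δ u X - W x - ∫ ω, valueChange δ W u X 0 t ω ∂P| ≤
      2 * (u₀ / δ) * Real.exp (-δ * t) := by
  have hτ := measurable_ruinTime h hg hu₀ hgu hu hX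
  have hm := measurable_dividendRate (δ := δ) hu hτ
  have ht : (0 : ℝ) ≤ t := t.coe_nonneg
  have hexp : IntegrableOn (fun r => Real.exp (-δ * r)) (Ioi 0) :=
    integrableOn_exp_mul_Ioi (neg_lt_zero.2 hδ) 0
  have hbd : ∀ r ω, 0 ≤ r → dividendRate δ u X r ω ≤ u₀ * Real.exp (-δ * r) := by
    intro r ω hr
    rw [dividendRate]
    by_cases hr' : r ∈ {r : ℝ | 0 ≤ r ∧ (r : EReal) < ruinTime fun s => X s ω}
    · rw [indicator_of_mem hr', mul_comm]
      exact mul_le_mul_of_nonneg_right (hu.mem_Icc r hr ω).2 (Real.exp_pos _).le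
    · rw [indicator_of_notMem hr']
      positivity
  have hint : ∀ ω, IntegrableOn (fun r => dividendRate δ u X r ω) (Ioi 0) := by
    intro ω
    refine (hexp.const_mul u₀).mono' (hm.comp
      (measurable_id.prodMk measurable_const)).aestronglyMeasurable ?_
    refine (ae_restrict_mem measurableSet_Ioi).mono fun r hr => ?_
    have h1 := dividendRate_mem_Icc (X := X) hδ hu₀ hu r ω
    exact (abs_of_nonneg h1.1).trans_le (hbd r ω (mem_Ioi.1 hr).le)
  have hJ : dividendValue P δ u X = ∫ ω, (∫ r in Ioi 0, dividendRate δ u X r ω) ∂P := by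
    rw [dividendValue]
    refine integral_congr_ae (ae_of_all _ fun ω => ?_)
    have hms : MeasurableSet {r : ℝ | 0 ≤ r ∧ (r : EReal) < ruinTime fun s => X s ω} :=
      (measurableSet_le measurable_const measurable_id).inter
        (measurableSet_lt measurable_coe_real_ereal measurable_const)
    simp only
    rw [← integral_Ici_eq_integral_Ioi, ← integral_indicator hms, ← integral_indicator
        measurableSet_Ici]
    congr 1
    funext r
    by_cases hr : r ∈ Ici (0 : ℝ)
    · rw [indicator_of_mem hr]
      rfl
    · rw [indicator_of_notMem hr, indicator_of_notMem (fun h => hr h.1)]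
  have hsplit : ∀ ω, ∫ r in Ioi 0, dividendRate δ u X r ω =
      valueChange δ W u X 0 t ω + W x + ((∫ r in Ioi (t : ℝ), dividendRate δ u X r ω) -
        discountedValue δ W X t ω) := by
    intro ω
    rw [valueChange_zero h hx hX, ← intervalIntegral.integral_interval_add_Ioi (hint ω)
      ((hint ω).mono_set (Ioi_subset_Ioi ht))]
    ring
  have htail : ∀ ω, ∫ r in Ioi (t : ℝ), dividendRate δ u X r ω ∈
      Icc 0 (u₀ / δ * Real.exp (-δ * t)) := by
    intro ω
    constructor
    · exact integral_nonneg fun r => (dividendRate_mem_Icc hδ hu₀ hu r ω).1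
    · calc ∫ r in Ioi (t : ℝ), dividendRate δ u X r ω ≤ ∫ r in Ioi (t : ℝ), u₀ * Real.exp (-δ * r)
        := by
            refine setIntegral_mono_on ((hint ω).mono_set (Ioi_subset_Ioi ht))
              ((hexp.mono_set (Ioi_subset_Ioi ht)).const_mul u₀) measurableSet_Ioi fun r hr => ?_
            exact hbd r ω (ht.trans (mem_Ioi.1 hr).le)
        _ = u₀ / δ * Real.exp (-δ * t) := by
            rw [integral_const_mul, integral_exp_mul_Ioi (neg_lt_zero.2 hδ)]
            field_simp
  have hdisc : ∀ ω, discountedValue δ W X t ω ∈ Icc 0 (u₀ / δ * Real.exp (-δ * t)) := by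
    intro ω
    rw [discountedValue]
    by_cases hω : ω ∈ alive X t
    · rw [indicator_of_mem hω, mul_comm (Real.exp _)]
      refine ⟨mul_nonneg (hW _).1 (Real.exp_pos _).le, ?_⟩
      exact mul_le_mul_of_nonneg_right (hW _).2 (Real.exp_pos _).le
    · rw [indicator_of_notMem hω]
      exact ⟨le_rfl, by positivity⟩
  have hvc : Integrable (valueChange δ W u X 0 t) P := by
    simpa using integrable_valueChange h hg hδ hu₀ hgu hu hX hW hWm (zero_le (a := t))
  have hrest : Integrable (fun ω => (∫ r in Ioi (t : ℝ), dividendRate δ u X r ω) -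
      discountedValue δ W X t ω) P := by
    refine Integrable.sub ?_ ?_
    · refine Integrable.of_bound (C := u₀ / δ * Real.exp (-δ * t)) ?_ (ae_of_all _ fun ω => ?_)
      · exact (hm.comp measurable_swap).stronglyMeasurable.integral_prod_right'.aestronglyMeasurable
      · rw [Real.norm_eq_abs, abs_of_nonneg (htail ω).1]
        exact (htail ω).2
    · refine Integrable.of_bound (C := u₀ / δ * Real.exp (-δ * t)) ?_ (ae_of_all _ fun ω => ?_)
      · exact (measurable_discountedValue (measurableSet_alive h hg hu₀ hgu hu hX t) hX
          hWm).aestronglyMeasurable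
      · rw [Real.norm_eq_abs, abs_of_nonneg (hdisc ω).1]
        exact (hdisc ω).2
  rw [hJ]
  simp_rw [hsplit]
  have e1 : ∫ ω, (valueChange δ W u X 0 t ω + W x + ((∫ r in Ioi (t : ℝ), dividendRate δ u X r ω) -
      discountedValue δ W X t ω)) ∂P = ∫ ω, valueChange δ W u X 0 t ω ∂P + W x +
      ∫ ω, ((∫ r in Ioi (t : ℝ), dividendRate δ u X r ω) - discountedValue δ W X t ω) ∂P := by
    refine (integral_add (hvc.add (integrable_const (W x))) hrest).trans ?_
    rw [integral_add' hvc (integrable_const (W x))]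
    simp
  rw [e1]
  have e2 : ∀ a b c : ℝ, a + b + c - b - a = c := fun a b c => by ring
  rw [e2, ← Real.norm_eq_abs]
  refine (norm_integral_le_of_norm_le_const (C := 2 * (u₀ / δ) * Real.exp (-δ * t))
    (ae_of_all _ fun ω => ?_)).trans (by simp)
  rw [Real.norm_eq_abs, abs_le]
  constructor <;> linarith [(htail ω).1, (htail ω).2, (hdisc ω).1, (hdisc ω).2]

lemma tendsto_two_mul_exp_neg_mul (hδ : 0 < δ) (a : ℝ) :
    Tendsto (fun n : ℕ => a * Real.exp (-δ * n)) atTop (𝓝 0) := by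
  have h1 : Tendsto (fun n : ℕ => -δ * (n : ℝ)) atTop atBot :=
    tendsto_natCast_atTop_atTop.const_mul_atTop_of_neg (neg_lt_zero.2 hδ)
  simpa using (Real.tendsto_exp_atBot.comp h1).const_mul a

/-- No dividend scheme is worth more than a bounded solution of the Hamilton-Jacobi-Bellman
equation. -/
theorem dividendValue_le (h : IsCompoundPoisson P 𝓕 lam Q T Y) {K : ℝ≥0}
    (hg : LipschitzOnWith K g (Ici 0)) (hlam : 0 < lam) (hδ : 0 < δ) (hu₀ : 0 < u₀)
    (hgu : ∀ x, 0 ≤ x → u₀ < g x) (hQ : ∀ y, 0 < y → Q {y} = 0) (hx : 0 ≤ x)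
    (hu : IsRestrictedRate 𝓕 u₀ u) (hX : IsSurplus 𝓕 g T Y x u X)
    (hW : ∀ y, W y ∈ Icc 0 (u₀ / δ)) (hW' : ∀ y, HasDerivAt W (W' y) y) (hW'c : Continuous W')
    (hhjb : ∀ x, 0 ≤ x →
      max (g x * W' x) ((g x - u₀) * W' x + u₀) = (lam + δ) * W x - lam * claimMean Q W x) :
    dividendValue P δ u X ≤ W x := by
  have hWm : Measurable W :=
    (continuous_iff_continuousAt.2 fun y => (hW' y).continuousAt).measurable
  have key : ∀ t : ℝ≥0, dividendValue P δ u X - W x ≤ 2 * (u₀ / δ) * Real.exp (-δ * t) := by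
    intro t
    have h1 := abs_dividendValue_sub_le h hg hδ hu₀ hgu hx hu hX hW hWm t
    have h2 := integral_valueChange_zero_le (σ := 1) (κ := 0) h hg hlam hδ hu₀ hgu hQ hu hX hW hW'
        hW'c t
      (Or.inl rfl) le_rfl ⟨1, one_pos, fun s η _ _ ω hω _ => ?_⟩
    · linarith [le_abs_self (dividendValue P δ u X - W x - ∫ ω, valueChange δ W u X 0 t ω ∂P)]
    · have hU := integral_rate_mem_Icc (ω := ω) hu s.coe_nonneg
        (show (s : ℝ) ≤ s + η by linarith [η.coe_nonneg])
      rw [add_sub_cancel_left] at hU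
      rw [← hhjb _ (hω s s.coe_nonneg le_rfl), one_mul, zero_mul]
      set U := ∫ r in (s : ℝ)..(s + η), u r ω
      set p := W' (X s ω)
      have e1 := mul_le_mul_of_nonneg_left (le_max_left (g (X s ω) * p) ((g (X s ω) - u₀) * p + u₀))
        η.coe_nonneg
      have e2 := mul_le_mul_of_nonneg_left (le_max_right (g (X s ω) * p) ((g (X s ω) - u₀) * p +
          u₀))
        η.coe_nonneg
      rcases le_total p 1 with hp | hp
      · nlinarith [hU.1, hU.2]
      · nlinarith [hU.1, hU.2]
  have hlim := tendsto_two_mul_exp_neg_mul hδ (2 * (u₀ / δ))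
  have := ge_of_tendsto hlim (Eventually.of_forall fun n : ℕ => key n)
  linarith

/-- A continuous feedback control that violates the Hamilton-Jacobi-Bellman equation by at most `ε`
is nearly optimal. -/
lemma le_dividendValue_add (h : IsCompoundPoisson P 𝓕 lam Q T Y) {K : ℝ≥0}
    (hg : LipschitzOnWith K g (Ici 0)) (hlam : 0 < lam) (hδ : 0 < δ) (hu₀ : 0 < u₀)
    (hgu : ∀ x, 0 ≤ x → u₀ < g x) (hQ : ∀ y, 0 < y → Q {y} = 0) (hx : 0 ≤ x)
    (hu : IsRestrictedRate 𝓕 u₀ u) (hX : IsSurplus 𝓕 g T Y x u X)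
    (hW : ∀ y, W y ∈ Icc 0 (u₀ / δ)) (hW' : ∀ y, HasDerivAt W (W' y) y) (hW'c : Continuous W')
    {v : ℝ → ℝ} (hv : Continuous v) (huv : ∀ r ω, 0 ≤ r → 0 ≤ X r ω → u r ω = v (X r ω)) {ε : ℝ}
    (hε : 0 < ε) (hhjb : ∀ x, 0 ≤ x →
      (lam + δ) * W x - lam * claimMean Q W x - ε ≤ (g x - v x) * W' x + v x) (t : ℝ≥0) :
    W x ≤ dividendValue P δ u X + 2 * (u₀ / δ) * Real.exp (-δ * t) + 2 * ε * t := by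
  have hWm : Measurable W :=
    (continuous_iff_continuousAt.2 fun y => (hW' y).continuousAt).measurable
  have h1 := abs_dividendValue_sub_le h hg hδ hu₀ hgu hx hu hX hW hWm t
  obtain ⟨B, G, hB0, hG0, hB, hG⟩ := exists_surplus_bounds h hg hu₀ hgu hu hX t
  obtain ⟨M', hM'⟩ := isCompact_Icc.exists_bound_of_continuousOn (s := Icc 0 B) hW'c.continuousOn
  have hM'0 : 0 ≤ M' := (norm_nonneg _).trans (hM' 0 (left_mem_Icc.2 hB0))
  have hε' : 0 < ε / (M' + 1) := by positivity
  obtain ⟨ρ, hρ0, hρ⟩ := Metric.uniformContinuousOn_iff.1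
    (isCompact_Icc.uniformContinuousOn_of_continuous (s := Icc 0 B) hv.continuousOn) _ hε'
  have h2 := integral_valueChange_zero_le (σ := -1) (κ := 2 * ε) h hg hlam hδ hu₀ hgu hQ hu hX hW
      hW'
    hW'c t (Or.inr rfl) (by positivity) ⟨Real.toNNReal (ρ / (2 * G)), by simpa using by positivity,
      fun s η hη hst ω hω hN => ?_⟩
  · linarith [neg_abs_le (dividendValue P δ u X - W x - ∫ ω, valueChange δ W u X 0 t ω ∂P)]
  · have hη0 : (0 : ℝ) ≤ η := η.coe_nonneg
    have hs0 : (0 : ℝ) ≤ s := s.coe_nonneg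
    have hη' : (η : ℝ) ≤ ρ / (2 * G) := by
      have : (η : ℝ) ≤ Real.toNNReal (ρ / (2 * G)) := NNReal.coe_le_coe.2 hη
      rwa [Real.coe_toNNReal _ (by positivity)] at this
    have hGη : G * η < ρ := by
      rw [le_div_iff₀ (by positivity)] at hη'
      nlinarith
    have hst' : (s : ℝ) + η ≤ t := by exact_mod_cast hst
    have hsη : (s : ℝ) ≤ s + η := by linarith
    have hX0 : 0 ≤ X s ω := hω s hs0 le_rfl
    -- the control hardly changes within the step
    have hU : |(∫ r in (s : ℝ)..(s + η), u r ω) - v (X s ω) * η| ≤ ε / (M' + 1) * η := by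
      have e1 : (∫ r in (s : ℝ)..(s + η), u r ω) - v (X s ω) * η =
          ∫ r in (s : ℝ)..(s + η), (u r ω - v (X s ω)) := by
        rw [intervalIntegral.integral_sub (intervalIntegrable_rate hu hs0 (hs0.trans hsη))
          intervalIntegrable_const, intervalIntegral.integral_const, smul_eq_mul,
              add_sub_cancel_left,
          mul_comm]
      rw [e1]
      have e2 := intervalIntegral.norm_integral_le_of_norm_le_const (a := (s : ℝ)) (b := s + η)
        (f := fun r => u r ω - v (X s ω)) (C := ε / (M' + 1)) ?_
      · rwa [add_sub_cancel_left, abs_of_nonneg hη0] at e2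
      · intro r hr
        rw [uIoc_of_le hsη] at hr
        have hr0 : 0 ≤ r := hs0.trans hr.1.le
        have hS : claimTotal T Y r ω = claimTotal T Y s ω :=
          claimTotal_congr (le_antisymm ((claimCount_mono h hr0 hr.2).trans hN.le)
            (claimCount_mono h hs0 hr.1.le))
        have e3 := surplus_sub_claims_le (ω := ω) hgu hu hX hs0 hr.1.le
        have e4 := surplus_le_of_premium_le (ω := ω) hu hX hG hs0 hr.1.le (hr.2.trans hst')
        rw [hS, sub_self, sub_zero] at e3 e4
        have hXr : 0 ≤ X r ω := hX0.trans e3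
        have e5 : G * (r - s) ≤ G * η := mul_le_mul_of_nonneg_left (by linarith [hr.2]) hG0.le
        have e6 := hρ (X r ω) ⟨hXr, hB r hr0 (hr.2.trans hst') ω⟩ (X s ω)
          ⟨hX0, hB s hs0 (hsη.trans hst') ω⟩ (by
            rw [Real.dist_eq, abs_of_nonneg (sub_nonneg.2 e3)]
            linarith)
        rw [huv r ω hr0 hXr]
        exact e6.le
    have hp : |W' (X s ω)| ≤ M' := hM' _ ⟨hX0, hB s hs0 (hsη.trans hst') ω⟩
    have e7 := mul_le_mul_of_nonneg_left (hhjb _ hX0) hη0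
    set U := ∫ r in (s : ℝ)..(s + η), u r ω
    set p := W' (X s ω)
    set R := (lam + δ) * W (X s ω) - lam * claimMean Q W (X s ω)
    have e8 : |(U - v (X s ω) * η) * (p - 1)| ≤ ε * η := by
      rw [abs_mul]
      have e9 : |p - 1| ≤ M' + 1 := (abs_sub _ _).trans (by rw [abs_one]; linarith)
      refine (mul_le_mul hU e9 (abs_nonneg _) (by positivity)).trans (le_of_eq ?_)
      field_simp
    have e10 := le_abs_self ((U - v (X s ω) * η) * (p - 1))
    have e11 : (-1 : ℝ) * ((g (X s ω) * η - U) * p + U - η * R) =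
      η * R - η * ((g (X s ω) - v (X s ω)) * p + v (X s ω)) + (U - v (X s ω) * η) * (p - 1) :=
          by ring
    rw [e11]
    linarith

end Bounds

/-! ### The flow of a positive continuous vector field on the line -/

/-- The solution of `y' = b(y)` is obtained by inverting the travel time `Θ(y) = ∫_0^y dr / b(r)`;
no Lipschitz condition on `b` is needed. -/
lemma exists_flow {b : ℝ → ℝ} (hb : Continuous b) (hpos : ∀ y, 0 < b y) {C : ℝ} (hC : 0 < C)
    (hbC : ∀ y, b y ≤ C * (1 + max y 0)) :
    ∃ fl : ℝ → ℝ → ℝ, Continuous (Function.uncurry fl) ∧ (∀ z, fl z 0 = z) ∧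
      ∀ z t, HasDerivAt (fl z) (b (fl z t)) t := by
  have hbi : Continuous fun y => (b y)⁻¹ := hb.inv₀ fun y => (hpos y).ne'
  set Θ : ℝ → ℝ := fun y => ∫ r in (0 : ℝ)..y, (b r)⁻¹ with hΘ
  have hd : ∀ y, HasDerivAt Θ (b y)⁻¹ y := fun y => (hbi.integral_hasStrictDerivAt 0 y).hasDerivAt
  have hΘ0 : Θ 0 = 0 := intervalIntegral.integral_same
  have hΘc : Continuous Θ := continuous_iff_continuousAt.2 fun y => (hd y).continuousAt
  have hmono : StrictMono Θ := strictMono_of_hasDerivAt_pos hd fun y => inv_pos.2 (hpos y)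
  have htop : Tendsto Θ atTop atTop := by
    have hlog : Tendsto (fun y : ℝ => Real.log (1 + y) / C) atTop atTop :=
      (Real.tendsto_log_atTop.comp (tendsto_atTop_add_const_left _ 1 tendsto_id)).atTop_div_const hC
    refine tendsto_atTop_mono' _ ?_ hlog
    filter_upwards [eventually_ge_atTop 0] with y hy
    have hdiff : ∀ r ∈ Ici (0 : ℝ), HasDerivAt (fun y => Θ y - Real.log (1 + y) / C)
        ((b r)⁻¹ - 1 / (1 + r) / C) r := by
      intro r hr
      have h1 : (1 : ℝ) + r ≠ 0 := by linarith [mem_Ici.1 hr]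
      exact (hd r).sub ((((hasDerivAt_id r).const_add 1).log h1).div_const C)
    have hm : MonotoneOn (fun y => Θ y - Real.log (1 + y) / C) (Ici 0) := by
      refine monotoneOn_of_hasDerivWithinAt_nonneg (convex_Ici 0)
        (fun r hr => (hdiff r hr).continuousAt.continuousWithinAt)
        (fun r hr => (hdiff r (interior_subset hr)).hasDerivWithinAt) fun r hr => ?_
      have hr0 : 0 ≤ r := mem_Ici.1 (interior_subset hr)
      have h2 := hbC r
      rw [max_eq_left hr0] at h2
      rw [sub_nonneg, div_div, one_div, mul_comm]
      exact inv_anti₀ (hpos r) h2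
    have := hm self_mem_Ici (mem_Ici.2 hy) hy
    simp only [hΘ0, add_zero, Real.log_one, zero_div, sub_self] at this
    linarith
  have hbot : Tendsto Θ atBot atBot := by
    have hlin : Tendsto (fun y : ℝ => y / C) atBot atBot := tendsto_id.atBot_div_const hC
    refine tendsto_atBot_mono' _ ?_ hlin
    filter_upwards [eventually_le_atBot 0] with y hy
    have hdiff : ∀ r, HasDerivAt (fun y => Θ y - y / C) ((b r)⁻¹ - 1 / C) r :=
      fun r => (hd r).sub ((hasDerivAt_id r).div_const C)
    have hm : MonotoneOn (fun y => Θ y - y / C) (Iic 0) := by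
      refine monotoneOn_of_hasDerivWithinAt_nonneg (convex_Iic 0)
        (fun r _ => (hdiff r).continuousAt.continuousWithinAt)
        (fun r _ => (hdiff r).hasDerivWithinAt) fun r hr => ?_
      have hr0 : r ≤ 0 := mem_Iic.1 (interior_subset hr)
      have h2 := hbC r
      rw [max_eq_right hr0, add_zero, mul_one] at h2
      rw [sub_nonneg, one_div]
      exact inv_anti₀ (hpos r) h2
    have := hm (mem_Iic.2 hy) self_mem_Iic hy
    simp only [hΘ0, zero_div, sub_self] at this
    linarith
  set e := (hmono.orderIsoOfSurjective Θ (hΘc.surjective htop hbot)).toHomeomorph with he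
  have heΘ : ∀ y, e y = Θ y := fun y => rfl
  have hinv : ∀ s, HasDerivAt e.symm (b (e.symm s)) s := by
    intro s
    have h1 := HasDerivAt.of_local_left_inverse (f := Θ) (g := e.symm) (a := s)
      e.symm.continuous.continuousAt (hd (e.symm s)) (inv_pos.2 (hpos _)).ne'
      (Eventually.of_forall fun r => e.apply_symm_apply r)
    rwa [inv_inv] at h1
  refine ⟨fun z t => e.symm (Θ z + t), ?_, fun z => ?_, fun z t => ?_⟩
  · exact e.symm.continuous.comp ((hΘc.comp continuous_fst).add continuous_snd)
  · simp only
    rw [add_zero, ← heΘ, e.symm_apply_apply]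
  · have := (hinv (Θ z + t)).comp t ((hasDerivAt_id t).const_add (Θ z))
    rw [mul_one] at this
    exact this

/-! ### Surplus processes under feedback controls -/

section Feedback

/-- The surplus right after the `n`-th claim, if it moves along the flow `fl` between claims. -/
noncomputable def surplusAtClaim {Ω : Type*} (fl : ℝ → ℝ → ℝ) (T Y : ℕ → Ω → ℝ) (x : ℝ) :
    ℕ → Ω → ℝ
  | 0, _ => x
  | n + 1, ω => fl (surplusAtClaim fl T Y x n ω) (T (n + 1) ω - T n ω) - Y (n + 1) ω

/-- The process that moves along the flow `fl` between claims and jumps down by the claim sizes. -/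
noncomputable def flowSurplus {Ω : Type*} (fl : ℝ → ℝ → ℝ) (T Y : ℕ → Ω → ℝ) (x t : ℝ) (ω : Ω) : ℝ
    :=
  fl (surplusAtClaim fl T Y x (claimCount T t ω) ω) (t - T (claimCount T t ω) ω)

section Measurability

/-! In this section the `σ`-algebra on `Ω` represents the information at time `t`. -/

variable {Ω : Type*} [MeasurableSpace Ω] {T Y : ℕ → Ω → ℝ} {t : ℝ} {fl : ℝ → ℝ → ℝ} {x : ℝ}
  (ht : 0 ≤ t) (hmono : ∀ ω, StrictMono fun i => T i ω) (hT0 : ∀ ω, T 0 ω = 0)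
  (hN : ∀ ω s, 0 ≤ s → ∀ n, claimCount T s ω = n ↔ T n ω ≤ s ∧ s < T (n + 1) ω)
  (hNm : ∀ s, 0 ≤ s → s ≤ t → Measurable (claimCount T s))
  (hSm : ∀ s, 0 ≤ s → s ≤ t → Measurable (claimTotal T Y s))

include hmono hN hNm in
lemma measurableSet_claimTime_le {a : ℝ} (ha : 0 ≤ a) (hat : a ≤ t) (n : ℕ) :
    MeasurableSet {ω | T n ω ≤ a} := by
  have : {ω | T n ω ≤ a} = claimCount T a ⁻¹' Ici n := by
    ext ω
    have h1 := (hN ω a ha _).1 rfl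
    simp only [mem_ofPred_eq, mem_preimage, mem_Ici]
    constructor
    · intro h
      by_contra! hlt
      exact absurd (((hmono ω).monotone (Nat.succ_le_of_lt hlt)).trans h) (not_le.2 h1.2)
    · exact fun h => ((hmono ω).monotone h).trans h1.1
  rw [this]
  exact hNm a ha hat measurableSet_Ici

include ht hmono hT0 hN hNm in
lemma measurable_min_claimTime (n : ℕ) : Measurable fun ω => min (T n ω) t := by
  refine measurable_of_Iic fun a => ?_
  rcases lt_or_ge a t with hat | hat
  · rcases lt_or_ge a 0 with ha | ha
    · convert MeasurableSet.empty
      ext ω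
      have : 0 ≤ T n ω := (hT0 ω).ge.trans ((hmono ω).monotone (Nat.zero_le n))
      simp only [mem_preimage, mem_Iic, mem_empty_iff_false, iff_false, not_le]
      exact ha.trans_le (le_min this ht)
    · convert measurableSet_claimTime_le hmono hN hNm ha hat.le n using 1
      ext ω
      simp [not_le.2 hat]
  · convert MeasurableSet.univ
    ext ω
    simp [hat]

include ht hmono hT0 hN hNm hSm in
/-- The first `n` claims are known by time `t` if they have occurred: they are the aggregate claims
at some rational time between two claims, or at time `t`. -/
lemma measurable_indicator_sum_claims (n : ℕ) :
    Measurable ({ω | T n ω ≤ t}.indicator fun ω => ∑ i ∈ Finset.range n, Y (i + 1) ω) := by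
  have hTn := measurableSet_claimTime_le hmono hN hNm ht le_rfl n
  intro A hA
  have heq : ({ω | T n ω ≤ t}.indicator fun ω => ∑ i ∈ Finset.range n, Y (i + 1) ω) ⁻¹' A =
      (⋃ q : ℚ, claimCount T (min (max q 0) t) ⁻¹' {n} ∩ claimTotal T Y (min (max q 0) t) ⁻¹' A) ∪
      ({ω | T n ω ≤ t}ᶜ ∩ {_ω | (0 : ℝ) ∈ A}) := by
    ext ω
    have hq0 : ∀ q : ℚ, 0 ≤ min (max (q : ℝ) 0) t := fun q => le_min (le_max_right _ _) ht
    simp only [mem_preimage, mem_union, mem_iUnion, mem_inter_iff, mem_singleton_iff, mem_compl_iff,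
      mem_ofPred_eq]
    by_cases hω : T n ω ≤ t
    · rw [indicator_of_mem (show ω ∈ {ω | T n ω ≤ t} from hω)]
      simp only [hω, not_true_eq_false, false_and, or_false]
      constructor
      · intro h
        have hn0 : 0 ≤ T n ω := (hT0 ω).ge.trans ((hmono ω).monotone (Nat.zero_le n))
        have hlt : T n ω < T (n + 1) ω := hmono ω (Nat.lt_succ_self n)
        obtain ⟨q, hq⟩ : ∃ q : ℚ, claimCount T (min (max q 0) t) ω = n := by
          simp only [hN ω _ (hq0 _)]
          rcases lt_or_ge t (T (n + 1) ω) with hlt' | hge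
          · obtain ⟨q, hq⟩ := exists_rat_gt t
            refine ⟨q, ?_⟩
            rw [min_eq_right (hq.le.trans (le_max_left _ _))]
            exact ⟨hω, hlt'⟩
          · obtain ⟨q, hq1, hq2⟩ := exists_rat_btwn hlt
            refine ⟨q, ?_⟩
            rw [max_eq_left (hn0.trans hq1.le), min_eq_left (hq2.le.trans hge)]
            exact ⟨hq1.le, hq2⟩
        exact ⟨q, hq, by rwa [claimTotal_eq, hq]⟩
      · rintro ⟨q, hq, hA'⟩
        rwa [claimTotal_eq, hq] at hA'
    · rw [indicator_of_notMem (show ω ∉ {ω | T n ω ≤ t} from hω)]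
      simp only [hω, not_false_eq_true, true_and]
      constructor
      · exact Or.inr
      · rintro (⟨q, hq, -⟩ | h)
        · exact absurd (((hN ω _ (hq0 q) n).1 hq).1.trans (min_le_right _ _)) hω
        · exact h
  rw [heq]
  refine (MeasurableSet.iUnion fun q => ?_).union (hTn.compl.inter (MeasurableSet.const _))
  have hq0 : 0 ≤ min (max (q : ℝ) 0) t := le_min (le_max_right _ _) ht
  exact (hNm _ hq0 (min_le_right _ _) (measurableSet_singleton n)).inter
    (hSm _ hq0 (min_le_right _ _) hA)

include ht hmono hT0 hN hNm hSm in
lemma measurable_indicator_claim (n : ℕ) :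
    Measurable ({ω | T (n + 1) ω ≤ t}.indicator (Y (n + 1))) := by
  have hTn := measurableSet_claimTime_le hmono hN hNm ht le_rfl (n + 1)
  have h1 := measurable_indicator_sum_claims ht hmono hT0 hN hNm hSm (n + 1)
  have h2 := (measurable_indicator_sum_claims ht hmono hT0 hN hNm hSm n).indicator hTn
  convert h1.sub h2 using 1
  funext ω
  simp only [Pi.sub_apply]
  by_cases hω : ω ∈ {ω | T (n + 1) ω ≤ t}
  · have hω' : ω ∈ {ω | T n ω ≤ t} := ((hmono ω).monotone n.le_succ).trans hω
    rw [indicator_of_mem hω, indicator_of_mem hω, indicator_of_mem hω, indicator_of_mem hω',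
      Finset.sum_range_succ, add_sub_cancel_left]
  · rw [indicator_of_notMem hω, indicator_of_notMem hω, indicator_of_notMem hω, sub_zero]

include ht hmono hT0 hN hNm hSm in
lemma measurable_indicator_surplusAtClaim (hfl : Continuous (Function.uncurry fl)) (n : ℕ) :
    Measurable ({ω | T n ω ≤ t}.indicator (surplusAtClaim fl T Y x n)) := by
  induction n with
  | zero =>
    exact Measurable.indicator measurable_const
      (measurableSet_claimTime_le hmono hN hNm ht le_rfl 0)
  | succ n ih =>
    have hTn := measurableSet_claimTime_le hmono hN hNm ht le_rfl (n + 1)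
    have h1 := measurable_min_claimTime ht hmono hT0 hN hNm
    have h2 := (hfl.measurable.comp (ih.prodMk ((h1 (n + 1)).sub (h1 n)))).indicator hTn
    convert h2.sub (measurable_indicator_claim ht hmono hT0 hN hNm hSm n) using 1
    funext ω
    simp only [Pi.sub_apply]
    by_cases hω : ω ∈ {ω | T (n + 1) ω ≤ t}
    · have hω' : ω ∈ {ω | T n ω ≤ t} := ((hmono ω).monotone n.le_succ).trans hω
      rw [indicator_of_mem hω, indicator_of_mem hω, indicator_of_mem hω]
      simp only [Function.comp_apply, Function.uncurry]
      rw [indicator_of_mem hω', min_eq_left (mem_ofPred.1 hω), min_eq_left (mem_ofPred.1 hω')]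
      rfl
    · rw [indicator_of_notMem hω, indicator_of_notMem hω, indicator_of_notMem hω, sub_zero]

include ht hmono hT0 hN hNm hSm in
/-- The surplus up to time `t` is determined, jointly measurably, by the information at time `t`. -/
lemma measurable_flowSurplus_clamp (hfl : Continuous (Function.uncurry fl)) :
    Measurable fun p : ℝ × Ω => flowSurplus fl T Y x (max 0 (min p.1 t)) p.2 := by
  have hσ : Measurable fun p : ℝ × Ω => max 0 (min p.1 t) :=
    measurable_const.max (measurable_fst.min measurable_const)
  have hσ0 : ∀ r : ℝ, 0 ≤ max 0 (min r t) := fun r => le_max_left _ _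
  have hσt : ∀ r : ℝ, max 0 (min r t) ≤ t := fun r => max_le ht (min_le_right _ _)
  have h1 := measurable_min_claimTime ht hmono hT0 hN hNm
  have hle : ∀ n, MeasurableSet {p : ℝ × Ω | T n p.2 ≤ max 0 (min p.1 t)} := by
    intro n
    have : {p : ℝ × Ω | T n p.2 ≤ max 0 (min p.1 t)} =
        {p : ℝ × Ω | T n p.2 ≤ t} ∩ {p : ℝ × Ω | min (T n p.2) t ≤ max 0 (min p.1 t)} := by
      ext p
      simp only [mem_ofPred_eq, mem_inter_iff]
      refine ⟨fun h => ⟨h.trans (hσt _), (min_le_left _ _).trans h⟩, fun h => ?_⟩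
      rw [min_eq_left h.1] at h
      exact h.2
    rw [this]
    exact (measurable_snd (measurableSet_claimTime_le hmono hN hNm ht le_rfl n)).inter
      (measurableSet_le ((h1 n).comp measurable_snd) hσ)
  have hcount : Measurable fun p : ℝ × Ω => claimCount T (max 0 (min p.1 t)) p.2 := by
    refine measurable_to_countable' fun n => ?_
    have : (fun p : ℝ × Ω => claimCount T (max 0 (min p.1 t)) p.2) ⁻¹' {n} =
        {p : ℝ × Ω | T n p.2 ≤ max 0 (min p.1 t)} ∩
        {p : ℝ × Ω | T (n + 1) p.2 ≤ max 0 (min p.1 t)}ᶜ := by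
      ext p
      simp only [mem_preimage, mem_singleton_iff, hN p.2 _ (hσ0 p.1), mem_inter_iff, mem_ofPred_eq,
        mem_compl_iff, not_le]
    rw [this]
    exact (hle n).inter (hle (n + 1)).compl
  have hF : Measurable fun q : ℕ × (ℝ × Ω) => fl ({ω | T q.1 ω ≤ t}.indicator
      (surplusAtClaim fl T Y x q.1) q.2.2) (max 0 (min q.2.1 t) - min (T q.1 q.2.2) t) := by
    refine measurable_from_prod_countable_right fun n => ?_
    have h2 := measurable_indicator_surplusAtClaim (x := x) ht hmono hT0 hN hNm hSm hfl n
    exact hfl.measurable.comp ((h2.comp measurable_snd).prodMk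
      (hσ.sub ((h1 n).comp measurable_snd)))
  convert hF.comp (hcount.prodMk measurable_id) using 1
  funext p
  have h2 := ((hN p.2 _ (hσ0 p.1) _).1 rfl).1.trans (hσt p.1)
  simp only [Function.comp_apply, id]
  rw [indicator_of_mem (show p.2 ∈ {ω | T (claimCount T (max 0 (min p.1 t)) p.2) ω ≤ t} from h2),
    min_eq_left h2]
  rfl

end Measurability

lemma measurable_integral_section {Ω : Type*} [MeasurableSpace Ω] {f : ℝ × Ω → ℝ}
    (hf : Measurable f) (s t : ℝ) : Measurable fun ω => ∫ r in s..t, f (r, ω) := by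
  have h : ∀ s t : ℝ, Measurable fun ω => ∫ r in Ioc s t, f (r, ω) := fun s t =>
    (hf.comp measurable_swap).stronglyMeasurable.integral_prod_right'.measurable
  exact (h s t).sub (h t s)

section Equation

variable {Ω : Type*} [mΩ : MeasurableSpace Ω] {P : Measure Ω} {𝓕 : Filtration ℝ≥0 mΩ} {lam u₀ : ℝ}
  {g : ℝ → ℝ} {Q : Measure ℝ} {T Y : ℕ → Ω → ℝ} {x : ℝ} {fl : ℝ → ℝ → ℝ} {b : ℝ → ℝ}

lemma measurable_flowSurplus_clamp_filtration (h : IsCompoundPoisson P 𝓕 lam Q T Y)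
    (hfl : Continuous (Function.uncurry fl)) (t : ℝ≥0) :
    Measurable[(inferInstance : MeasurableSpace ℝ).prod (𝓕 t)]
      fun p : ℝ × Ω => flowSurplus fl T Y x (max 0 (min p.1 t)) p.2 := by
  refine @measurable_flowSurplus_clamp Ω (𝓕 t) T Y t fl x t.coe_nonneg h.strictMono_time h.time_zero
    (fun ω s hs n => claimCount_eq_iff h hs) (fun s hs hst => ?_) (fun s hs hst => ?_) hfl
  · have h2 : (⟨s, hs⟩ : ℝ≥0) ≤ t := hst
    exact (h.adapted_count ⟨s, hs⟩).mono (𝓕.mono h2) le_rfl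
  · have h2 : (⟨s, hs⟩ : ℝ≥0) ≤ t := hst
    exact (h.adapted_total ⟨s, hs⟩).mono (𝓕.mono h2) le_rfl

lemma measurable_flowSurplus (h : IsCompoundPoisson P 𝓕 lam Q T Y)
    (hfl : Continuous (Function.uncurry fl)) :
    Measurable fun p : ℝ × Ω => flowSurplus fl T Y x (max 0 p.1) p.2 := by
  refine measurable_of_tendsto_metrizable
    (f := fun (n : ℕ) (p : ℝ × Ω) => flowSurplus fl T Y x (max 0 (min p.1 (n : ℝ≥0))) p.2)
    (fun n => ?_) (tendsto_pi_nhds.2 fun p => ?_)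
  · refine (measurable_flowSurplus_clamp_filtration h hfl n).mono ?_ le_rfl
    exact sup_le_sup le_rfl (MeasurableSpace.comap_mono (𝓕.le n))
  · refine tendsto_const_nhds.congr' ?_
    obtain ⟨m, hm⟩ := exists_nat_ge p.1
    filter_upwards [eventually_ge_atTop m] with n hn
    rw [min_eq_left]
    simpa using hm.trans (Nat.cast_le.2 hn)

lemma flowSurplus_eq (h : IsCompoundPoisson P 𝓕 lam Q T Y) {n : ℕ} {r : ℝ} {ω : Ω} (hr : T n ω ≤ r)
    (hr' : r < T (n + 1) ω) :
    flowSurplus fl T Y x r ω = fl (surplusAtClaim fl T Y x n ω) (r - T n ω) := by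
  have h0 : 0 ≤ r := ((h.time_zero ω).ge.trans ((h.strictMono_time ω).monotone (Nat.zero_le
      n))).trans hr
  rw [flowSurplus, (claimCount_eq_iff h h0).2 ⟨hr, hr'⟩]

/-- Between two claims the flow equation holds in integrated form. -/
lemma integral_flowSurplus_between (h : IsCompoundPoisson P 𝓕 lam Q T Y) (hb : Continuous b)
    (hfl0 : ∀ z, fl z 0 = z) (hfld : ∀ z t, HasDerivAt (fl z) (b (fl z t)) t) {n : ℕ} {t : ℝ} {ω :
        Ω}
    (ht : T n ω ≤ t) (ht' : t ≤ T (n + 1) ω) :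
    IntervalIntegrable (fun r => b (flowSurplus fl T Y x r ω)) volume (T n ω) t ∧
    ∫ r in T n ω..t, b (flowSurplus fl T Y x r ω) =
      fl (surplusAtClaim fl T Y x n ω) (t - T n ω) - surplusAtClaim fl T Y x n ω := by
  set z := surplusAtClaim fl T Y x n ω with hz
  have hd : ∀ r, HasDerivAt (fun r => fl z (r - T n ω)) (b (fl z (r - T n ω))) r := by
    intro r
    have := (hfld z (r - T n ω)).comp r ((hasDerivAt_id r).sub_const (T n ω))
    rw [mul_one] at this
    exact this
  have hc : Continuous fun r => b (fl z (r - T n ω)) :=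
    hb.comp (continuous_iff_continuousAt.2 fun r => (hd r).continuousAt)
  have hae : ∀ᵐ r : ℝ, r ∈ uIoc (T n ω) t →
      b (fl z (r - T n ω)) = b (flowSurplus fl T Y x r ω) := by
    have hne : ∀ᵐ r : ℝ, r ≠ t := by simp [ae_iff]
    filter_upwards [hne] with r hr hr'
    rw [uIoc_of_le ht] at hr'
    rw [flowSurplus_eq h hr'.1.le ((lt_of_le_of_ne hr'.2 hr).trans_le ht')]
  constructor
  · exact (hc.intervalIntegrable _ _).congr_ae ((ae_restrict_iff' measurableSet_uIoc).2 hae)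
  · rw [← intervalIntegral.integral_congr_ae hae,
      intervalIntegral.integral_eq_sub_of_hasDerivAt (fun r _ => hd r) (hc.intervalIntegrable _ _),
      sub_self, hfl0]

lemma flowSurplus_equation (h : IsCompoundPoisson P 𝓕 lam Q T Y) (hb : Continuous b)
    (hfl0 : ∀ z, fl z 0 = z) (hfld : ∀ z t, HasDerivAt (fl z) (b (fl z t)) t) {t : ℝ} (ht : 0 ≤ t)
    (ω : Ω) :
    IntervalIntegrable (fun r => b (flowSurplus fl T Y x r ω)) volume 0 t ∧
    flowSurplus fl T Y x t ω = x + (∫ r in (0 : ℝ)..t, b (flowSurplus fl T Y x r ω)) -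
      claimTotal T Y t ω := by
  have key : ∀ n, IntervalIntegrable (fun r => b (flowSurplus fl T Y x r ω)) volume 0 (T n ω) ∧
      surplusAtClaim fl T Y x n ω = x + (∫ r in (0 : ℝ)..T n ω, b (flowSurplus fl T Y x r ω)) -
        ∑ i ∈ Finset.range n, Y (i + 1) ω := by
    intro n
    induction n with
    | zero => simp [h.time_zero, surplusAtClaim]
    | succ n ih =>
      have h1 := integral_flowSurplus_between (x := x) h hb hfl0 hfld
        ((h.strictMono_time ω).monotone n.le_succ) le_rfl
      refine ⟨ih.1.trans h1.1, ?_⟩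
      rw [← intervalIntegral.integral_add_adjacent_intervals ih.1 h1.1, h1.2, Finset.sum_range_succ,
        surplusAtClaim]
      linarith [ih.2]
  have hn := claimCount_spec (ω := ω) h ht
  have h1 := integral_flowSurplus_between (x := x) h hb hfl0 hfld hn.1 hn.2.le
  have h2 := key (claimCount T t ω)
  refine ⟨h2.1.trans h1.1, ?_⟩
  rw [← intervalIntegral.integral_add_adjacent_intervals h2.1 h1.1, h1.2, claimTotal_eq,
      flowSurplus]
  linarith [h2.2]

/-- Every continuous feedback control `v` with values in `[0, u₀]` is admissible. -/
theorem exists_feedback (h : IsCompoundPoisson P 𝓕 lam Q T Y) {K : ℝ≥0}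
    (hg : LipschitzOnWith K g (Ici 0)) (hgu : ∀ x, 0 ≤ x → u₀ < g x) {v : ℝ → ℝ}
    (hv : Continuous v) (hv0 : ∀ y, v y ∈ Icc 0 u₀) (x : ℝ) :
    ∃ u X : ℝ → Ω → ℝ, IsRestrictedRate 𝓕 u₀ u ∧ IsSurplus 𝓕 g T Y x u X ∧
      ∀ r ω, 0 ≤ r → u r ω = v (X r ω) := by
  have hgl := lipschitzWith_premium hg
  have hu₀ : 0 ≤ u₀ := (hv0 0).1.trans (hv0 0).2
  have hg0 : 0 < g 0 := hu₀.trans_lt (hgu 0 le_rfl)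
  set b : ℝ → ℝ := fun y => g (max y 0) - v y with hb
  have hbc : Continuous b := hgl.continuous.sub hv
  have hbpos : ∀ y, 0 < b y := fun y => sub_pos.2 ((hv0 y).2.trans_lt (hgu _ (le_max_right _ _)))
  have hbC : ∀ y, b y ≤ (g 0 + K) * (1 + max y 0) := by
    intro y
    have hm : 0 ≤ max y 0 := le_max_right _ _
    have h1 := hg.dist_le_mul (max y 0) (mem_Ici.2 hm) 0 self_mem_Ici
    rw [Real.dist_eq, Real.dist_eq, sub_zero, abs_of_nonneg hm] at h1
    have h2 := le_abs_self (g (max y 0) - g 0)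
    have h3 := (hv0 y).1
    have h4 : 0 ≤ g 0 * max y 0 := by positivity
    have h5 : (0 : ℝ) ≤ K := K.2
    simp only [hb]
    nlinarith
  obtain ⟨fl, hfl, hfl0, hfld⟩ := exists_flow hbc hbpos (by positivity : 0 < g 0 + K) hbC
  have heq := fun t (ht : 0 ≤ t) (ω : Ω) =>
    flowSurplus_equation (x := x) (b := b) h hbc hfl0 hfld ht ω
  have hclamp := fun t : ℝ≥0 => measurable_flowSurplus_clamp_filtration (x := x) h hfl t
  have hXt : ∀ t : ℝ≥0, Measurable[𝓕 t] (flowSurplus fl T Y x t) := by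
    intro t
    have h1 : Measurable[𝓕 t, (inferInstance : MeasurableSpace ℝ).prod (𝓕 t)] fun ω => ((t : ℝ), ω)
        :=
      @measurable_prodMk_left ℝ Ω _ (𝓕 t) (t : ℝ)
    have h2 := (hclamp t).comp h1
    convert h2 using 1
    funext ω
    simp
  have hjoint := measurable_flowSurplus (x := x) h hfl
  have hvint : ∀ (ω : Ω) (t : ℝ), 0 ≤ t →
      IntervalIntegrable (fun r => v (flowSurplus fl T Y x r ω)) volume 0 t := by
    intro ω t ht
    have h1 : IntervalIntegrable (fun r => v (flowSurplus fl T Y x (max 0 r) ω)) volume 0 t := by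
      rw [intervalIntegrable_iff]
      refine Measure.integrableOn_of_bounded (M := u₀) (by simp) (hv.measurable.comp
        (hjoint.comp (measurable_id.prodMk measurable_const))).aestronglyMeasurable
        (ae_of_all _ fun r => ?_)
      exact (abs_of_nonneg (hv0 _).1).trans_le (hv0 _).2
    refine h1.congr fun r hr => ?_
    rw [uIoc_of_le ht] at hr
    rw [max_eq_right hr.1.le]
  have hgv : ∀ y, g (max y 0) = b y + v y := fun y => by simp [hb]
  have huX : ∀ ω (t : ℝ), 0 ≤ t → ∫ s in (0 : ℝ)..t, v (flowSurplus fl T Y x (max 0 s) ω) =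
      ∫ s in (0 : ℝ)..t, v (flowSurplus fl T Y x s ω) := by
    intro ω t ht
    refine intervalIntegral.integral_congr fun r hr => ?_
    rw [uIcc_of_le ht] at hr
    rw [max_eq_right hr.1]
  refine ⟨fun t ω => v (flowSurplus fl T Y x (max 0 t) ω), flowSurplus fl T Y x, ?_, ?_, ?_⟩
  · refine ⟨hv.measurable.comp hjoint, fun t => ?_, fun t _ ω => hv0 _, fun t => ?_⟩
    · rw [max_eq_right t.coe_nonneg]
      exact hv.measurable.comp (hXt t)
    · have h1 := @measurable_integral_section Ω (𝓕 t) _ (hv.measurable.comp (hclamp t)) 0 t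
      convert h1 using 1
      funext ω
      refine intervalIntegral.integral_congr fun r hr => ?_
      rw [uIcc_of_le t.coe_nonneg] at hr
      simp only [Function.comp_apply]
      rw [min_eq_left hr.2]
  · refine ⟨hXt, fun ω t ht => ?_, fun ω t ht => ?_⟩
    · simp only [hgv]
      exact (heq t ht ω).1.add (hvint ω t ht)
    · rw [(heq t ht ω).2, huX ω t ht]
      simp only [hgv]
      rw [intervalIntegral.integral_add (heq t ht ω).1 (hvint ω t ht)]
      ring
  · intro r ω hr
    simp only
    rw [max_eq_right hr]

end Equation

end Feedback

/-! ### Identification of the value function -/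

/-- The value function coincides with every bounded solution of the Hamilton-Jacobi-Bellman
equation. -/
theorem restrictedValue_eq {Ω : Type*} [mΩ : MeasurableSpace Ω] {P : Measure Ω}
    [IsProbabilityMeasure P] {𝓕 : Filtration ℝ≥0 mΩ} {lam u₀ δ : ℝ} {g : ℝ → ℝ} {Q : Measure ℝ}
    {T Y : ℕ → Ω → ℝ} {W W' : ℝ → ℝ} (h : IsCompoundPoisson P 𝓕 lam Q T Y) {K : ℝ≥0}
    (hg : LipschitzOnWith K g (Ici 0)) (hlam : 0 < lam) (hδ : 0 < δ) (hu₀ : 0 < u₀)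
    (hgu : ∀ x, 0 ≤ x → u₀ < g x) (hQ : ∀ y, 0 < y → Q {y} = 0)
    (hW : ∀ y, W y ∈ Icc 0 (u₀ / δ)) (hW' : ∀ y, HasDerivAt W (W' y) y) (hW'c : Continuous W')
    (hhjb : ∀ x, 0 ≤ x →
      max (g x * W' x) ((g x - u₀) * W' x + u₀) = (lam + δ) * W x - lam * claimMean Q W x)
    {x : ℝ} (hx : 0 ≤ x) : restrictedValue P 𝓕 g T Y δ u₀ x = W x := by
  have key : ∀ ε > 0, ∃ u X : ℝ → Ω → ℝ, IsRestrictedRate 𝓕 u₀ u ∧ IsSurplus 𝓕 g T Y x u X ∧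
      W x - ε < dividendValue P δ u X := by
    intro ε hε
    obtain ⟨n, hn⟩ := ((tendsto_two_mul_exp_neg_mul hδ (2 * (u₀ / δ))).eventually
      (gt_mem_nhds (half_pos hε))).exists
    set ρ : ℝ := ε / (4 * u₀ * (n + 1)) with hρ
    have hρ0 : 0 < ρ := by positivity
    -- the optimal control `u₀ 1_{W' < 1}`, made continuous
    set v : ℝ → ℝ := fun y => u₀ * max 0 (min 1 ((1 - W' y) / ρ)) with hv
    have hvc : Continuous v := by
      rw [hv]
      fun_prop
    have hv0 : ∀ y, v y ∈ Icc 0 u₀ := fun y =>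
      ⟨mul_nonneg hu₀.le (le_max_left _ _),
        mul_le_of_le_one_right hu₀.le (max_le zero_le_one (min_le_left _ _))⟩
    obtain ⟨u, X, hu, hX, huX⟩ := exists_feedback h hg hgu hvc hv0 x
    refine ⟨u, X, hu, hX, ?_⟩
    have h1 := le_dividendValue_add h hg hlam hδ hu₀ hgu hQ hx hu hX hW hW' hW'c hvc
      (fun r ω hr _ => huX r ω hr) (mul_pos hu₀ hρ0) (fun y hy => ?_) (n : ℝ≥0)
    · have h2 : 2 * (u₀ * ρ) * n < ε / 2 := by
        have h3 : 2 * (u₀ * ρ) * n = ε / 2 * (n / (n + 1)) := by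
          rw [hρ]
          field_simp
          norm_num
        rw [h3]
        refine mul_lt_of_lt_one_right (half_pos hε) ?_
        rw [div_lt_one (by positivity)]
        linarith
      rw [NNReal.coe_natCast] at h1
      linarith
    · rw [← hhjb y hy]
      set p := W' y
      have hvp : u₀ * (1 - p) - u₀ * ρ ≤ v y * (1 - p) ∧ 0 ≤ v y * (1 - p) := by
        simp only [hv]
        rcases le_total (1 - p) 0 with hp | hp
        · have : (1 - p) / ρ ≤ 0 := div_nonpos_of_nonpos_of_nonneg hp hρ0.le
          rw [max_eq_left ((min_le_right _ _).trans this)]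
          constructor <;> nlinarith [mul_pos hu₀ hρ0]
        · refine ⟨?_, mul_nonneg (hv0 y).1 hp⟩
          rcases le_total ρ (1 - p) with hp' | hp'
          · rw [min_eq_left ((one_le_div hρ0).2 hp'), max_eq_right zero_le_one]
            linarith [mul_pos hu₀ hρ0]
          · have h2 : 0 ≤ u₀ * max 0 (min 1 ((1 - p) / ρ)) * (1 - p) := mul_nonneg (hv0 y).1 hp
            have h3 := mul_le_mul_of_nonneg_left hp' hu₀.le
            linarith
      rw [sub_le_iff_le_add]
      refine max_le ?_ ?_
      · nlinarith [mul_pos hu₀ hρ0]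
      · nlinarith
  refine (IsLUB.csSup_eq ⟨?_, ?_⟩ ?_)
  · rintro J ⟨u, X, hu, hX, rfl⟩
    exact dividendValue_le h hg hlam hδ hu₀ hgu hQ hx hu hX hW hW' hW'c hhjb
  · intro c hc
    refine le_of_forall_pos_lt_add fun ε hε => ?_
    obtain ⟨u, X, hu, hX, hJ⟩ := key ε hε
    linarith [hc ⟨u, X, hu, hX, rfl⟩]
  · obtain ⟨u, X, hu, hX, -⟩ := key 1 one_pos
    exact ⟨_, u, X, hu, hX, rfl⟩

end PDCP

theorem theorem3p2 {Ω : Type*} [mΩ : MeasurableSpace Ω] (P : Measure Ω) [IsProbabilityMeasure P]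
    (𝓕 : Filtration ℝ≥0 mΩ) (g : ℝ → ℝ) (T Y : ℕ → Ω → ℝ) (Q : Measure ℝ) (lam δ u₀ : ℝ)
    (hlam : 0 < lam) (hδ : 0 < δ) (hu₀ : 0 < u₀)
    (hg : ∃ K : ℝ≥0, LipschitzOnWith K g (Ici 0)) (hgu : ∀ x, 0 ≤ x → u₀ < g x)
    (hclaims : PDCP.IsCompoundPoisson P 𝓕 lam Q T Y)
    (hQ : ∀ y, 0 < y → Q {y} = 0) :
    ContDiffOn ℝ 1 (PDCP.restrictedValue P 𝓕 g T Y δ u₀) (Ici 0) ∧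
      ∀ x, 0 ≤ x →
        IsLUB ((fun u : ℝ =>
            (g x - u) * derivWithin (PDCP.restrictedValue P 𝓕 g T Y δ u₀) (Ici 0) x
              - (lam + δ) * PDCP.restrictedValue P 𝓕 g T Y δ u₀ x
              + lam * (∫ y in Icc 0 x, PDCP.restrictedValue P 𝓕 g T Y δ u₀ (x - y) ∂Q)
              + u) '' Icc 0 u₀) 0 := by
  obtain ⟨K, hg⟩ := hg
  have := PDCP.isProbabilityMeasure_claimLaw hclaims
  obtain ⟨W, W', hW, hW', hW'c, hhjb⟩ := PDCP.exists_hjb_solution (Q := Q)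
    (PDCP.lipschitzWith_premium hg).continuous hlam hδ hu₀ (fun y => hgu _ (le_max_right y 0)) hQ
  replace hhjb : ∀ x, 0 ≤ x → max (g x * W' x) ((g x - u₀) * W' x + u₀) =
      (lam + δ) * W x - lam * PDCP.claimMean Q W x := fun x hx => by
    simpa only [max_eq_left hx] using hhjb x hx
  have hV : EqOn (PDCP.restrictedValue P 𝓕 g T Y δ u₀) W (Ici 0) := fun x hx =>
    PDCP.restrictedValue_eq hclaims hg hlam hδ hu₀ hgu hQ hW hW' hW'c hhjb hx
  have hWd : ContDiff ℝ 1 W := contDiff_one_iff_deriv.2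
    ⟨fun y => (hW' y).differentiableAt, by rwa [funext fun y => (hW' y).deriv]⟩
  refine ⟨hWd.contDiffOn.congr hV, fun x hx => ?_⟩
  have hd : derivWithin (PDCP.restrictedValue P 𝓕 g T Y δ u₀) (Ici 0) x = W' x := by
    rw [derivWithin_congr hV (hV hx)]
    exact (hW' x).hasDerivWithinAt.derivWithin (uniqueDiffOn_Ici 0 x hx)
  have hI : ∫ y in Icc 0 x, PDCP.restrictedValue P 𝓕 g T Y δ u₀ (x - y) ∂Q =
      PDCP.claimMean Q W x :=
    setIntegral_congr_fun measurableSet_Icc fun y hy => hV (mem_Ici.2 (sub_nonneg.2 hy.2))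
  rw [hd, hI, hV hx]
  have h := hhjb x hx
  -- the expression is affine in `u`, so its maximum over `[0, u₀]` is attained at an end point
  refine IsGreatest.isLUB ⟨?_, ?_⟩
  · rcases le_total (g x * W' x) ((g x - u₀) * W' x + u₀) with hle | hle
    · rw [max_eq_right hle] at h
      exact ⟨u₀, right_mem_Icc.2 hu₀.le, by linarith⟩
    · rw [max_eq_left hle] at h
      exact ⟨0, left_mem_Icc.2 hu₀.le, by linarith⟩
  · rintro _ ⟨u, hu, rfl⟩
    have h0 := le_max_left (g x * W' x) ((g x - u₀) * W' x + u₀)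
    have h1 := le_max_right (g x * W' x) ((g x - u₀) * W' x + u₀)
    rcases le_total (W' x) 1 with hp | hp
    · nlinarith [hu.1, hu.2]
    · nlinarith [hu.1, hu.2]
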